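/- Let $\mathfrak L$ be a non-empty finite index set, $n=|\mathfrak L|$. For a non-empty compact convex set (body) $A\subset\mathbb R^2$ let $h_A(\theta)=\max_{p\in A}\langle\theta,p\rangle$, $\theta\in\mathbb S^1$, be its support function and $A^*\subset\mathbb S^1\times\mathbb R$ the graph of $h_A$. A common supporting tangent of several bodies is a directed line tangent to each of them and having all of them on its left side. An arrangement indexed by $\mathfrak L$ is a family $\mathcal A=(A_i)_{i\in\mathfrak L}$ of bodies such that: for $i\ne j$ the curves $A_i^*,A_j^*$ cross at each common point, that is, $h_{A_i}-h_{A_j}$ has only isolated zeros and changes sign at each of them (this holds in particular if no point of $A_i\cap A_j$ lies on a common supporting tangent of $A_i$ and $A_j$); no three bodies of the family share a common supporting tangent; and there are only finitely many common supporting tangents of pairs of bodies of the family. Its dual system is $\mathcal A^*=(A_i^*)_{i\in\mathfrak L}$. A swap pair $(\rho,\sigma)$ on $\mathfrak L$ consists of a bijection $\rho:\{1,\dots,n\}\to\mathfrak L$, regarded as a sequence, and a finite sequence $\sigma=(\sigma_1,\dots,\sigma_N)$ of adjacent transpositions, $\sigma_k$ interchanging the entries in positions $H(\sigma_k)$ and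 $H(\sigma_k)+1$, such that $\sigma_N\circ\dots\circ\sigma_1$ is the identity. Two swap pairs are equivalent if they are related by a sequence of the operations: (cyclic shift, for $N\ge1$) replace $(\rho,(\sigma_1,\dots,\sigma_N))$ by $(\sigma_1(\rho),(\sigma_2,\dots,\sigma_N,\sigma_1))$; (independent transposition) interchange $\sigma_k$ and $\sigma_{k+1}$, provided that $|H(\sigma_k)-H(\sigma_{k+1})|>1$. The swap pair of an arrangement $\mathcal A$ is obtained by parametrizing $\mathbb S^1$ by $(0,2\pi]$ and ordering the crossings of $\mathcal A^*$ lexicographically in $(0,2\pi]\times\mathbb R$: $\rho$ lists the indices of the curves from bottom to top before the first crossing, and $H(\sigma_k)$ is $1$ plus the number of curves below the $k$-th crossing. The combinatorial type of $\mathcal A$ is the equivalence class of its swap pair. Theorem. Two arrangements $\mathcal A=(A_i)_{i\in\mathfrak L}$ and $\mathcal B=(B_i)_{i\in\mathfrak L}$ of convex bodies have the same combinatorial type if and only if there is a homeomorphism $\varphi:\mathbb S^1\times\mathbb R\to\mathbb S^1\times\mathbb R$ that preserves orientation (it has local degree $1$ at every point) and preserves $+\infty$ (there is $y_0$ such that for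 every $y\ge y_0$ the second coordinate of $\varphi(\theta,y)$ is positive for all $\theta\in\mathbb S^1$) such that $\varphi(A_i^*)=B_i^*$ for every $i\in\mathfrak L$. -/

import Mathlib

namespace ConvexArrangement

open Set Filter Topology

/-! ### Support functions and common supporting tangents

The Euclidean plane is `ℂ` with its real inner product, and `Circle` is its unit circle.
-/

noncomputable section

/-- The support function `h_A(θ) = max_{p ∈ A} ⟪θ, p⟫` of a body `A`. -/
def supportFn (A : Set ℂ) (θ : Circle) : ℝ :=
  sSup ((fun p : ℂ => inner ℝ (θ : ℂ) p) '' A)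

/-- The directed line with outward normal `θ` (its left side is `{x | ⟪θ, x⟫ ≤ c}`) and offset `c`
is tangent to `A`, with `A` on its left side. -/
def IsSupportingTangent (l : Circle × ℝ) (A : Set ℂ) : Prop :=
  (∀ x ∈ A, inner ℝ (l.1 : ℂ) x ≤ l.2) ∧ ∃ x ∈ A, inner ℝ (l.1 : ℂ) x = l.2

/-- `g` vanishes at `t`, has no other zero near `t`, and changes sign at `t`. -/
def ChangesSignAt (g : ℝ → ℝ) (t : ℝ) : Prop :=
  g t = 0 ∧
    (((∀ᶠ s in 𝓝[<] t, g s < 0) ∧ (∀ᶠ s in 𝓝[>] t, 0 < g s)) ∨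
      ((∀ᶠ s in 𝓝[<] t, 0 < g s) ∧ (∀ᶠ s in 𝓝[>] t, g s < 0)))

/-- The graphs over the circle of `f₁` and `f₂` cross at each point of intersection. -/
def CrossTransversally (f₁ f₂ : Circle → ℝ) : Prop :=
  ∀ t : ℝ, f₁ (Circle.exp t) = f₂ (Circle.exp t) →
    ChangesSignAt (fun s => f₁ (Circle.exp s) - f₂ (Circle.exp s)) t

/-- An arrangement of convex bodies in the plane indexed by `L`. Transversality of two bodies is
expressed through their support curves; by `CrossTransversally.of_disjoint_tangents` below it holds
whenever no common point of the two bodies lies on a common supporting tangent. -/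
structure Arrangement (L : Type*) where
  body : L → Set ℂ
  nonempty_body : ∀ i, (body i).Nonempty
  isCompact_body : ∀ i, IsCompact (body i)
  convex_body : ∀ i, Convex ℝ (body i)
  transversal : ∀ i j, i ≠ j → CrossTransversally (supportFn (body i)) (supportFn (body j))
  no_triple_tangent : ∀ i j k, i ≠ j → i ≠ k → j ≠ k → ∀ l : Circle × ℝ,
    ¬ (IsSupportingTangent l (body i) ∧ IsSupportingTangent l (body j) ∧
      IsSupportingTangent l (body k))
  finite_tangents : {l : Circle × ℝ | ∃ i j, i ≠ j ∧
    IsSupportingTangent l (body i) ∧ IsSupportingTangent l (body j)}.Finite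

/-- The support functions of an arrangement; their graphs are the dual support curves. -/
def Arrangement.support {L : Type*} (A : Arrangement L) (i : L) : Circle → ℝ :=
  supportFn (A.body i)

/-- The dual support curve of the `i`-th body, a closed curve on the cylinder. -/
def Arrangement.dualCurve {L : Type*} (A : Arrangement L) (i : L) : Set (Circle × ℝ) :=
  {q | q.2 = A.support i q.1}

/-! ### Swap pairs and combinatorial types -/

/-- The adjacent transposition of the positions `i` and `i + 1` (positions and heights are counted
from `0`). -/
def adjacentSwap {n : ℕ} (i : Fin (n - 1)) : Equiv.Perm (Fin n) :=
  Equiv.swap ⟨i, by omega⟩ ⟨i + 1, by omega⟩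

/-- A swap pair `(ρ, σ)` on `L`. The `k`-th adjacent transposition of `σ` is recorded by its height.
An adjacent transposition acts on a sequence `x : Fin n → L` by `x ↦ x ∘ adjacentSwap i`, so that
the successive action of `σ` on `x` is `x ↦ x ∘ (product of the list)`. -/
structure SwapPair (L : Type*) [Fintype L] where
  order : Fin (Fintype.card L) ≃ L
  swaps : List (Fin (Fintype.card L - 1))
  prod_eq_one : (swaps.map adjacentSwap).prod = 1

/-- The two elementary operations on swap pairs. -/
inductive SwapPair.Step {L : Type*} [Fintype L] : SwapPair L → SwapPair L → Prop
  | cyclicShift (P Q : SwapPair L) (i : Fin (Fintype.card L - 1))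
      (s : List (Fin (Fintype.card L - 1)))
      (hP : P.swaps = i :: s) (hQ : Q.swaps = s ++ [i])
      (h_order : Q.order = (adjacentSwap i).trans P.order) : SwapPair.Step P Q
  | independent (P Q : SwapPair L) (i j : Fin (Fintype.card L - 1))
      (s t : List (Fin (Fintype.card L - 1)))
      (hP : P.swaps = s ++ i :: j :: t) (hQ : Q.swaps = s ++ j :: i :: t)
      (h_order : Q.order = P.order)
      (h_far : (i : ℕ) + 1 < j ∨ (j : ℕ) + 1 < i) : SwapPair.Step P Q

/-- Equivalence of swap pairs: the equivalence relation generated by the elementary operations. -/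
def SwapPair.Equivalent {L : Type*} [Fintype L] (P Q : SwapPair L) : Prop :=
  Relation.EqvGen SwapPair.Step P Q

/-- The crossings of the curves that are the graphs of `f i`, as points `(t, y)` with `t ∈ (0, 2π]`,
in lexicographic order. -/
def crossings {L : Type*} (f : L → Circle → ℝ) : Set (ℝ ×ₗ ℝ) :=
  {p | (ofLex p).1 ∈ Ioc 0 (2 * Real.pi) ∧ ∃ i j, i ≠ j ∧
    f i (Circle.exp (ofLex p).1) = (ofLex p).2 ∧ f j (Circle.exp (ofLex p).1) = (ofLex p).2}

/-- `P` is the swap pair of the system of curves that are the graphs of `f i`: before the first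
crossing the curves are, from bottom to top, in the order `P.order`; and `P.swaps` lists, for the
crossings in increasing order, the number of curves below the crossing. -/
structure IsSwapPairOf {L : Type*} [Fintype L] (f : L → Circle → ℝ) (P : SwapPair L) : Prop where
  order_before : ∀ t ∈ Ioc 0 (2 * Real.pi), (∀ p ∈ crossings f, t < (ofLex p).1) →
    StrictMono fun a => f (P.order a) (Circle.exp t)
  swaps_eq : ∃ c : List (ℝ ×ₗ ℝ), c.Pairwise (· < ·) ∧ (∀ p, p ∈ c ↔ p ∈ crossings f) ∧
    P.swaps.map (fun i => (i : ℕ)) =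
      c.map (fun p => {k : L | f k (Circle.exp (ofLex p).1) < (ofLex p).2}.ncard)

/-- The combinatorial type of an arrangement: the equivalence class of the swap pair of its dual
support system. -/
def Arrangement.combinatorialType {L : Type*} [Fintype L] (A : Arrangement L) : Set (SwapPair L) :=
  {Q | ∃ P, IsSwapPairOf A.support P ∧ P.Equivalent Q}

/-! ### Homeomorphisms of the cylinder -/

/-- The closed plane curve `γ` (parametrized by `[0, 2π]`) avoids the origin and winds exactly once
around it, counter-clockwise: a continuous choice of its argument increases by `2π`. -/
def WindsOnce (γ : ℝ → ℂ) : Prop :=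
  ∃ α : ℝ → ℝ, ContinuousOn α (Icc 0 (2 * Real.pi)) ∧
    (∀ t ∈ Icc 0 (2 * Real.pi), γ t ≠ 0 ∧ γ t = ‖γ t‖ * Complex.exp (α t * Complex.I)) ∧
    α (2 * Real.pi) = α 0 + 2 * Real.pi

/-- The positively oriented circle of radius `r` around the point `p` of the cylinder. -/
def smallCircle (p : Circle × ℝ) (r t : ℝ) : Circle × ℝ :=
  (p.1 * Circle.exp (r * Real.cos t), p.2 + r * Real.sin t)

/-- The displacement from `p` to `q` in the local coordinates (angle, height) centred at `p`. -/
def displacement (p q : Circle × ℝ) : ℂ :=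
  ⟨Complex.arg ((q.1 / p.1 : Circle) : ℂ), q.2 - p.2⟩

/-- A self-homeomorphism of the cylinder preserves orientation when it has local degree `1` at every
point: the image of each small positively oriented circle around `p` winds once,
counter-clockwise, around the image of `p`. -/
def PreservesOrientation (φ : Circle × ℝ ≃ₜ Circle × ℝ) : Prop :=
  ∀ p, ∀ᶠ r in 𝓝[>] (0 : ℝ), WindsOnce fun t => displacement (φ p) (φ (smallCircle p r t))

/-- For `y` sufficiently large, the second coordinate of `φ (θ, y)` is positive for all `θ`. -/
def PreservesTop (φ : Circle × ℝ ≃ₜ Circle × ℝ) : Prop :=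
  ∃ y₀ : ℝ, ∀ y ≥ y₀, ∀ θ : Circle, 0 < (φ (θ, y)).2

/-! ### Transversality in terms of bodies -/

theorem bddAbove_inner {A : Set ℂ} (hA : IsCompact A) (θ : Circle) :
    BddAbove ((fun p : ℂ => inner ℝ (θ : ℂ) p) '' A) :=
  (hA.image (by fun_prop)).bddAbove

theorem inner_le_supportFn {A : Set ℂ} (hA : IsCompact A) (θ : Circle) {p : ℂ} (hp : p ∈ A) :
    inner ℝ (θ : ℂ) p ≤ supportFn A θ :=
  le_csSup (bddAbove_inner hA θ) (mem_image_of_mem _ hp)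

theorem exists_inner_eq_supportFn {A : Set ℂ} (hA : IsCompact A) (hne : A.Nonempty) (θ : Circle) :
    ∃ p ∈ A, inner ℝ (θ : ℂ) p = supportFn A θ :=
  (hA.image (by fun_prop)).sSup_mem (hne.image _)

theorem isSupportingTangent_iff {A : Set ℂ} (hA : IsCompact A) (hne : A.Nonempty)
    (l : Circle × ℝ) : IsSupportingTangent l A ↔ supportFn A l.1 = l.2 := by
  constructor
  · rintro ⟨h1, x, hx, hxl⟩
    obtain ⟨p, hp, hpe⟩ := exists_inner_eq_supportFn hA hne l.1
    have := inner_le_supportFn hA l.1 hx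
    have := h1 p hp
    linarith
  · intro h
    obtain ⟨p, hp, hpe⟩ := exists_inner_eq_supportFn hA hne l.1
    exact ⟨fun x hx => h ▸ inner_le_supportFn hA l.1 hx, p, hp, hpe.trans h⟩

theorem inner_exp (t : ℝ) (p : ℂ) :
    inner ℝ (Circle.exp t : ℂ) p = Real.cos t * p.re + Real.sin t * p.im := by
  rw [Circle.coe_exp, Complex.inner, Complex.exp_mul_I, ← Complex.ofReal_cos, ← Complex.ofReal_sin]
  simp [-Complex.ofReal_cos, -Complex.ofReal_sin]
  ring

theorem inner_I_mul_exp (t : ℝ) (p : ℂ) :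
    inner ℝ (Complex.I * (Circle.exp t : ℂ)) p = Real.cos t * p.im - Real.sin t * p.re := by
  rw [Circle.coe_exp, Complex.inner, Complex.exp_mul_I, ← Complex.ofReal_cos, ← Complex.ofReal_sin]
  simp [-Complex.ofReal_cos, -Complex.ofReal_sin]
  ring

theorem inner_exp_eq (t s : ℝ) (p : ℂ) :
    inner ℝ (Circle.exp s : ℂ) p = Real.cos (s - t) * inner ℝ (Circle.exp t : ℂ) p +
      Real.sin (s - t) * inner ℝ (Complex.I * (Circle.exp t : ℂ)) p := by
  have hs : s = t + (s - t) := by ring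
  generalize s - t = u at hs
  subst hs
  rw [inner_exp, inner_exp, inner_I_mul_exp, Real.cos_add, Real.sin_add]
  ring

theorem eventually_supportFn_lt {A B : Set ℂ} (hA : IsCompact A) (hB : IsCompact B)
    (hBne : B.Nonempty) (t e : ℝ) (h : supportFn A (Circle.exp t) = supportFn B (Circle.exp t))
    {p : ℂ} (hp : p ∈ A) (hpt : inner ℝ (Circle.exp t : ℂ) p = supportFn A (Circle.exp t))
    (hlt : ∀ q ∈ B, inner ℝ (Circle.exp t : ℂ) q = supportFn B (Circle.exp t) →
      e * inner ℝ (Complex.I * (Circle.exp t : ℂ)) q <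
        e * inner ℝ (Complex.I * (Circle.exp t : ℂ)) p) :
    ∀ᶠ s in 𝓝 t, (∃ d > 0, Real.sin (s - t) = d * e) → 0 < Real.cos (s - t) →
      supportFn B (Circle.exp s) < supportFn A (Circle.exp s) := by
  set T : ℂ → ℝ := fun q => inner ℝ (Complex.I * (Circle.exp t : ℂ)) q with hT
  have hTc : Continuous T := by fun_prop
  have hK : IsCompact (B ∩ {q | e * T p ≤ e * T q}) :=
    hB.inter_right (isClosed_le continuous_const (by fun_prop))
  have key : ∀ᶠ s in 𝓝 t, ∀ q ∈ B ∩ {q | e * T p ≤ e * T q},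
      inner ℝ (Circle.exp s : ℂ) q < inner ℝ (Circle.exp s : ℂ) p := by
    apply hK.eventually_forall_of_forall_eventually
    rintro q ⟨hq, hqT⟩
    have h0 : inner ℝ (Circle.exp t : ℂ) q < inner ℝ (Circle.exp t : ℂ) p := by
      rw [hpt, h]
      refine lt_of_le_of_ne (inner_le_supportFn hB _ hq) fun he => ?_
      exact absurd (hlt q hq he) (not_lt.2 hqT)
    have c1 : Continuous fun z : ℝ × ℂ => inner ℝ (Circle.exp z.1 : ℂ) z.2 := by fun_prop
    have c2 : Continuous fun z : ℝ × ℂ => inner ℝ (Circle.exp z.1 : ℂ) p := by fun_prop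
    exact (c1.continuousAt (x := (t, q))).eventually_lt (c2.continuousAt (x := (t, q))) h0
  filter_upwards [key] with s hs hsin hcos
  obtain ⟨d, hd, hde⟩ := hsin
  obtain ⟨q, hq, hqs⟩ := exists_inner_eq_supportFn hB hBne (Circle.exp s)
  rw [← hqs]
  refine lt_of_lt_of_le ?_ (inner_le_supportFn hA (Circle.exp s) hp)
  by_cases hqT : e * T p ≤ e * T q
  · exact hs q ⟨hq, hqT⟩
  · rw [inner_exp_eq t s q, inner_exp_eq t s p, hde]
    have h1 : inner ℝ (Circle.exp t : ℂ) q ≤ inner ℝ (Circle.exp t : ℂ) p := by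
      rw [hpt, h]; exact inner_le_supportFn hB _ hq
    have h2 := mul_le_mul_of_nonneg_left h1 hcos.le
    have h3 := mul_lt_mul_of_pos_left (not_le.1 hqT) hd
    simp only [hT] at h3
    nlinarith

theorem eventually_sin_cos (t : ℝ) : ∀ᶠ s in 𝓝 t,
    0 < Real.cos (s - t) ∧ (t < s → 0 < Real.sin (s - t)) ∧ (s < t → Real.sin (s - t) < 0) := by
  have hpi := Real.pi_gt_three
  filter_upwards [Ioo_mem_nhds (show t - 1 < t by linarith) (show t < t + 1 by linarith)]
    with s hs
  exact ⟨Real.cos_pos_of_mem_Ioo ⟨by linarith [hs.1], by linarith [hs.2]⟩,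
    fun h => Real.sin_pos_of_pos_of_lt_pi (by linarith) (by linarith [hs.2]),
    fun h => Real.sin_neg_of_neg_of_neg_pi_lt (by linarith) (by linarith [hs.1])⟩

/-- If no common point of two bodies lies on a common supporting tangent, then their dual support
curves cross at each point of intersection. -/
theorem CrossTransversally.of_disjoint_tangents {A B : Set ℂ} (hA : IsCompact A) (hB : IsCompact B)
    (hAne : A.Nonempty) (hBne : B.Nonempty) (hAc : Convex ℝ A) (hBc : Convex ℝ B)
    (hAB : ∀ l : Circle × ℝ, IsSupportingTangent l A → IsSupportingTangent l B →
      ∀ x ∈ A ∩ B, inner ℝ (l.1 : ℂ) x ≠ l.2) :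
    CrossTransversally (supportFn A) (supportFn B) := by
  intro t h
  refine ⟨sub_eq_zero.2 h, ?_⟩
  have hdis : ∀ x ∈ A ∩ B, inner ℝ (Circle.exp t : ℂ) x ≠ supportFn A (Circle.exp t) :=
    hAB (Circle.exp t, supportFn A (Circle.exp t)) ((isSupportingTangent_iff hA hAne _).2 rfl)
      ((isSupportingTangent_iff hB hBne _).2 h.symm)
  set c := supportFn A (Circle.exp t) with hc
  set T : ℂ → ℝ := fun q => inner ℝ (Complex.I * (Circle.exp t : ℂ)) q with hT
  set FA := A ∩ {x | inner ℝ (Circle.exp t : ℂ) x = c} with hFA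
  set FB := B ∩ {x | inner ℝ (Circle.exp t : ℂ) x = c} with hFB
  have hlin : ∀ θ : ℂ, IsLinearMap ℝ (fun x : ℂ => inner ℝ θ x) := fun θ =>
    ⟨fun x y => inner_add_right _ _ _, fun a x => real_inner_smul_right _ _ _⟩
  have hplane : Convex ℝ {x : ℂ | inner ℝ (Circle.exp t : ℂ) x = c} :=
    convex_hyperplane (hlin _) c
  have hTA : (T '' FA).OrdConnected :=
    ((hAc.inter hplane).is_linear_image (hlin _)).ordConnected
  have hTB : (T '' FB).OrdConnected :=
    ((hBc.inter hplane).is_linear_image (hlin _)).ordConnected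
  obtain ⟨a, haA, hac⟩ := exists_inner_eq_supportFn hA hAne (Circle.exp t)
  obtain ⟨b, hbB, hbc⟩ := exists_inner_eq_supportFn hB hBne (Circle.exp t)
  have ha : a ∈ FA := ⟨haA, hac⟩
  have hb : b ∈ FB := ⟨hbB, hbc.trans h.symm⟩
  have hTinj : ∀ x ∈ FA, ∀ y ∈ FB, T x ≠ T y := by
    intro x hx y hy hxy
    have hxy' : x = y := by
      have h1 : inner ℝ (Circle.exp t : ℂ) x = inner ℝ (Circle.exp t : ℂ) y := hx.2.trans hy.2.symm
      have h2 : T x = T y := hxy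
      have hn := Real.sin_sq_add_cos_sq t
      simp only [hT] at h2
      rw [inner_I_mul_exp, inner_I_mul_exp] at h2
      rw [inner_exp, inner_exp] at h1
      generalize Real.sin t = u at *
      generalize Real.cos t = v at *
      apply Complex.ext
      · linear_combination v * h1 - u * h2 - (x.re - y.re) * hn
      · linear_combination u * h1 + v * h2 - (x.im - y.im) * hn
    subst hxy'
    exact hdis x ⟨hx.1, hy.1⟩ hx.2
  have hsep : (∀ x ∈ FA, ∀ y ∈ FB, T x < T y) ∨ (∀ x ∈ FA, ∀ y ∈ FB, T y < T x) := by
    have hpre : IsPreconnected ((T '' FA) ×ˢ (T '' FB)) :=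
      hTA.isPreconnected.prod hTB.isPreconnected
    by_contra hcon
    push Not at hcon
    obtain ⟨⟨x, hx, y, hy, hxy⟩, x', hx', y', hy', hxy'⟩ := hcon
    obtain ⟨z, hz, hz0⟩ := hpre.intermediate_value
      (a := (T x', T y')) (b := (T x, T y)) ⟨mem_image_of_mem _ hx', mem_image_of_mem _ hy'⟩
      ⟨mem_image_of_mem _ hx, mem_image_of_mem _ hy⟩
      (f := fun z : ℝ × ℝ => z.1 - z.2) (by fun_prop)
      (show (0 : ℝ) ∈ Icc (T x' - T y') (T x - T y) from ⟨by linarith, by linarith⟩)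
    obtain ⟨⟨u, hu, hu'⟩, v, hv, hv'⟩ := hz
    refine hTinj u hu v hv ?_
    have : z.1 - z.2 = 0 := hz0
    linarith
  have hfaceA : ∀ x ∈ A, inner ℝ (Circle.exp t : ℂ) x = supportFn A (Circle.exp t) → x ∈ FA :=
    fun x hx hxe => ⟨hx, hxe⟩
  have hfaceB : ∀ x ∈ B, inner ℝ (Circle.exp t : ℂ) x = supportFn B (Circle.exp t) → x ∈ FB :=
    fun x hx hxe => ⟨hx, hxe.trans h.symm⟩
  have hsc := eventually_sin_cos t
  rcases hsep with hsep | hsep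
  · right
    have e1 := eventually_supportFn_lt hA hB hBne t (-1) h haA hac
      (fun q hq hqe => by have := hsep a ha q (hfaceB q hq hqe); simp only [hT] at this; linarith)
    have e2 := eventually_supportFn_lt hB hA hAne t 1 h.symm hbB hbc
      (fun q hq hqe => by have := hsep q (hfaceA q hq hqe) b hb; simp only [hT] at this; linarith)
    constructor
    · filter_upwards [e1.filter_mono nhdsWithin_le_nhds, hsc.filter_mono nhdsWithin_le_nhds,
        self_mem_nhdsWithin] with s h1 h2 h3
      exact sub_pos.2 (h1 ⟨-Real.sin (s - t), by linarith [h2.2.2 h3], by ring⟩ h2.1)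
    · filter_upwards [e2.filter_mono nhdsWithin_le_nhds, hsc.filter_mono nhdsWithin_le_nhds,
        self_mem_nhdsWithin] with s h1 h2 h3
      exact sub_neg.2 (h1 ⟨Real.sin (s - t), by linarith [h2.2.1 h3], by ring⟩ h2.1)
  · left
    have e1 := eventually_supportFn_lt hA hB hBne t 1 h haA hac
      (fun q hq hqe => by have := hsep a ha q (hfaceB q hq hqe); simp only [hT] at this; linarith)
    have e2 := eventually_supportFn_lt hB hA hAne t (-1) h.symm hbB hbc
      (fun q hq hqe => by have := hsep q (hfaceA q hq hqe) b hb; simp only [hT] at this; linarith)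
    constructor
    · filter_upwards [e2.filter_mono nhdsWithin_le_nhds, hsc.filter_mono nhdsWithin_le_nhds,
        self_mem_nhdsWithin] with s h1 h2 h3
      exact sub_neg.2 (h1 ⟨-Real.sin (s - t), by linarith [h2.2.2 h3], by ring⟩ h2.1)
    · filter_upwards [e1.filter_mono nhdsWithin_le_nhds, hsc.filter_mono nhdsWithin_le_nhds,
        self_mem_nhdsWithin] with s h1 h2 h3
      exact sub_pos.2 (h1 ⟨Real.sin (s - t), by linarith [h2.2.1 h3], by ring⟩ h2.1)

end

end ConvexArrangement

namespace ConvexArrangement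

open Set Filter Topology

/-! ### Winding once -/

theorem WindsOnce.of_norm_sub_lt {γ₀ γ₁ : ℝ → ℂ} (h : WindsOnce γ₀)
    (h₀ : ContinuousOn γ₀ (Icc 0 (2 * Real.pi))) (h₁ : ContinuousOn γ₁ (Icc 0 (2 * Real.pi)))
    (c₀ : γ₀ (2 * Real.pi) = γ₀ 0) (c₁ : γ₁ (2 * Real.pi) = γ₁ 0)
    (hlt : ∀ t ∈ Icc 0 (2 * Real.pi), ‖γ₁ t - γ₀ t‖ < ‖γ₀ t‖) : WindsOnce γ₁ := by
  obtain ⟨α, hα, hγ, hclose⟩ := h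
  have hslit : ∀ t ∈ Icc 0 (2 * Real.pi), γ₁ t / γ₀ t ∈ Complex.slitPlane := by
    intro t ht
    have h0 := (hγ t ht).1
    have hn : ‖γ₁ t / γ₀ t - 1‖ < 1 := by
      rw [div_sub_one h0, norm_div, div_lt_one (norm_pos_iff.2 h0)]
      exact hlt t ht
    simpa using Complex.mem_slitPlane_of_norm_lt_one hn
  refine ⟨fun t => α t + Complex.arg (γ₁ t / γ₀ t), ?_, ?_, ?_⟩
  · refine hα.add fun t ht => ?_
    exact (Complex.continuousAt_arg (hslit t ht)).comp_continuousWithinAt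
      (f := fun t => γ₁ t / γ₀ t) ((h₁ t ht).div (h₀ t ht) (hγ t ht).1)
  · intro t ht
    have h0 := (hγ t ht).1
    have hq := Complex.slitPlane_ne_zero (hslit t ht)
    refine ⟨fun h => hq (by simp [h]), ?_⟩
    have e1 := Complex.norm_mul_exp_arg_mul_I (γ₁ t / γ₀ t)
    have e2 := (hγ t ht).2
    push_cast
    rw [add_mul, Complex.exp_add]
    have : γ₁ t = (γ₁ t / γ₀ t) * γ₀ t := by field_simp
    rw [norm_div] at e1
    have hn : (‖γ₀ t‖ : ℂ) ≠ 0 := by exact_mod_cast norm_ne_zero_iff.2 h0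
    calc γ₁ t = (γ₁ t / γ₀ t) * γ₀ t := this
      _ = (((‖γ₁ t‖ / ‖γ₀ t‖ : ℝ) : ℂ) * Complex.exp (Complex.arg (γ₁ t / γ₀ t) * Complex.I)) *
          (‖γ₀ t‖ * Complex.exp (α t * Complex.I)) := by rw [e1, ← e2]
      _ = _ := by push_cast; field_simp
  · simp only [c₀, c₁, hclose]; ring

theorem WindsOnce.of_homotopy {F : ℝ → ℝ → ℂ}
    (hF : ContinuousOn (Function.uncurry F) (Icc 0 1 ×ˢ Icc 0 (2 * Real.pi)))
    (hne : ∀ u ∈ Icc (0 : ℝ) 1, ∀ t ∈ Icc 0 (2 * Real.pi), F u t ≠ 0)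
    (hc : ∀ u ∈ Icc (0 : ℝ) 1, F u (2 * Real.pi) = F u 0) (h : WindsOnce (F 0)) :
    WindsOnce (F 1) := by
  have hpi := Real.pi_pos
  have hK : IsCompact (Icc (0 : ℝ) 1 ×ˢ Icc 0 (2 * Real.pi)) := isCompact_Icc.prod isCompact_Icc
  obtain ⟨m, hm, hmle⟩ : ∃ m > 0, ∀ x ∈ Icc (0 : ℝ) 1 ×ˢ Icc 0 (2 * Real.pi),
      m ≤ ‖Function.uncurry F x‖ := by
    obtain ⟨x, hx, hmin⟩ := hK.exists_isMinOn
      ⟨(0, 0), by simp, by simp [hpi.le]⟩ hF.norm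
    exact ⟨_, norm_pos_iff.2 (hne x.1 hx.1 x.2 hx.2), fun y hy => hmin hy⟩
  obtain ⟨δ, hδ, hδF⟩ := Metric.uniformContinuousOn_iff.1
    (hK.uniformContinuousOn_of_continuous hF) m hm
  obtain ⟨n, hn⟩ := exists_nat_gt (1 / δ)
  have hn0 : (0 : ℝ) < n := lt_trans (by positivity) hn
  have hslice : ∀ u ∈ Icc (0 : ℝ) 1, ContinuousOn (F u) (Icc 0 (2 * Real.pi)) := fun u hu =>
    hF.comp (f := fun t => (u, t)) (by fun_prop) fun t ht => ⟨hu, ht⟩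
  have key : ∀ k : ℕ, k ≤ n → WindsOnce (F (k / n)) := by
    intro k
    induction k with
    | zero => simpa using h
    | succ k ih =>
      intro hk
      have hk' : (k : ℝ) + 1 ≤ n := by exact_mod_cast hk
      have u0 : (k / n : ℝ) ∈ Icc (0 : ℝ) 1 :=
        ⟨by positivity, (div_le_one hn0).2 (by linarith)⟩
      have u1 : ((k + 1 : ℕ) / n : ℝ) ∈ Icc (0 : ℝ) 1 :=
        ⟨by positivity, (div_le_one hn0).2 (by push_cast; linarith)⟩
      refine (ih (by omega)).of_norm_sub_lt (hslice _ u0) (hslice _ u1) (hc _ u0) (hc _ u1) ?_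
      intro t ht
      have := hδF (_, t) ⟨u1, ht⟩ (_, t) ⟨u0, ht⟩ (by
        rw [Prod.dist_eq]
        simp only [dist_self, Real.dist_eq]
        have : ((k + 1 : ℕ) / n : ℝ) - k / n = 1 / n := by push_cast; ring
        rw [this, abs_of_pos (by positivity), max_eq_left (by positivity)]
        rw [div_lt_iff₀ hδ] at hn
        rw [div_lt_iff₀ hn0]; linarith)
      rw [dist_eq_norm] at this
      exact this.trans_le (hmle (_, t) ⟨u0, ht⟩)
  have := key n le_rfl
  rwa [div_self hn0.ne'] at this

theorem windsOnce_circle {r : ℝ} (hr : 0 < r) :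
    WindsOnce fun t => ⟨r * Real.cos t, r * Real.sin t⟩ := by
  have e : ∀ t : ℝ, (⟨r * Real.cos t, r * Real.sin t⟩ : ℂ) = r * Complex.exp (t * Complex.I) := by
    intro t
    rw [Complex.exp_mul_I, ← Complex.ofReal_cos, ← Complex.ofReal_sin]
    apply Complex.ext <;> simp [-Complex.ofReal_cos, -Complex.ofReal_sin]
  have hn : ∀ t : ℝ, ‖(⟨r * Real.cos t, r * Real.sin t⟩ : ℂ)‖ = r := by
    intro t; rw [e, norm_mul, Complex.norm_exp_ofReal_mul_I]; simp [abs_of_pos hr]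
  refine ⟨id, continuousOn_id, fun t _ => ⟨?_, ?_⟩, by simp⟩
  · rw [← norm_pos_iff, hn]; exact hr
  · have h1 := e t
    have h2 := hn t
    simp only [id]
    rw [h2, h1]

theorem not_windsOnce_reversed_circle :
    ¬ WindsOnce fun t => ⟨-Real.cos t, Real.sin t⟩ := by
  rintro ⟨α, hα, hγ, hc⟩
  have e : ∀ t : ℝ, (⟨-Real.cos t, Real.sin t⟩ : ℂ) =
      Complex.exp (((Real.pi - t : ℝ) : ℂ) * Complex.I) := by
    intro t
    rw [Complex.exp_mul_I, ← Complex.ofReal_cos, ← Complex.ofReal_sin, Real.cos_pi_sub,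
      Real.sin_pi_sub]
    apply Complex.ext <;> simp [-Complex.ofReal_cos, -Complex.ofReal_sin]
  have hpi := Real.pi_pos
  have hint : ∀ t ∈ Icc 0 (2 * Real.pi), Real.sin ((α t - (Real.pi - t)) / 2) = 0 := by
    intro t ht
    have h2 := (hγ t ht).2
    have hn : ‖(⟨-Real.cos t, Real.sin t⟩ : ℂ)‖ = 1 := by
      rw [e, Complex.norm_exp_ofReal_mul_I]
    simp only [hn] at h2
    rw [e, Complex.ofReal_one, one_mul, Complex.exp_eq_exp_iff_exists_int] at h2
    obtain ⟨m, hm⟩ := h2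
    have : (Real.pi - t : ℝ) = α t + m * (2 * Real.pi) := by
      have : ((Real.pi - t : ℝ) : ℂ) * Complex.I = ((α t + m * (2 * Real.pi) : ℝ) : ℂ) * Complex.I := by
        rw [hm]; push_cast; ring
      exact_mod_cast mul_right_cancel₀ Complex.I_ne_zero this
    rw [this, Real.sin_eq_zero_iff]
    exact ⟨-m, by push_cast; ring⟩
  have h0 : (0 : ℝ) ≤ 2 * Real.pi := by linarith
  obtain ⟨k, hk⟩ := Real.sin_eq_zero_iff.1 (hint 0 ⟨le_rfl, h0⟩)
  have hcont : ContinuousOn (fun t => (α t - (Real.pi - t)) / 2) (Icc 0 (2 * Real.pi)) := by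
    fun_prop
  obtain ⟨t, ht, hte⟩ := intermediate_value_Icc h0 hcont
    (show (k * Real.pi + Real.pi / 2) ∈ _ by
      rw [hk, hc]; constructor <;> linarith)
  have h3 := hint t ht
  simp only at hte
  rw [hte, add_comm, Real.sin_add_int_mul_pi] at h3
  simp [zpow_ne_zero] at h3

/-! ### Local coordinates on the cylinder -/

/-- The point of the cylinder with coordinates `(a, b)` with respect to `p`. -/
noncomputable def shift (p : Circle × ℝ) (a b : ℝ) : Circle × ℝ := (p.1 * Circle.exp a, p.2 + b)

theorem continuous_shift (p : Circle × ℝ) : Continuous fun x : ℝ × ℝ => shift p x.1 x.2 := by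
  unfold shift; fun_prop

@[simp] theorem shift_zero (p : Circle × ℝ) : shift p 0 0 = p := by simp [shift]

theorem shift_shift (p : Circle × ℝ) (a b c d : ℝ) :
    shift (shift p a b) c d = shift p (a + c) (b + d) := by
  simp [shift, mul_assoc, add_assoc]

theorem smallCircle_eq_shift (p : Circle × ℝ) (r t : ℝ) :
    smallCircle p r t = shift p (r * Real.cos t) (r * Real.sin t) := rfl

theorem shift_inj {p : Circle × ℝ} {a b c d : ℝ} (h : shift p a b = shift p c d)
    (hac : |a - c| < 2 * Real.pi) : a = c ∧ b = d := by
  simp only [shift, Prod.mk.injEq, mul_right_inj, add_right_inj] at h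
  refine ⟨?_, h.2⟩
  obtain ⟨m, hm⟩ := Circle.exp_eq_exp.1 h.1
  have hpi := Real.pi_pos
  rw [hm, add_sub_cancel_left, abs_mul, abs_of_pos (show 0 < 2 * Real.pi by positivity)] at hac
  have : |(m : ℝ)| < 1 := by nlinarith
  have : m = 0 := by
    rw [← Int.cast_abs] at this
    exact Int.abs_lt_one_iff.1 (by exact_mod_cast this)
  simp [hm, this]

theorem displacement_eq_zero {p q : Circle × ℝ} (h : displacement p q = 0) : p = q := by
  have h1 := congrArg Complex.re h
  have h2 := congrArg Complex.im h
  simp only [displacement, Complex.zero_re, Complex.zero_im] at h1 h2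
  have h3 := Circle.arg_eq_zero.1 h1
  exact Prod.ext (div_eq_one.1 h3).symm (by linarith)

theorem continuousAt_displacement {x : (Circle × ℝ) × (Circle × ℝ)}
    (h : ((x.2.1 / x.1.1 : Circle) : ℂ) ∈ Complex.slitPlane) :
    ContinuousAt (fun x : (Circle × ℝ) × (Circle × ℝ) => displacement x.1 x.2) x := by
  have e : (fun x : (Circle × ℝ) × (Circle × ℝ) => displacement x.1 x.2) = fun x =>
      (Complex.arg ((x.2.1 / x.1.1 : Circle) : ℂ) : ℂ) + ((x.2.2 - x.1.2 : ℝ) : ℂ) * Complex.I := by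
    funext x
    apply Complex.ext <;> simp [displacement]
  rw [e]
  refine ContinuousAt.add ?_ (by fun_prop)
  refine Complex.continuous_ofReal.continuousAt.comp ?_
  have hq : Continuous fun x : (Circle × ℝ) × (Circle × ℝ) => x.2.1 / x.1.1 :=
    (continuous_fst.comp continuous_snd).div' (continuous_fst.comp continuous_fst)
  exact ContinuousAt.comp (f := fun x : (Circle × ℝ) × (Circle × ℝ) =>
    ((x.2.1 / x.1.1 : Circle) : ℂ)) (Complex.continuousAt_arg h)
    (continuous_subtype_val.comp hq).continuousAt

/-- Near `p`, displacements between images of points are given by the principal argument. -/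
theorem exists_slitPlane {φ : Circle × ℝ → Circle × ℝ} (hφ : Continuous φ) (p : Circle × ℝ) :
    ∃ R > 0, R ≤ 1 ∧ ∀ a b c d : ℝ, |a| < R → |b| < R → |c| < R → |d| < R →
      (((φ (shift p c d)).1 / (φ (shift p a b)).1 : Circle) : ℂ) ∈ Complex.slitPlane := by
  have hs := continuous_shift p
  have hc : Continuous fun x : (ℝ × ℝ) × (ℝ × ℝ) =>
      (((φ (shift p x.2.1 x.2.2)).1 / (φ (shift p x.1.1 x.1.2)).1 : Circle) : ℂ) := by
    have h1 : Continuous fun x : (ℝ × ℝ) × (ℝ × ℝ) => φ (shift p x.2.1 x.2.2) :=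
      hφ.comp (hs.comp continuous_snd)
    have h2 : Continuous fun x : (ℝ × ℝ) × (ℝ × ℝ) => φ (shift p x.1.1 x.1.2) :=
      hφ.comp (hs.comp continuous_fst)
    exact continuous_subtype_val.comp (h1.fst.div' h2.fst)
  have h0 : (((φ (shift p 0 0)).1 / (φ (shift p 0 0)).1 : Circle) : ℂ) ∈ Complex.slitPlane := by
    rw [div_self']
    exact Complex.one_mem_slitPlane
  have hn := (hc.tendsto ((0, 0), (0, 0))).eventually (Complex.isOpen_slitPlane.mem_nhds h0)
  obtain ⟨R, hR, hball⟩ := Metric.eventually_nhds_iff.1 hn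
  refine ⟨min R 1, by positivity, min_le_right _ _, fun a b c d ha hb hc hd => ?_⟩
  refine @hball ((a, b), (c, d)) ?_
  simp only [Prod.dist_eq, Real.dist_eq, sub_zero, max_lt_iff]
  exact ⟨⟨ha.trans_le (min_le_left _ _), hb.trans_le (min_le_left _ _)⟩,
    hc.trans_le (min_le_left _ _), hd.trans_le (min_le_left _ _)⟩

/-- A deformation of loops near `p` does not change the winding of their images under an injective
continuous map. -/
theorem WindsOnce.of_deformation {φ : Circle × ℝ → Circle × ℝ} (hφ : Continuous φ)
    (hinj : Function.Injective φ) {p : Circle × ℝ} {R : ℝ} (hR1 : R ≤ 1)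
    (hR : ∀ a b c d : ℝ, |a| < R → |b| < R → |c| < R → |d| < R →
      (((φ (shift p c d)).1 / (φ (shift p a b)).1 : Circle) : ℂ) ∈ Complex.slitPlane)
    {a b : ℝ → ℝ} {c d : ℝ → ℝ → ℝ} (ha : Continuous a) (hb : Continuous b)
    (hc : Continuous (Function.uncurry c)) (hd : Continuous (Function.uncurry d))
    (haR : ∀ u ∈ Icc (0 : ℝ) 1, |a u| < R) (hbR : ∀ u ∈ Icc (0 : ℝ) 1, |b u| < R)
    (hcR : ∀ u ∈ Icc (0 : ℝ) 1, ∀ t, |c u t| < R) (hdR : ∀ u ∈ Icc (0 : ℝ) 1, ∀ t, |d u t| < R)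
    (hne : ∀ u ∈ Icc (0 : ℝ) 1, ∀ t, c u t = a u → d u t ≠ b u)
    (hcc : ∀ u, c u (2 * Real.pi) = c u 0) (hdc : ∀ u, d u (2 * Real.pi) = d u 0)
    (h : WindsOnce fun t =>
      displacement (φ (shift p (a 0) (b 0))) (φ (shift p (c 0 t) (d 0 t)))) :
    WindsOnce fun t => displacement (φ (shift p (a 1) (b 1))) (φ (shift p (c 1 t) (d 1 t))) := by
  refine WindsOnce.of_homotopy (F := fun u t =>
    displacement (φ (shift p (a u) (b u))) (φ (shift p (c u t) (d u t)))) ?_ ?_ ?_ h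
  · rintro ⟨u, t⟩ ⟨hu, ht⟩
    apply ContinuousAt.continuousWithinAt
    have hs := continuous_shift p
    have h1 : Continuous fun x : ℝ × ℝ => φ (shift p (a x.1) (b x.1)) :=
      hφ.comp (hs.comp ((ha.comp continuous_fst).prodMk (hb.comp continuous_fst)))
    have h2 : Continuous fun x : ℝ × ℝ => φ (shift p (c x.1 x.2) (d x.1 x.2)) :=
      hφ.comp (hs.comp (hc.prodMk hd))
    exact ContinuousAt.comp (f := fun x : ℝ × ℝ =>
      (φ (shift p (a x.1) (b x.1)), φ (shift p (c x.1 x.2) (d x.1 x.2))))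
      (continuousAt_displacement
        (hR _ _ _ _ (haR u hu) (hbR u hu) (hcR u hu t) (hdR u hu t)))
      (h1.prodMk h2).continuousAt
  · intro u hu t ht h0
    have h1 := hinj (displacement_eq_zero h0)
    obtain ⟨e1, e2⟩ := shift_inj h1 (by
      have := abs_sub (a u) (c u t)
      have := haR u hu
      have := hcR u hu t
      have := Real.pi_gt_three
      linarith)
    exact hne u hu t e1.symm e2.symm
  · intro u _
    simp only [hcc, hdc]

/-- Local degree `1` at a single point. -/
def HasLocalDegreeOne (φ : Circle × ℝ → Circle × ℝ) (p : Circle × ℝ) : Prop :=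
  ∀ᶠ r in 𝓝[>] (0 : ℝ), WindsOnce fun t => displacement (φ p) (φ (smallCircle p r t))

theorem exists_hasLocalDegreeOne_iff {φ : Circle × ℝ → Circle × ℝ} (hφ : Continuous φ)
    (hinj : Function.Injective φ) (p : Circle × ℝ) :
    ∃ ε > 0, ∀ a b : ℝ, |a| < ε → |b| < ε →
      (HasLocalDegreeOne φ (shift p a b) ↔ HasLocalDegreeOne φ p) := by
  obtain ⟨R, hR0, hR1, hR⟩ := exists_slitPlane hφ p
  have main : ∀ a b r a' b' r' : ℝ, |a| < R / 2 → |b| < R / 2 → 0 < r → r < R / 2 →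
      |a'| < R / 2 → |b'| < R / 2 → 0 < r' → r' < R / 2 →
      WindsOnce (fun t => displacement (φ (shift p a b)) (φ (smallCircle (shift p a b) r t))) →
      WindsOnce (fun t => displacement (φ (shift p a' b'))
        (φ (smallCircle (shift p a' b') r' t))) := by
    intro a b r a' b' r' ha hb hr hrR ha' hb' hr' hrR' h
    simp only [smallCircle_eq_shift, shift_shift] at h ⊢
    have conv : ∀ x y : ℝ, |x| < R / 2 → |y| < R / 2 → ∀ u ∈ Icc (0 : ℝ) 1,
        |x + u * (y - x)| < R / 2 := by
      intro x y hx hy u hu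
      have h1 : |x + u * (y - x)| ≤ (1 - u) * |x| + u * |y| := by
        have h2 := abs_add_le ((1 - u) * x) (u * y)
        rw [abs_mul, abs_mul, abs_of_nonneg hu.1, abs_of_nonneg (sub_nonneg.2 hu.2)] at h2
        rwa [show x + u * (y - x) = (1 - u) * x + u * y by ring]
      have h2 := le_max_left |x| |y|
      have h3 := le_max_right |x| |y|
      have h4 : max |x| |y| < R / 2 := max_lt hx hy
      nlinarith [hu.1, hu.2]
    have hrr : ∀ u ∈ Icc (0 : ℝ) 1, 0 < r + u * (r' - r) := fun u hu => by
      rcases eq_or_lt_of_le hu.1 with h | h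
      · rw [← h]; simpa
      · nlinarith [hu.2, mul_pos h hr']
    have hrR : ∀ u ∈ Icc (0 : ℝ) 1, |r + u * (r' - r)| < R / 2 :=
      conv r r' (by rwa [abs_of_pos hr]) (by rwa [abs_of_pos hr'])
    have bound : ∀ x y z : ℝ, |x| < R / 2 → |y| < R / 2 → |z| ≤ 1 → |x + y * z| < R := by
      intro x y z hx hy hz
      have h1 := abs_add_le x (y * z)
      rw [abs_mul] at h1
      nlinarith [abs_nonneg y, abs_nonneg z]
    have := WindsOnce.of_deformation hφ hinj hR1 hR
      (a := fun u => a + u * (a' - a)) (b := fun u => b + u * (b' - b))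
      (c := fun u t => (a + u * (a' - a)) + (r + u * (r' - r)) * Real.cos t)
      (d := fun u t => (b + u * (b' - b)) + (r + u * (r' - r)) * Real.sin t)
      (by fun_prop) (by fun_prop) (by unfold Function.uncurry; fun_prop)
      (by unfold Function.uncurry; fun_prop)
      (fun u hu => (conv a a' ha ha' u hu).trans (by linarith))
      (fun u hu => (conv b b' hb hb' u hu).trans (by linarith))
      (fun u hu t => bound _ _ _ (conv a a' ha ha' u hu) (hrR u hu) (Real.abs_cos_le_one t))
      (fun u hu t => bound _ _ _ (conv b b' hb hb' u hu) (hrR u hu) (Real.abs_sin_le_one t))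
      (fun u hu t h1 h2 => by
        have h3 := hrr u hu
        have h4 : (r + u * (r' - r)) * Real.cos t = 0 := by linarith
        have h5 : (r + u * (r' - r)) * Real.sin t = 0 := by linarith
        have h6 := (mul_eq_zero.1 h4).resolve_left h3.ne'
        have h7 := (mul_eq_zero.1 h5).resolve_left h3.ne'
        have := Real.sin_sq_add_cos_sq t
        rw [h6, h7] at this
        norm_num at this)
      (fun u => by simp) (fun u => by simp)
      (by simpa using h)
    simpa using this
  have hev : ∀ᶠ r in 𝓝[>] (0 : ℝ), 0 < r ∧ r < R / 2 := by
    filter_upwards [Ioo_mem_nhdsGT (show (0 : ℝ) < R / 2 by linarith)] with r hr using hr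
  have key : ∀ a b a' b' : ℝ, |a| < R / 2 → |b| < R / 2 → |a'| < R / 2 → |b'| < R / 2 →
      HasLocalDegreeOne φ (shift p a b) → HasLocalDegreeOne φ (shift p a' b') := by
    intro a b a' b' ha hb ha' hb' h
    obtain ⟨r, hr, hr0⟩ := (h.and hev).exists
    filter_upwards [hev] with r' hr'
    exact main a b r a' b' r' ha hb hr0.1 hr0.2 ha' hb' hr'.1 hr'.2 hr
  refine ⟨R / 2, by linarith, fun a b ha hb => ?_⟩
  have h0 : |(0 : ℝ)| < R / 2 := by rw [abs_zero]; linarith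
  have k1 := key a b 0 0 ha hb h0 h0
  have k2 := key 0 0 a b h0 h0 ha hb
  rw [shift_zero] at k1 k2
  exact ⟨k1, k2⟩

theorem exists_shift_of_nhds (p : Circle × ℝ) {ε : ℝ} (hε : 0 < ε) :
    ∀ᶠ q in 𝓝 p, ∃ a b : ℝ, |a| < ε ∧ |b| < ε ∧ q = shift p a b := by
  have h1 : ContinuousAt (fun q : Circle × ℝ => displacement p q) p := by
    have := continuousAt_displacement (x := (p, p)) (by simp [Complex.one_mem_slitPlane])
    exact this.comp (f := fun q : Circle × ℝ => (p, q)) (by fun_prop)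
  have h0 : displacement p p = 0 := by
    apply Complex.ext <;> simp [displacement]
  have := Metric.continuousAt_iff.1 h1 ε hε
  obtain ⟨δ, hδ, hh⟩ := this
  filter_upwards [Metric.ball_mem_nhds p hδ] with q hq
  have h2 := hh hq
  rw [h0, dist_zero_right] at h2
  refine ⟨(displacement p q).re, (displacement p q).im, (Complex.abs_re_le_norm _).trans_lt h2,
    (Complex.abs_im_le_norm _).trans_lt h2, ?_⟩
  refine Prod.ext ?_ ?_
  · simp only [shift, displacement, Circle.exp_arg, mul_div_cancel]
  · simp [shift, displacement]

/-- A homeomorphism of the cylinder preserves orientation if it does so at one point. -/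
theorem preservesOrientation_of_hasLocalDegreeOne (φ : Circle × ℝ ≃ₜ Circle × ℝ)
    {p₀ : Circle × ℝ} (h : HasLocalDegreeOne φ p₀) : PreservesOrientation φ := by
  have hloc : ∀ p, ∀ᶠ q in 𝓝 p, (HasLocalDegreeOne φ q ↔ HasLocalDegreeOne φ p) := by
    intro p
    obtain ⟨ε, hε, hiff⟩ := exists_hasLocalDegreeOne_iff φ.continuous φ.injective p
    filter_upwards [exists_shift_of_nhds p hε] with q ⟨a, b, ha, hb, e⟩
    rw [e]; exact hiff a b ha hb
  have hclopen : IsClopen {p | HasLocalDegreeOne φ p} := by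
    constructor
    · rw [← isOpen_compl_iff, isOpen_iff_mem_nhds]
      intro p hp
      filter_upwards [hloc p] with q hq
      exact fun hq' => hp (hq.1 hq')
    · rw [isOpen_iff_mem_nhds]
      intro p hp
      filter_upwards [hloc p] with q hq
      exact hq.2 hp
  have := hclopen.eq_univ ⟨p₀, h⟩
  intro p
  exact this.symm.subset (mem_univ p)

theorem hasLocalDegreeOne_of_eventually_id {φ : Circle × ℝ → Circle × ℝ} {p : Circle × ℝ}
    (h : ∀ᶠ q in 𝓝 p, φ q = q) : HasLocalDegreeOne φ p := by
  have hpi := Real.pi_gt_three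
  have ht : ∀ᶠ x : ℝ × ℝ in 𝓝 (0, 0), φ (shift p x.1 x.2) = shift p x.1 x.2 :=
    (continuous_shift p).tendsto' (0, 0) p (by simp) |>.eventually h
  obtain ⟨ε, hε, hball⟩ := Metric.eventually_nhds_iff.1 ht
  filter_upwards [Ioo_mem_nhdsGT (show (0 : ℝ) < min ε 1 by positivity)] with r hr
  have hr1 : r < ε := hr.2.trans_le (min_le_left _ _)
  have hr2 : r < 1 := hr.2.trans_le (min_le_right _ _)
  convert windsOnce_circle hr.1 using 1
  funext t
  have hb : ∀ x : ℝ, |x| ≤ 1 → |r * x| ≤ r := fun x hx => by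
    rw [abs_mul, abs_of_pos hr.1]; nlinarith [hr.1]
  have h1 := hb _ (Real.abs_cos_le_one t)
  have h2 := hb _ (Real.abs_sin_le_one t)
  rw [h.self_of_nhds, smallCircle_eq_shift, @hball (r * Real.cos t, r * Real.sin t) (by
    rw [Prod.dist_eq]; simp only [Real.dist_eq, sub_zero]
    exact (max_le h1 h2).trans_lt hr1)]
  rw [abs_le] at h1
  simp only [displacement, shift, mul_div_cancel_left, add_sub_cancel_left]
  rw [Circle.arg_exp (by linarith) (by linarith)]

/-! ### Isomorphisms of systems of curves -/

/-- `T i` is the lift of an orientation-preserving reparametrization of the circle, that carries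
the `i`-th curve of the system `f` to the `i`-th curve of the system `g` in such a way that
intersections and the vertical order are respected. -/
structure CurveIso {L : Type*} (f g : L → Circle → ℝ) (T : L → ℝ → ℝ) : Prop where
  strictMono : ∀ i, StrictMono (T i)
  continuous : ∀ i, Continuous (T i)
  add_two_pi : ∀ i t, T i (t + 2 * Real.pi) = T i t + 2 * Real.pi
  lt_iff : ∀ i j t, f i (Circle.exp t) < f j (Circle.exp t) ↔
    g i (Circle.exp (T i t)) < g j (Circle.exp (T i t))
  gt_iff : ∀ i j t, f j (Circle.exp t) < f i (Circle.exp t) ↔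
    g j (Circle.exp (T i t)) < g i (Circle.exp (T i t))
  eq_of_eq : ∀ i j t, f i (Circle.exp t) = f j (Circle.exp t) → T i t = T j t

theorem strictMono_of_eventually_lt {τ : ℝ → ℝ} (hc : Continuous τ)
    (h : ∀ t, ∀ᶠ s in 𝓝[>] t, τ t < τ s) : StrictMono τ := by
  have mono : ∀ a b, a ≤ b → τ a ≤ τ b := by
    intro a b hab
    have := IsClosed.Icc_subset_of_forall_exists_gt (a := a) (b := b) (s := {x | τ a ≤ τ x})
      ((isClosed_le continuous_const hc).inter isClosed_Icc) (le_refl (τ a)) (by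
        rintro x ⟨hx, hxab⟩ y hy
        obtain ⟨s, hs, hs'⟩ := ((h x).and (Ioc_mem_nhdsGT hy)).exists
        exact ⟨s, le_trans hx hs.le, hs'⟩)
    exact this ⟨hab, le_rfl⟩
  intro a b hab
  obtain ⟨s, hs, hs'⟩ := ((h a).and (Ioc_mem_nhdsGT hab)).exists
  exact hs.trans_le (mono _ _ hs'.2)

theorem add_int_mul_two_pi {T : ℝ → ℝ} (h : ∀ t, T (t + 2 * Real.pi) = T t + 2 * Real.pi)
    (t : ℝ) (m : ℤ) : T (t + m * (2 * Real.pi)) = T t + m * (2 * Real.pi) := by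
  induction m using Int.induction_on with
  | zero => simp
  | succ k ih =>
    rw [show t + ((k + 1 : ℤ) : ℝ) * (2 * Real.pi) =
      (t + ((k : ℤ) : ℝ) * (2 * Real.pi)) + 2 * Real.pi by push_cast; ring, h, ih]
    push_cast; ring
  | pred k ih =>
    have := h (t + ((-k - 1 : ℤ) : ℝ) * (2 * Real.pi))
    rw [show t + ((-k - 1 : ℤ) : ℝ) * (2 * Real.pi) + 2 * Real.pi =
      t + ((-k : ℤ) : ℝ) * (2 * Real.pi) by push_cast; ring, ih] at this
    rw [eq_sub_of_add_eq this.symm]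
    push_cast; ring

theorem surjective_of_add_two_pi {T : ℝ → ℝ} (hc : Continuous T)
    (h : ∀ t, T (t + 2 * Real.pi) = T t + 2 * Real.pi) : Function.Surjective T := by
  intro y
  have hpi := Real.pi_pos
  obtain ⟨n, hn⟩ := exists_nat_gt (|y - T 0| / (2 * Real.pi))
  rw [div_lt_iff₀ (by positivity)] at hn
  have h1 := add_int_mul_two_pi h 0 n
  have h2 := add_int_mul_two_pi h 0 (-n)
  have h3 := abs_lt.1 hn
  push_cast at h1 h2
  have hle : (0 : ℝ) + -(n : ℝ) * (2 * Real.pi) ≤ 0 + n * (2 * Real.pi) := by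
    have : (0 : ℝ) ≤ n * (2 * Real.pi) := by positivity
    linarith
  obtain ⟨t, -, ht⟩ := intermediate_value_Icc hle hc.continuousOn
    (show y ∈ _ from ⟨by rw [h2]; linarith, by rw [h1]; linarith⟩)
  exact ⟨t, ht⟩

/-! ### The sides of a curve -/

/-- The graph of `f`. -/
def curve (f : Circle → ℝ) : Set (Circle × ℝ) := {q | q.2 = f q.1}

theorem isConnected_above {f : Circle → ℝ} (hf : Continuous f) :
    IsConnected {q : Circle × ℝ | f q.1 < q.2} := by
  have : {q : Circle × ℝ | f q.1 < q.2} =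
      (fun x : Circle × ℝ => (x.1, f x.1 + x.2)) '' (univ ×ˢ Ioi 0) := by
    ext q
    constructor
    · intro h
      exact ⟨(q.1, q.2 - f q.1), ⟨trivial, show 0 < q.2 - f q.1 from sub_pos.2 h⟩, by simp⟩
    · rintro ⟨x, ⟨-, hx⟩, rfl⟩
      simpa using hx
  rw [this]
  exact (isConnected_univ.prod isConnected_Ioi).image _ (by fun_prop)

theorem isConnected_below {f : Circle → ℝ} (hf : Continuous f) :
    IsConnected {q : Circle × ℝ | q.2 < f q.1} := by
  have : {q : Circle × ℝ | q.2 < f q.1} =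
      (fun x : Circle × ℝ => (x.1, f x.1 + x.2)) '' (univ ×ˢ Iio 0) := by
    ext q
    constructor
    · intro h
      exact ⟨(q.1, q.2 - f q.1), ⟨trivial, show q.2 - f q.1 < 0 from sub_neg.2 h⟩, by simp⟩
    · rintro ⟨x, ⟨-, hx⟩, rfl⟩
      simpa using hx
  rw [this]
  exact (isConnected_univ.prod isConnected_Iio).image _ (by fun_prop)

theorem exists_forall_lt {f : Circle → ℝ} (hf : Continuous f) : ∃ C, ∀ θ, f θ < C := by
  obtain ⟨C, hC⟩ := (isCompact_range hf).bddAbove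
  exact ⟨C + 1, fun θ => (hC ⟨θ, rfl⟩).trans_lt (by linarith)⟩

theorem PreservesTop.exists_above {f g : Circle → ℝ} (hf : Continuous f) (hg : Continuous g)
    {φ : Circle × ℝ ≃ₜ Circle × ℝ} (htop : PreservesTop φ) :
    ∃ q : Circle × ℝ, f q.1 < q.2 ∧ g (φ q).1 < (φ q).2 := by
  obtain ⟨y₀, hy₀⟩ := htop
  obtain ⟨C, hC⟩ := exists_forall_lt hg
  obtain ⟨D, hD⟩ := exists_forall_lt hf
  have hK : IsCompact (φ.symm '' ((univ : Set Circle) ×ˢ Icc 0 C)) :=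
    (isCompact_univ.prod isCompact_Icc).image φ.symm.continuous
  obtain ⟨E, hE⟩ := (hK.image continuous_snd).bddAbove
  set y := max (max y₀ D) (E + 1) with hy
  have h1 : y₀ ≤ y := (le_max_left _ _).trans (le_max_left _ _)
  have h2 : D ≤ y := (le_max_right _ _).trans (le_max_left _ _)
  have h3 : E + 1 ≤ y := le_max_right _ _
  refine ⟨(1, y), (hD 1).trans_le h2, ?_⟩
  by_contra hcon
  have h4 := hE ⟨(1, y), ⟨φ (1, y), ⟨trivial, (hy₀ y h1 1).le,
    (not_lt.1 hcon).trans (hC _).le⟩, by simp⟩, rfl⟩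
  simp only at h4
  linarith

theorem PreservesTop.above_iff_and_below_iff {f g : Circle → ℝ} (hf : Continuous f)
    (hg : Continuous g) {φ : Circle × ℝ ≃ₜ Circle × ℝ} (htop : PreservesTop φ)
    (hφ : φ '' curve f = curve g) (q : Circle × ℝ) :
    (f q.1 < q.2 ↔ g (φ q).1 < (φ q).2) ∧ (q.2 < f q.1 ↔ (φ q).2 < g (φ q).1) := by
  have hon : ∀ q, q.2 = f q.1 ↔ (φ q).2 = g (φ q).1 := by
    intro q
    constructor
    · intro h
      have : φ q ∈ curve g := hφ ▸ mem_image_of_mem φ h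
      exact this
    · intro h
      have : φ q ∈ φ '' curve f := hφ ▸ h
      obtain ⟨q', hq', e⟩ := this
      rwa [← φ.injective e]
  have hoa : IsOpen {q : Circle × ℝ | g q.1 < q.2} :=
    isOpen_lt (by fun_prop) (by fun_prop)
  have hob : IsOpen {q : Circle × ℝ | q.2 < g q.1} :=
    isOpen_lt (by fun_prop) (by fun_prop)
  have hdis : Disjoint {q : Circle × ℝ | g q.1 < q.2} {q : Circle × ℝ | q.2 < g q.1} :=
    Set.disjoint_left.2 fun q h1 h2 => lt_asymm (show g q.1 < q.2 from h1) h2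
  have habove : ∀ q, f q.1 < q.2 → g (φ q).1 < (φ q).2 := by
    have hsub : φ '' {q | f q.1 < q.2} ⊆ {q | g q.1 < q.2} := by
      refine IsPreconnected.subset_left_of_subset_union hoa hob hdis ?_ ?_
        ((isConnected_above hf).image φ φ.continuous.continuousOn).isPreconnected
      · rintro _ ⟨q, hq, rfl⟩
        rcases lt_trichotomy (g (φ q).1) (φ q).2 with h | h | h
        · exact Or.inl h
        · exact absurd ((hon q).2 h.symm) (ne_of_gt hq)
        · exact Or.inr h
      · obtain ⟨q, h1, h2⟩ := htop.exists_above hf hg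
        exact ⟨φ q, mem_image_of_mem φ h1, h2⟩
    exact fun q hq => hsub (mem_image_of_mem φ hq)
  have hbelow : ∀ q, q.2 < f q.1 → (φ q).2 < g (φ q).1 := by
    have hsub : φ '' {q | q.2 < f q.1} ⊆ {q | q.2 < g q.1} := by
      refine IsPreconnected.subset_left_of_subset_union hob hoa hdis.symm ?_ ?_
        ((isConnected_below hf).image φ φ.continuous.continuousOn).isPreconnected
      · rintro _ ⟨q, hq, rfl⟩
        rcases lt_trichotomy (g (φ q).1) (φ q).2 with h | h | h
        · exact Or.inr h
        · exact absurd ((hon q).2 h.symm) (ne_of_lt hq)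
        · exact Or.inl h
      · obtain ⟨q', hq'⟩ := (isConnected_below hg).nonempty
        refine ⟨q', ⟨φ.symm q', ?_, by simp⟩, hq'⟩
        have hq'' : q'.2 < g q'.1 := hq'
        rcases lt_trichotomy (φ.symm q').2 (f (φ.symm q').1) with h | h | h
        · exact h
        · have := (hon _).1 h
          simp only [Homeomorph.apply_symm_apply] at this
          exact absurd this hq''.ne
        · have := habove _ h
          simp only [Homeomorph.apply_symm_apply] at this
          exact absurd this hq''.not_gt
    exact fun q hq => hsub (mem_image_of_mem φ hq)
  refine ⟨⟨habove q, fun h => ?_⟩, ⟨hbelow q, fun h => ?_⟩⟩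
  · rcases lt_trichotomy (f q.1) q.2 with h' | h' | h'
    · exact h'
    · exact absurd ((hon q).1 h'.symm) h.ne'
    · exact absurd (hbelow q h') h.not_gt
  · rcases lt_trichotomy (f q.1) q.2 with h' | h' | h'
    · exact absurd (habove q h') h.not_gt
    · exact absurd ((hon q).1 h'.symm) h.ne
    · exact h'

/-! ### Orientation along a curve -/

theorem convex_comb_ne_zero {x y u : ℝ} (hxy : 0 < x * y) (hu : u ∈ Icc (0 : ℝ) 1) :
    (1 - u) * x + u * y ≠ 0 := by
  intro h
  have h1 : (1 - u) * x * x + u * (x * y) = 0 := by linear_combination x * h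
  have hx : 0 < x * x := by
    rcases lt_trichotomy x 0 with h | h | h
    · nlinarith
    · simp [h] at hxy
    · nlinarith
  have h2 : 0 ≤ (1 - u) * (x * x) := mul_nonneg (sub_nonneg.2 hu.2) hx.le
  have h3 : 0 ≤ u * (x * y) := mul_nonneg hu.1 hxy.le
  have h4 : (1 - u) * (x * x) = 0 := by linarith
  have h5 : u * (x * y) = 0 := by linarith
  have h6 := (mul_eq_zero.1 h4).resolve_right hx.ne'
  have h7 := (mul_eq_zero.1 h5).resolve_right hxy.ne'
  linarith

theorem not_windsOnce_of_reversed {a b : ℝ → ℝ} (ha : Continuous a) (hb : Continuous b)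
    (ha0 : a (2 * Real.pi) = a 0) (hb0 : b (2 * Real.pi) = b 0)
    (him : ∀ t, Real.sin t ≠ 0 → 0 < b t * Real.sin t)
    (hre : ∀ t, Real.sin t = 0 → 0 < a t * -Real.cos t) :
    ¬ WindsOnce fun t => ⟨a t, b t⟩ := by
  intro h
  apply not_windsOnce_reversed_circle
  have e : ∀ x y : ℝ, (⟨x, y⟩ : ℂ) = x + y * Complex.I := fun x y => by
    apply Complex.ext <;> simp
  have := WindsOnce.of_homotopy (F := fun u t =>
    ⟨(1 - u) * a t + u * -Real.cos t, (1 - u) * b t + u * Real.sin t⟩) ?_ ?_ ?_ (by simpa using h)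
  · simpa using this
  · apply Continuous.continuousOn
    simp only [e]
    unfold Function.uncurry
    fun_prop
  · intro u hu t _ h0
    have h1 := congrArg Complex.re h0
    have h2 := congrArg Complex.im h0
    simp only [Complex.zero_re, Complex.zero_im] at h1 h2
    by_cases hs : Real.sin t = 0
    · exact convex_comb_ne_zero (hre t hs) hu h1
    · exact convex_comb_ne_zero (him t hs) hu h2
  · intro u _
    simp [ha0, hb0]

theorem lt_of_hasLocalDegreeOne {f g : Circle → ℝ} (hf : Continuous f) (hg : Continuous g)
    {φ : Circle × ℝ → Circle × ℝ} (hφ : Continuous φ) (hinj : Function.Injective φ)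
    (habove : ∀ q, f q.1 < q.2 → g (φ q).1 < (φ q).2)
    (hbelow : ∀ q, q.2 < f q.1 → (φ q).2 < g (φ q).1) {T : ℝ → ℝ} (hT : Continuous T)
    (hTφ : ∀ t, φ (Circle.exp t, f (Circle.exp t)) = (Circle.exp (T t), g (Circle.exp (T t))))
    (t₀ : ℝ) (hdeg : HasLocalDegreeOne φ (Circle.exp t₀, f (Circle.exp t₀))) :
    ∃ r ∈ Ioo (0 : ℝ) 1, ¬ (T (t₀ + r) < T t₀ ∧ T t₀ < T (t₀ - r)) := by
  have hpi := Real.pi_gt_three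
  set p : Circle × ℝ := (Circle.exp t₀, f (Circle.exp t₀)) with hp
  obtain ⟨R, hR0, hR1, hR⟩ := exists_slitPlane hφ p
  set F : ℝ → ℝ := fun x => f (Circle.exp (t₀ + x)) - f (Circle.exp t₀) with hF
  have hFc : Continuous F := by fun_prop
  have ev1 : ∀ᶠ x in 𝓝 (0 : ℝ), |F x| < R / 2 := by
    have : Tendsto (fun x => |F x|) (𝓝 0) (𝓝 0) := by
      have := (hFc.abs.tendsto 0); simpa [hF] using this
    exact this.eventually (gt_mem_nhds (by linarith))
  have ev2 : ∀ᶠ x in 𝓝 (0 : ℝ), |T (t₀ + x) - T t₀| < 1 := by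
    have : Tendsto (fun x => |T (t₀ + x) - T t₀|) (𝓝 0) (𝓝 0) := by
      have h : Continuous fun x => |T (t₀ + x) - T t₀| := by fun_prop
      have := h.tendsto 0; simpa using this
    exact this.eventually (gt_mem_nhds one_pos)
  obtain ⟨δ, hδ, hball⟩ := Metric.eventually_nhds_iff.1 (ev1.and ev2)
  have hr : ∃ r, (0 < r ∧ r < R / 2 ∧ r < δ) ∧
      WindsOnce fun t => displacement (φ p) (φ (smallCircle p r t)) := by
    have : ∀ᶠ r in 𝓝[>] (0 : ℝ), 0 < r ∧ r < R / 2 ∧ r < δ := by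
      filter_upwards [Ioo_mem_nhdsGT (show (0 : ℝ) < min (R / 2) δ by positivity)] with r hr
      exact ⟨hr.1, hr.2.trans_le (min_le_left _ _), hr.2.trans_le (min_le_right _ _)⟩
    exact (this.and hdeg).exists
  obtain ⟨r, ⟨hr0, hrR, hrδ⟩, hw⟩ := hr
  refine ⟨r, ⟨hr0, by linarith⟩, ?_⟩
  rintro ⟨hlt1, hlt2⟩
  have hb : ∀ x : ℝ, |x| ≤ 1 → |r * x| ≤ r := fun x hx => by
    rw [abs_mul, abs_of_pos hr0]; nlinarith
  have hcos : ∀ t, |r * Real.cos t| ≤ r := fun t => hb _ (Real.abs_cos_le_one t)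
  have hsin : ∀ t, |r * Real.sin t| ≤ r := fun t => hb _ (Real.abs_sin_le_one t)
  have hFR : ∀ t, |F (r * Real.cos t)| < R / 2 := fun t =>
    (@hball (r * Real.cos t) (by
      rw [Real.dist_eq, sub_zero]; exact (hcos t).trans_lt hrδ)).1
  have hbound : ∀ u ∈ Icc (0 : ℝ) 1, ∀ t, |r * Real.sin t + u * F (r * Real.cos t)| < R := by
    intro u hu t
    have h1 := abs_add_le (r * Real.sin t) (u * F (r * Real.cos t))
    rw [abs_mul u, abs_of_nonneg hu.1] at h1
    have h2 : u * |F (r * Real.cos t)| ≤ |F (r * Real.cos t)| :=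
      mul_le_of_le_one_left (abs_nonneg _) hu.2
    have := hsin t
    have := hFR t
    linarith
  have hw1 := WindsOnce.of_deformation hφ hinj hR1 hR (a := fun _ => 0) (b := fun _ => 0)
    (c := fun _ t => r * Real.cos t) (d := fun u t => r * Real.sin t + u * F (r * Real.cos t))
    continuous_const continuous_const (by unfold Function.uncurry; fun_prop)
    (by unfold Function.uncurry; fun_prop)
    (fun _ _ => by simpa) (fun _ _ => by simpa)
    (fun u _ t => (hcos t).trans_lt (by linarith)) hbound
    (fun u hu t h1 h2 => by
      have h3 : F 0 = 0 := by simp [hF]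
      rw [h1, h3, mul_zero, add_zero] at h2
      have h6 := (mul_eq_zero.1 h1).resolve_left hr0.ne'
      have h7 := (mul_eq_zero.1 h2).resolve_left hr0.ne'
      have := Real.sin_sq_add_cos_sq t
      rw [h6, h7] at this
      norm_num at this)
    (fun u => by simp) (fun u => by simp)
    (by simpa [smallCircle_eq_shift] using hw)
  simp only [shift_zero, one_mul] at hw1
  set w : ℝ → Circle × ℝ := fun t =>
    (Circle.exp (t₀ + r * Real.cos t), f (Circle.exp (t₀ + r * Real.cos t)) + r * Real.sin t)
    with hwdef
  have hshift : ∀ t, shift p (r * Real.cos t) (r * Real.sin t + F (r * Real.cos t)) = w t := by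
    intro t
    simp only [shift, hp, hwdef, hF, Circle.exp_add]
    congr 1
    ring
  have hslit : ∀ t, (((φ (w t)).1 / (φ p).1 : Circle) : ℂ) ∈ Complex.slitPlane := by
    intro t
    have := hR 0 0 (r * Real.cos t) (r * Real.sin t + F (r * Real.cos t)) (by simpa) (by simpa)
      ((hcos t).trans_lt (by linarith)) (by simpa using hbound 1 (by simp) t)
    rwa [shift_zero, hshift] at this
  simp only [hshift] at hw1
  have hwc : Continuous w := by fun_prop
  have hφp : φ p = (Circle.exp (T t₀), g (Circle.exp (T t₀))) := hTφ t₀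
  have hdc : Continuous fun t => displacement (φ p) (φ (w t)) := by
    rw [continuous_iff_continuousAt]
    intro t
    exact ContinuousAt.comp (f := fun t => (φ p, φ (w t))) (continuousAt_displacement (hslit t))
      (by fun_prop)
  have hac : Continuous fun t => (displacement (φ p) (φ (w t))).re :=
    Complex.continuous_re.comp hdc
  have hbc : Continuous fun t => (displacement (φ p) (φ (w t))).im :=
    Complex.continuous_im.comp hdc
  set a := fun t => (displacement (φ p) (φ (w t))).re with ha
  set b := fun t => (displacement (φ p) (φ (w t))).im with hbdef
  set G : ℝ → ℝ := fun t => g (φ (w t)).1 - (φ p).2 with hG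
  have hGc : Continuous G := by fun_prop
  have hwper : w (2 * Real.pi) = w 0 := by simp [hwdef]
  have hbG : ∀ t, b t - G t = (φ (w t)).2 - g (φ (w t)).1 := by
    intro t; simp only [hbdef, hG, displacement]; ring
  have e : ∀ x y : ℝ, (⟨x, y⟩ : ℂ) = x + y * Complex.I := fun x y => by
    apply Complex.ext <;> simp
  have hside1 : ∀ t, 0 < Real.sin t → 0 < b t - G t := fun t ht => by
    rw [hbG, sub_pos]
    apply habove
    simp only [hwdef]
    have := mul_pos hr0 ht
    linarith
  have hside2 : ∀ t, Real.sin t < 0 → b t - G t < 0 := fun t ht => by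
    rw [hbG, sub_neg]
    apply hbelow
    simp only [hwdef]
    have := mul_neg_of_pos_of_neg hr0 ht
    linarith
  have harg : ∀ x, |T (t₀ + x) - T t₀| < 1 → ∀ t, Real.sin t = 0 → r * Real.cos t = x →
      a t = T (t₀ + x) - T t₀ := by
    intro x hx t hs hxt
    simp only [ha, displacement, hwdef, hxt, hs, mul_zero, add_zero, hTφ, hφp]
    rw [abs_lt] at hx
    rw [← Circle.exp_sub, Circle.arg_exp (by linarith) (by linarith)]
  have hTr : ∀ x, |x| ≤ r → |T (t₀ + x) - T t₀| < 1 := fun x hx =>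
    (@hball x (by rw [Real.dist_eq, sub_zero]; exact hx.trans_lt hrδ)).2
  have hre : ∀ t, Real.sin t = 0 → 0 < a t * -Real.cos t := by
    intro t hs
    have hx := hTr (r * Real.cos t) (hcos t)
    rw [harg _ hx t hs rfl]
    have h1 := Real.sin_sq_add_cos_sq t
    rw [hs] at h1
    have h2 : (Real.cos t - 1) * (Real.cos t + 1) = 0 := by linarith
    rcases mul_eq_zero.1 h2 with h | h
    · have : Real.cos t = 1 := by linarith
      rw [this, mul_one]; linarith
    · have : Real.cos t = -1 := by linarith
      rw [this, show t₀ + r * -1 = t₀ - r by ring]; linarith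
  refine not_windsOnce_of_reversed (a := a) (b := fun t => b t - G t) hac (hbc.sub hGc) ?_ ?_ ?_
    hre ?_
  · simp only [ha, hwper]
  · simp only [hbdef, hG, hwper]
  · intro t ht
    rcases lt_or_gt_of_ne ht with h | h
    · exact mul_pos_of_neg_of_neg (hside2 t h) h
    · exact mul_pos (hside1 t h) h
  · have := WindsOnce.of_homotopy (F := fun u t => ⟨a t, b t - u * G t⟩) ?_ ?_ ?_
      (by simpa [ha, hbdef] using hw1)
    · simpa using this
    · apply Continuous.continuousOn
      simp only [e]
      unfold Function.uncurry
      fun_prop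
    · intro u hu t _ h0
      have h1 : a t = 0 := congrArg Complex.re h0
      have h2 : b t - u * G t = 0 := congrArg Complex.im h0
      have h3 : (φ (w t)).1 = (φ p).1 := div_eq_one.1 (Circle.arg_eq_zero.1 h1)
      have h4 : G t = 0 := by
        simp only [hG, h3, hφp, sub_self]
      rw [h4, mul_zero, sub_zero] at h2
      by_cases hs : Real.sin t = 0
      · have := hre t hs
        rw [h1] at this; simp at this
      · rcases lt_or_gt_of_ne hs with h | h
        · have := hside2 t h; linarith
        · have := hside1 t h; linarith
    · intro u _
      simp only [ha, hbdef, hG, hwper]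

theorem strictMono_lift_and_add_two_pi {f g : Circle → ℝ} (hf : Continuous f) (hg : Continuous g)
    {φ : Circle × ℝ ≃ₜ Circle × ℝ} (hor : PreservesOrientation φ)
    (habove : ∀ q, f q.1 < q.2 → g (φ q).1 < (φ q).2)
    (hbelow : ∀ q, q.2 < f q.1 → (φ q).2 < g (φ q).1) {T : ℝ → ℝ} (hT : Continuous T)
    (hTφ : ∀ t, φ (Circle.exp t, f (Circle.exp t)) = (Circle.exp (T t), g (Circle.exp (T t)))) :
    StrictMono T ∧ ∀ t, T (t + 2 * Real.pi) = T t + 2 * Real.pi := by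
  have hpi := Real.pi_gt_three
  have hinj : ∀ s t, Circle.exp (T s) = Circle.exp (T t) → Circle.exp s = Circle.exp t := by
    intro s t h
    have := hTφ s
    rw [h, ← hTφ t] at this
    exact congrArg Prod.fst (φ.injective this)
  have hmono : StrictMono T := by
    refine strictMono_of_eventually_lt hT fun t => ?_
    have hinjOn : InjOn T (Icc (t - 1) (t + 1)) := by
      intro x hx y hy hxy
      exact Circle.exp_injOn_Icc (by linarith) hx hy (hinj x y (by rw [hxy]))
    have hcase := hT.continuousOn.strictMonoOn_of_injOn_Icc' (by linarith) hinjOn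
    have hmono : StrictMonoOn T (Icc (t - 1) (t + 1)) := by
      rcases hcase with h | h
      · exact h
      · exfalso
        obtain ⟨r, hr, hn⟩ := lt_of_hasLocalDegreeOne hf hg φ.continuous φ.injective habove hbelow
          hT hTφ t (hor _)
        exact hn ⟨h ⟨by linarith, by linarith⟩ ⟨by linarith [hr.1], by linarith [hr.2]⟩
          (by linarith [hr.1]), h ⟨by linarith [hr.2], by linarith [hr.1]⟩
          ⟨by linarith, by linarith⟩ (by linarith [hr.1])⟩
    filter_upwards [Ioc_mem_nhdsGT (show t < t + 1 by linarith)] with s hs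
    exact hmono ⟨by linarith, by linarith⟩ ⟨by linarith [hs.1], hs.2⟩ hs.1
  refine ⟨hmono, fun t => ?_⟩
  have h1 := hTφ (t + 2 * Real.pi)
  rw [Circle.exp_add_two_pi, hTφ t, Prod.mk.injEq] at h1
  obtain ⟨m, hm⟩ := Circle.exp_eq_exp.1 h1.1.symm
  have h2 := hmono (show t < t + 2 * Real.pi by linarith)
  have hm1 : 0 < m := by
    have : (0 : ℝ) < m := by
      by_contra h
      nlinarith [not_lt.1 h]
    exact_mod_cast this
  have hm2 : m < 2 := by
    by_contra h
    have h3 : (2 : ℝ) ≤ m := by exact_mod_cast not_lt.1 h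
    obtain ⟨s, hs, hse⟩ := intermediate_value_Icc (show t ≤ t + 2 * Real.pi by linarith)
      hT.continuousOn (show T t + 2 * Real.pi ∈ _ from ⟨by linarith, by nlinarith⟩)
    have h4 : Circle.exp s = Circle.exp t := hinj s t (by rw [hse, Circle.exp_add_two_pi])
    obtain ⟨k, hk⟩ := Circle.exp_eq_exp.1 h4
    have hs1 : t < s := hmono.lt_iff_lt.1 (by rw [hse]; linarith)
    have hs2 : s < t + 2 * Real.pi := hmono.lt_iff_lt.1 (by rw [hse, hm]; nlinarith)
    have k1 : (0 : ℝ) < k := by by_contra h; nlinarith [not_lt.1 h]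
    have k2 : (k : ℝ) < 1 := by by_contra h; nlinarith [not_lt.1 h]
    have k1' : 0 < k := by exact_mod_cast k1
    have k2' : k < 1 := by exact_mod_cast k2
    omega
  have : m = 1 := by omega
  rw [hm, this]; simp

theorem exists_lift {φ : Circle × ℝ → Circle × ℝ} (hφ : Continuous φ) :
    ∃ X : ℝ × ℝ → ℝ, Continuous X ∧ ∀ x, Circle.exp (X x) = (φ (Circle.exp x.1, x.2)).1 := by
  let Φ : C(ℝ × ℝ, Circle) := ⟨fun x => (φ (Circle.exp x.1, x.2)).1, by fun_prop⟩
  obtain ⟨e₀, he₀⟩ := Circle.exp_surjective (Φ (0, 0))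
  obtain ⟨X, ⟨-, hX⟩, -⟩ := Circle.isCoveringMap_exp.existsUnique_continuousMap_lifts Φ (0, 0) e₀ he₀
  exact ⟨X, X.continuous, fun x => congrFun hX x⟩

theorem exists_curveIso_of_homeomorph {L : Type*} {f g : L → Circle → ℝ}
    (hf : ∀ i, Continuous (f i)) (hg : ∀ i, Continuous (g i)) {φ : Circle × ℝ ≃ₜ Circle × ℝ}
    (hor : PreservesOrientation φ) (htop : PreservesTop φ)
    (hφ : ∀ i, φ '' curve (f i) = curve (g i)) : ∃ T, CurveIso f g T := by
  obtain ⟨X, hXc, hX⟩ := exists_lift φ.continuous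
  have hside := fun i => htop.above_iff_and_below_iff (hf i) (hg i) (hφ i)
  set T : L → ℝ → ℝ := fun i t => X (t, f i (Circle.exp t)) with hT
  have hTc : ∀ i, Continuous (T i) := fun i => by
    have := hf i
    fun_prop
  have hTφ : ∀ i t, φ (Circle.exp t, f i (Circle.exp t)) =
      (Circle.exp (T i t), g i (Circle.exp (T i t))) := by
    intro i t
    have h1 : φ (Circle.exp t, f i (Circle.exp t)) ∈ curve (g i) :=
      hφ i ▸ mem_image_of_mem φ rfl
    have h2 := hX (t, f i (Circle.exp t))
    refine Prod.ext h2.symm ?_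
    have h3 : _ = _ := h1
    rw [h3, ← h2]
  have hmono := fun i => strictMono_lift_and_add_two_pi (hf i) (hg i) hor
    (fun q => (hside i q).1.1) (fun q => (hside i q).2.1) (hTc i) (hTφ i)
  refine ⟨T, fun i => (hmono i).1, hTc, fun i => (hmono i).2, ?_, ?_, ?_⟩
  · intro i j t
    have := (hside j (Circle.exp t, f i (Circle.exp t))).2
    rw [hTφ] at this
    exact this
  · intro i j t
    have := (hside j (Circle.exp t, f i (Circle.exp t))).1
    rw [hTφ] at this
    exact this
  · intro i j t h
    simp only [hT, h]

/-! ### Sign changes -/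

theorem mul_pos_of_forall_ne_zero {u : ℝ → ℝ} (hu : Continuous u) {x y : ℝ}
    (h : ∀ z ∈ uIcc x y, u z ≠ 0) : 0 < u x * u y := by
  by_contra hcon
  obtain ⟨z, hz, hz0⟩ := intermediate_value_uIcc (hu.continuousOn (s := uIcc x y))
    (show (0 : ℝ) ∈ uIcc (u x) (u y) by
      rw [mem_uIcc]
      rcases le_total (u x) 0 with h1 | h1 <;> rcases le_total 0 (u y) with h2 | h2
      · exact Or.inl ⟨h1, h2⟩
      · have := mul_nonneg_of_nonpos_of_nonpos h1 h2
        rcases mul_eq_zero.1 (le_antisymm (not_lt.1 hcon) this) with h | h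
        · exact absurd h (‹∀ z ∈ uIcc x y, u z ≠ 0› x left_mem_uIcc)
        · exact absurd h (‹∀ z ∈ uIcc x y, u z ≠ 0› y right_mem_uIcc)
      · have := mul_nonneg h1 h2
        rcases mul_eq_zero.1 (le_antisymm (not_lt.1 hcon) this) with h | h
        · exact absurd h (‹∀ z ∈ uIcc x y, u z ≠ 0› x left_mem_uIcc)
        · exact absurd h (‹∀ z ∈ uIcc x y, u z ≠ 0› y right_mem_uIcc)
      · exact Or.inr ⟨h2, h1⟩)
  exact h z hz hz0

theorem ChangesSignAt.mul_neg {u : ℝ → ℝ} (hu : Continuous u) {b t t' : ℝ}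
    (hb : ChangesSignAt u b) (ht : t < b) (ht' : b < t') (h1 : ∀ z ∈ Ico t b, u z ≠ 0)
    (h2 : ∀ z ∈ Ioc b t', u z ≠ 0) : u t * u t' < 0 := by
  have e : ∃ s ∈ Ico t b, ∃ s' ∈ Ioc b t', u s * u s' < 0 := by
    rcases hb.2 with ⟨hl, hr⟩ | ⟨hl, hr⟩
    · obtain ⟨s, hs, hs'⟩ := (hl.and (Ico_mem_nhdsLT ht)).exists
      obtain ⟨r, hr, hr'⟩ := (hr.and (Ioc_mem_nhdsGT ht')).exists
      exact ⟨s, hs', r, hr', mul_neg_of_neg_of_pos hs hr⟩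
    · obtain ⟨s, hs, hs'⟩ := (hl.and (Ico_mem_nhdsLT ht)).exists
      obtain ⟨r, hr, hr'⟩ := (hr.and (Ioc_mem_nhdsGT ht')).exists
      exact ⟨s, hs', r, hr', mul_neg_of_pos_of_neg hs hr⟩
  obtain ⟨s, hs, s', hs', hss⟩ := e
  have p1 := mul_pos_of_forall_ne_zero hu (x := t) (y := s) fun z hz => by
    rw [uIcc_of_le hs.1] at hz
    exact h1 z ⟨hz.1, hz.2.trans_lt hs.2⟩
  have p2 := mul_pos_of_forall_ne_zero hu (x := s') (y := t') fun z hz => by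
    rw [uIcc_of_le hs'.2] at hz
    exact h2 z ⟨hs'.1.trans_le hz.1, hz.2⟩
  have p3 := mul_pos p1 p2
  by_contra hcon
  have p4 := mul_nonneg (not_lt.1 hcon) (neg_nonneg.2 hss.le)
  have : u t * u t' * -(u s * u s') = -(u t * u s * (u s' * u t')) := by ring
  linarith

theorem not_mem_translate {τ z : ℝ} {m : ℤ} (h1 : τ - 2 * Real.pi < z) (h2 : z < τ) :
    z ≠ τ + m * (2 * Real.pi) := by
  intro h
  have hpi := Real.pi_pos
  have k1 : (m : ℝ) < 0 := by by_contra hc; nlinarith [not_lt.1 hc]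
  have k2 : (-1 : ℝ) < m := by by_contra hc; nlinarith [not_lt.1 hc]
  have k1' : m < 0 := by exact_mod_cast k1
  have k2' : -1 < m := by exact_mod_cast k2
  omega

theorem eq_of_mem_Ioc_translate {x y : ℝ} {m : ℤ} (hx : x ∈ Ioc 0 (2 * Real.pi))
    (hy : y ∈ Ioc 0 (2 * Real.pi)) (h : x = y + m * (2 * Real.pi)) : x = y := by
  have hpi := Real.pi_pos
  have k1 : (m : ℝ) < 1 := by by_contra hc; nlinarith [not_lt.1 hc, hx.2, hy.1]
  have k2 : (-1 : ℝ) < m := by by_contra hc; nlinarith [not_lt.1 hc, hx.1, hy.2]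
  have k1' : m < 1 := by exact_mod_cast k1
  have k2' : -1 < m := by exact_mod_cast k2
  have : m = 0 := by omega
  simp [h, this]

theorem exists_translate_mem_Ioc (t : ℝ) :
    ∃ m : ℤ, ∃ z ∈ Ioc 0 (2 * Real.pi), t = z + m * (2 * Real.pi) := by
  refine ⟨toIocDiv Real.two_pi_pos 0 t, toIocMod Real.two_pi_pos 0 t, ?_, ?_⟩
  · have := toIocMod_mem_Ioc Real.two_pi_pos 0 t
    rwa [zero_add] at this
  · have := self_sub_toIocDiv_zsmul Real.two_pi_pos 0 t
    rw [zsmul_eq_mul] at this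
    linarith

theorem exp_add_int_mul (t : ℝ) (m : ℤ) :
    Circle.exp (t + m * (2 * Real.pi)) = Circle.exp t :=
  Circle.exp_eq_exp.2 ⟨m, rfl⟩

/-- If the zeros of `u` are the translates of `b` and of finitely many numbers in `(b, b + 2π)`, then
`u` has opposite signs on the two intervals that end at `b`. -/
theorem ChangesSignAt.mul_neg_of_translates {u : ℝ → ℝ} (hu : Continuous u) {b t t' : ℝ}
    {S : Set ℝ} (hS : ∀ τ ∈ S, b < τ ∧ τ < b + 2 * Real.pi)
    (hz : ∀ z, u z = 0 → ∃ m : ℤ, z = b + m * (2 * Real.pi) ∨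
      ∃ τ ∈ S, z = τ + m * (2 * Real.pi))
    (hb : ChangesSignAt u b) (ht : b - 2 * Real.pi < t) (htb : t < b)
    (htS : ∀ τ ∈ S, τ - 2 * Real.pi < t) (hbt' : b < t') (ht' : t' < b + 2 * Real.pi)
    (ht'S : ∀ τ ∈ S, t' < τ) : u t * u t' < 0 := by
  refine hb.mul_neg hu htb hbt' ?_ ?_
  · intro z hz' h0
    obtain ⟨m, h | ⟨τ, hτ, h⟩⟩ := hz z h0
    · exact not_mem_translate (ht.trans_le hz'.1) hz'.2 h
    · exact not_mem_translate ((htS τ hτ).trans_le hz'.1) (hz'.2.trans (hS τ hτ).1) h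
  · intro z hz' h0
    obtain ⟨m, h | ⟨τ, hτ, h⟩⟩ := hz z h0
    · refine not_mem_translate (τ := b + 2 * Real.pi) (z := z) (m := m - 1) (by linarith [hz'.1])
        (by linarith [hz'.2]) ?_
      rw [h]; push_cast; ring
    · exact not_mem_translate (by linarith [(hS τ hτ).2, hz'.1])
        (hz'.2.trans_lt (ht'S τ hτ)) h

/-! ### Systems of curves -/

/-- The properties of the dual support curves of an arrangement. -/
structure IsCurveSystem {L : Type*} (g : L → Circle → ℝ) : Prop where
  continuous : ∀ i, Continuous (g i)
  cross : ∀ i j, i ≠ j → CrossTransversally (g i) (g j)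
  no_triple : ∀ i j k, i ≠ j → i ≠ k → j ≠ k → ∀ θ, g i θ = g j θ → g i θ ≠ g k θ
  finite_crossings : (crossings g).Finite

theorem IsCurveSystem.continuous_sub {L : Type*} {g : L → Circle → ℝ} (hg : IsCurveSystem g)
    (i j : L) : Continuous fun t => g i (Circle.exp t) - g j (Circle.exp t) := by
  have := hg.continuous i
  have := hg.continuous j
  fun_prop

theorem IsCurveSystem.changesSignAt {L : Type*} {g : L → Circle → ℝ} (hg : IsCurveSystem g)
    {i j : L} (hij : i ≠ j) {t : ℝ} (h : g i (Circle.exp t) = g j (Circle.exp t)) :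
    ChangesSignAt (fun t => g i (Circle.exp t) - g j (Circle.exp t)) t :=
  hg.cross i j hij t h

/-! ### Words of adjacent transpositions -/

section Words

variable {n : ℕ} {L α : Type*}

/-- The lower of the two positions interchanged at height `h`. -/
def lo (h : Fin (n - 1)) : Fin n := ⟨h, by omega⟩

/-- The upper of the two positions interchanged at height `h`. -/
def hi (h : Fin (n - 1)) : Fin n := ⟨h + 1, by omega⟩

theorem lo_lt_hi (h : Fin (n - 1)) : lo h < hi h := by
  rw [Fin.lt_def]; simp [lo, hi]

theorem adjacentSwap_eq (h : Fin (n - 1)) : adjacentSwap h = Equiv.swap (lo h) (hi h) := rfl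

/-- Positions `h` and `h + 1` of the sequence `ρ` interchanged. -/
def swapAt (h : Fin (n - 1)) (ρ : Fin n ≃ L) : Fin n ≃ L := (adjacentSwap h).trans ρ

theorem swapAt_apply (h : Fin (n - 1)) (ρ : Fin n ≃ L) (k : Fin n) :
    swapAt h ρ k = ρ (adjacentSwap h k) := rfl

@[simp] theorem swapAt_lo (h : Fin (n - 1)) (ρ : Fin n ≃ L) : swapAt h ρ (lo h) = ρ (hi h) := by
  simp [swapAt_apply, adjacentSwap_eq]

@[simp] theorem swapAt_hi (h : Fin (n - 1)) (ρ : Fin n ≃ L) : swapAt h ρ (hi h) = ρ (lo h) := by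
  simp [swapAt_apply, adjacentSwap_eq]

@[simp] theorem swapAt_swapAt (h : Fin (n - 1)) (ρ : Fin n ≃ L) : swapAt h (swapAt h ρ) = ρ := by
  ext k; simp [swapAt_apply, adjacentSwap_eq]

theorem swapAt_symm (h : Fin (n - 1)) (ρ : Fin n ≃ L) (i : L) :
    (swapAt h ρ).symm i = adjacentSwap h (ρ.symm i) := rfl

theorem swapAt_apply_of_far {h : Fin (n - 1)} {k : Fin n} (h1 : k ≠ lo h) (h2 : k ≠ hi h)
    (ρ : Fin n ≃ L) : swapAt h ρ k = ρ k := by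
  rw [swapAt_apply, adjacentSwap_eq, Equiv.swap_apply_of_ne_of_ne h1 h2]

theorem lt_or_of_adjacentSwap_lt {h : Fin (n - 1)} {x y : Fin n}
    (hxy : adjacentSwap h x < adjacentSwap h y) : x < y ∨ (x = hi h ∧ y = lo h) := by
  have h1 : (lo h : ℕ) = h := rfl
  have h2 : (hi h : ℕ) = h + 1 := rfl
  simp only [adjacentSwap_eq, Equiv.swap_apply_def] at hxy
  generalize lo h = a at *
  generalize hi h = b at *
  split_ifs at hxy <;> simp only [Fin.ext_iff, Fin.lt_def] at * <;> omega

theorem swapAt_comm {h k : Fin (n - 1)} (hfar : (h : ℕ) + 1 < k ∨ (k : ℕ) + 1 < h)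
    (ρ : Fin n ≃ L) : swapAt h (swapAt k ρ) = swapAt k (swapAt h ρ) := by
  have hd : Commute (adjacentSwap h) (adjacentSwap k) := by
    refine (Equiv.Perm.disjoint_swap_swap ?_).commute
    simp only [List.nodup_cons, List.mem_cons, Fin.ext_iff, List.not_mem_nil]
    simp
    omega
  ext x
  have := congrArg (fun σ : Equiv.Perm (Fin n) => ρ (σ x)) hd.eq
  simpa [swapAt_apply] using this.symm

/-- The result of the action of a word of heights on a sequence. -/
def act (ρ : Fin n ≃ L) : List (Fin (n - 1)) → (Fin n ≃ L)
  | [] => ρ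
  | h :: w => act (swapAt h ρ) w

theorem act_append (ρ : Fin n ≃ L) (w w' : List (Fin (n - 1))) :
    act ρ (w ++ w') = act (act ρ w) w' := by
  induction w generalizing ρ with
  | nil => rfl
  | cons h w ih => exact ih _

theorem act_eq (ρ : Fin n ≃ L) (w : List (Fin (n - 1))) :
    act ρ w = ((w.map adjacentSwap).prod : Equiv.Perm (Fin n)).trans ρ := by
  induction w generalizing ρ with
  | nil => rfl
  | cons h w ih => rw [act, ih, List.map_cons, List.prod_cons]; rfl

theorem act_eq_self_iff (ρ : Fin n ≃ L) (w : List (Fin (n - 1))) :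
    act ρ w = ρ ↔ (w.map adjacentSwap).prod = (1 : Equiv.Perm (Fin n)) := by
  rw [act_eq]
  constructor
  · intro h
    ext k
    have := congrArg (fun σ : Fin n ≃ L => σ k) h
    simpa using congrArg Fin.val (ρ.injective this)
  · intro h; rw [h]; rfl

/-- The pairs of entries that are successively interchanged when a word acts on a sequence, together
with the data attached to the letters of the word. -/
def events (ρ : Fin n ≃ L) : List (Fin (n - 1) × α) → List (L × L × α)
  | [] => []
  | x :: s => (ρ (lo x.1), ρ (hi x.1), x.2) :: events (swapAt x.1 ρ) s

theorem events_append (ρ : Fin n ≃ L) (s s' : List (Fin (n - 1) × α)) :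
    events ρ (s ++ s') = events ρ s ++ events (act ρ (s.map Prod.fst)) s' := by
  induction s generalizing ρ with
  | nil => rfl
  | cons x s ih => simp [events, act, ih]

theorem map_events (ρ : Fin n ≃ L) (s : List (Fin (n - 1) × α)) :
    (events ρ s).map (fun e => e.2.2) = s.map Prod.snd := by
  induction s generalizing ρ with
  | nil => rfl
  | cons x s ih => simp [events, ih]

theorem events_map {β : Type*} (F : α → β) (ρ : Fin n ≃ L) (s : List (Fin (n - 1) × α)) :
    events ρ (s.map fun x => (x.1, F x.2)) = (events ρ s).map fun e => (e.1, e.2.1, F e.2.2) := by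
  induction s generalizing ρ with
  | nil => rfl
  | cons x s ih => simp [events, ih]

/-- The entry `i` takes part in the event `e`. -/
def Involves (e : L × L × α) (i : L) : Prop := e.1 = i ∨ e.2.1 = i

theorem ne_of_mem_events {ρ : Fin n ≃ L} {s : List (Fin (n - 1) × α)} {e : L × L × α}
    (he : e ∈ events ρ s) : e.1 ≠ e.2.1 := by
  induction s generalizing ρ with
  | nil => simp [events] at he
  | cons x s ih =>
    rcases List.mem_cons.1 he with h | h
    · rw [h]
      exact ρ.injective.ne (lo_lt_hi x.1).ne
    · exact ih h

theorem events_independent (ρ : Fin n ≃ L) (s t : List (Fin (n - 1) × α))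
    (x y : Fin (n - 1) × α) (hfar : (x.1 : ℕ) + 1 < y.1 ∨ (y.1 : ℕ) + 1 < x.1) :
    ∃ (l l' : List (L × L × α)) (e e' : L × L × α), (∀ i, Involves e i → ¬ Involves e' i) ∧
      events ρ (s ++ x :: y :: t) = l ++ e :: e' :: l' ∧
      events ρ (s ++ y :: x :: t) = l ++ e' :: e :: l' := by
  set σ := act ρ (s.map Prod.fst) with hσ
  have h1 : lo y.1 ≠ lo x.1 ∧ lo y.1 ≠ hi x.1 ∧ hi y.1 ≠ lo x.1 ∧ hi y.1 ≠ hi x.1 := by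
    simp only [lo, hi, ne_eq, Fin.ext_iff]; omega
  obtain ⟨a1, a2, a3, a4⟩ := h1
  refine ⟨events ρ s, events (swapAt y.1 (swapAt x.1 σ)) t, (σ (lo x.1), σ (hi x.1), x.2),
    (σ (lo y.1), σ (hi y.1), y.2), ?_, ?_, ?_⟩
  · rintro i (h | h) (h' | h') <;> simp only at h h' <;> rw [← h] at h' <;>
      have := σ.injective h' <;> contradiction
  · simp only [events_append, events, ← hσ, swapAt_apply_of_far a1 a2, swapAt_apply_of_far a3 a4]
  · simp only [events_append, events, ← hσ, swapAt_apply_of_far a1.symm a3.symm,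
      swapAt_apply_of_far a2.symm a4.symm, swapAt_comm hfar]

end Words

/-! ### Timed words -/

section TimedWord

variable {n : ℕ} {L : Type*}

/-- The time of an event. -/
def time (e : L × L × (ℝ ×ₗ ℝ)) : ℝ := (ofLex e.2.2).1

/-- The word `s`, whose letters carry points of the plane, records the crossings of the curves `g i`
up to translation by multiples of `2π`, in an order that is compatible with the order along each
curve. -/
structure TimedWord (g : L → Circle → ℝ) (ρ : Fin n ≃ L) (s : List (Fin (n - 1) × (ℝ ×ₗ ℝ))) :
    Prop where
  act_eq : act ρ (s.map Prod.fst) = ρ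
  pairwise : (events ρ s).Pairwise fun e e' => ∀ i, Involves e i → Involves e' i →
    time e < time e' ∧ time e' < time e + 2 * Real.pi
  value : ∀ e ∈ events ρ s, ∀ i, Involves e i → g i (Circle.exp (time e)) = (ofLex e.2.2).2
  zero : ∀ i j t, i ≠ j → g i (Circle.exp t) = g j (Circle.exp t) →
    ∃ e ∈ events ρ s, Involves e i ∧ Involves e j ∧ ∃ m : ℤ, t = time e + m * (2 * Real.pi)
  lt_of_lt : ∀ i j, ρ.symm i < ρ.symm j → ∀ t, (∀ e ∈ events ρ s, Involves e i → Involves e j →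
    time e - 2 * Real.pi < t ∧ t < time e) → g i (Circle.exp t) < g j (Circle.exp t)

theorem TimedWord.independent {g : L → Circle → ℝ} {ρ : Fin n ≃ L}
    {s t : List (Fin (n - 1) × (ℝ ×ₗ ℝ))} {x y : Fin (n - 1) × (ℝ ×ₗ ℝ)}
    (h : TimedWord g ρ (s ++ x :: y :: t))
    (hfar : (x.1 : ℕ) + 1 < y.1 ∨ (y.1 : ℕ) + 1 < x.1) : TimedWord g ρ (s ++ y :: x :: t) := by
  obtain ⟨l, l', e, e', hdis, h1, h2⟩ := events_independent ρ s t x y hfar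
  have hmem : ∀ a, a ∈ events ρ (s ++ y :: x :: t) ↔ a ∈ events ρ (s ++ x :: y :: t) := by
    intro a
    rw [h1, h2]
    simp only [List.mem_append, List.mem_cons]
    tauto
  constructor
  · have := h.act_eq
    simp only [List.map_append, List.map_cons, act_append, act] at this ⊢
    rwa [swapAt_comm hfar]
  · have := h.pairwise
    rw [h1] at this
    rw [h2]
    simp only [List.pairwise_append, List.pairwise_cons, List.mem_cons] at this ⊢
    obtain ⟨p1, ⟨p2, p3, p4⟩, p5⟩ := this
    refine ⟨p1, ⟨?_, fun a ha => p2 a (Or.inr ha), p4⟩, ?_⟩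
    · rintro a (rfl | ha)
      · exact fun i hi hi' => absurd hi (hdis i hi')
      · exact p3 a ha
    · rintro a ha b (rfl | rfl | hb)
      · exact p5 a ha _ (Or.inr (Or.inl rfl))
      · exact p5 a ha _ (Or.inl rfl)
      · exact p5 a ha _ (Or.inr (Or.inr hb))
  · exact fun a ha => h.value a ((hmem a).1 ha)
  · intro i j t hij ht
    obtain ⟨a, ha, hh⟩ := h.zero i j t hij ht
    exact ⟨a, (hmem a).2 ha, hh⟩
  · exact fun i j hij t ht => h.lt_of_lt i j hij t fun a ha => ht a ((hmem a).2 ha)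

theorem finite_times {ρ : Fin n ≃ L}
    (s : List (Fin (n - 1) × (ℝ ×ₗ ℝ))) (i j : L) :
    {τ | ∃ e ∈ events ρ s, Involves e i ∧ Involves e j ∧ time e = τ}.Finite := by
  refine ((List.finite_toSet (events ρ s)).image time).subset ?_
  rintro τ ⟨e, he, -, -, rfl⟩
  exact mem_image_of_mem _ he

theorem involves_iff_of_lo_hi {ρ : Fin n ≃ L} {h : Fin (n - 1)} {b : ℝ ×ₗ ℝ} {i j : L}
    (hij : ρ.symm i < ρ.symm j) (hi' : Involves (ρ (lo h), ρ (hi h), b) i)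
    (hj' : Involves (ρ (lo h), ρ (hi h), b) j) : i = ρ (lo h) ∧ j = ρ (hi h) := by
  have hl := lo_lt_hi h
  rcases hi' with h1 | h1 <;> rcases hj' with h2 | h2 <;> simp only at h1 h2 <;>
    subst h1 <;> subst h2 <;> simp only [Equiv.symm_apply_apply] at hij
  · exact absurd hij (lt_irrefl _)
  · exact ⟨rfl, rfl⟩
  · exact absurd hij hl.not_gt
  · exact absurd hij (lt_irrefl _)

/-- Translation of a point of the plane by `m` full turns. -/
noncomputable def turn (m : ℤ) (b : ℝ ×ₗ ℝ) : ℝ ×ₗ ℝ :=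
  toLex ((ofLex b).1 + m * (2 * Real.pi), (ofLex b).2)

theorem TimedWord.cyclicShift {g : L → Circle → ℝ} (hg : IsCurveSystem g) {ρ : Fin n ≃ L}
    {s : List (Fin (n - 1) × (ℝ ×ₗ ℝ))} {h : Fin (n - 1)} {b : ℝ ×ₗ ℝ}
    (H : TimedWord g ρ ((h, b) :: s)) : TimedWord g (swapAt h ρ) (s ++ [(h, turn 1 b)]) := by
  have hpi := Real.pi_pos
  set τ := (ofLex b).1 with hτ
  have hact : act (swapAt h ρ) (s.map Prod.fst) = ρ := H.act_eq
  have hev : events (swapAt h ρ) (s ++ [(h, turn 1 b)]) =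
      events (swapAt h ρ) s ++ [(ρ (lo h), ρ (hi h), turn 1 b)] := by
    rw [events_append, hact]; rfl
  have hev0 : events ρ ((h, b) :: s) = (ρ (lo h), ρ (hi h), b) :: events (swapAt h ρ) s := rfl
  have htime0 : time (ρ (lo h), ρ (hi h), b) = τ := rfl
  have htime1 : time (ρ (lo h), ρ (hi h), turn 1 b) = τ + 2 * Real.pi := by
    simp [time, turn, hτ]
  have hpw := H.pairwise
  rw [hev0, List.pairwise_cons] at hpw
  obtain ⟨hp1, hp2⟩ := hpw
  rw [htime0] at hp1
  have hInv : ∀ i, Involves (ρ (lo h), ρ (hi h), turn 1 b) i ↔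
    Involves (ρ (lo h), ρ (hi h), b) i := fun i => Iff.rfl
  constructor
  · rw [List.map_append, act_append, hact]; rfl
  · rw [hev, List.pairwise_append]
    refine ⟨hp2, List.pairwise_singleton _ _, ?_⟩
    intro e he e' he' i hi1 hi2
    rw [List.mem_singleton] at he'
    subst he'
    have := hp1 e he i hi2 hi1
    rw [htime1]
    exact ⟨this.2, by linarith⟩
  · intro e he i hi1
    rw [hev, List.mem_append, List.mem_singleton] at he
    rcases he with he | rfl
    · exact H.value e (hev0 ▸ List.mem_cons_of_mem _ he) i hi1
    · rw [htime1, Circle.exp_add_two_pi]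
      exact H.value (ρ (lo h), ρ (hi h), b) (by rw [hev0]; exact List.mem_cons_self) i hi1
  · intro i j t hij ht
    obtain ⟨e, he, h1, h2, m, hm⟩ := H.zero i j t hij ht
    rw [hev0, List.mem_cons] at he
    rw [hev]
    rcases he with rfl | he
    · refine ⟨_, List.mem_append_right _ (List.mem_singleton_self _), h1, h2, m - 1, ?_⟩
      rw [hm, htime0, htime1]; push_cast; ring
    · exact ⟨e, List.mem_append_left _ he, h1, h2, m, hm⟩
  · intro i j hij t ht
    rw [swapAt_symm, swapAt_symm] at hij
    have htl : ∀ e ∈ events (swapAt h ρ) s, Involves e i → Involves e j →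
        time e - 2 * Real.pi < t ∧ t < time e := fun e he =>
      ht e (by rw [hev]; exact List.mem_append_left _ he)
    have hlast := ht (ρ (lo h), ρ (hi h), turn 1 b)
      (by rw [hev]; exact List.mem_append_right _ (List.mem_singleton_self _))
    rw [htime1, hInv, hInv] at hlast
    rcases lt_or_of_adjacentSwap_lt hij with hlt | ⟨e1, e2⟩
    · refine H.lt_of_lt i j hlt t fun e he h1 h2 => ?_
      rw [hev0, List.mem_cons] at he
      rcases he with rfl | he
      · exfalso
        obtain ⟨rfl, rfl⟩ := involves_iff_of_lo_hi hlt h1 h2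
        simp only [Equiv.symm_apply_apply, adjacentSwap_eq, Equiv.swap_apply_left,
          Equiv.swap_apply_right] at hij
        exact absurd hij (lo_lt_hi h).not_gt
      · exact htl e he h1 h2
    · rw [Equiv.symm_apply_eq] at e1 e2
      subst e1 e2
      have hne : ρ (hi h) ≠ ρ (lo h) := ρ.injective.ne (lo_lt_hi h).ne'
      have hlast := hlast (Or.inr rfl) (Or.inl rfl)
      set S : Set ℝ := {τ | ∃ e ∈ events (swapAt h ρ) s, Involves e (ρ (hi h)) ∧
        Involves e (ρ (lo h)) ∧ time e = τ} with hSdef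
      have hSfin : S.Finite := finite_times s _ _
      have hS : ∀ σ ∈ S, τ < σ ∧ σ < τ + 2 * Real.pi := by
        rintro σ ⟨e, he, h1, h2, rfl⟩
        exact hp1 e he (ρ (hi h)) (Or.inr rfl) h1
      have hval := fun i => H.value (ρ (lo h), ρ (hi h), b) (by rw [hev0]; exact List.mem_cons_self) i
      rw [htime0] at hval
      have hcs := hg.changesSignAt hne ((hval _ (Or.inr rfl)).trans (hval _ (Or.inl rfl)).symm)
      have hex : ∀ᶠ t' in 𝓝[<] τ, t' < τ ∧ τ - 2 * Real.pi < t' ∧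
          ∀ σ ∈ S, σ - 2 * Real.pi < t' := by
        refine eventually_mem_nhdsWithin.and (Filter.Eventually.and ?_ ?_)
        · exact nhdsWithin_le_nhds (lt_mem_nhds (by linarith))
        · rw [Filter.eventually_all_finite hSfin]
          exact fun σ hσ => nhdsWithin_le_nhds (lt_mem_nhds (by linarith [(hS σ hσ).2]))
      obtain ⟨t', h1, h2, h3⟩ := hex.exists
      have hneg := hcs.mul_neg_of_translates (hg.continuous_sub _ _) hS ?_ h2 h1 h3
        (show τ < t by linarith [hlast.1]) hlast.2
        (by rintro σ ⟨e, he, h1, h2, rfl⟩; exact (htl e he h1 h2).2)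
      · have hpos : g (ρ (lo h)) (Circle.exp t') < g (ρ (hi h)) (Circle.exp t') := by
          refine H.lt_of_lt _ _ (by simpa using lo_lt_hi h) t' fun e he k1 k2 => ?_
          rw [hev0, List.mem_cons] at he
          rcases he with rfl | he
          · exact ⟨h2, h1⟩
          · have hm : time e ∈ S := ⟨e, he, k2, k1, rfl⟩
            exact ⟨h3 _ hm, h1.trans (hS _ hm).1⟩
        have := neg_of_mul_neg_left (a := g (ρ (hi h)) (Circle.exp t) - g (ρ (lo h)) (Circle.exp t))
          (by rw [mul_comm]; exact hneg) (sub_pos.2 hpos).le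
        linarith
      · intro z hz
        obtain ⟨e, he, k1, k2, m, hm⟩ := H.zero _ _ z hne (sub_eq_zero.1 hz)
        refine ⟨m, ?_⟩
        rw [hev0, List.mem_cons] at he
        rcases he with rfl | he
        · exact Or.inl hm
        · exact Or.inr ⟨_, ⟨e, he, k1, k2, rfl⟩, hm⟩

theorem TimedWord.cyclicShift_symm {g : L → Circle → ℝ} (hg : IsCurveSystem g) {ρ : Fin n ≃ L}
    {s : List (Fin (n - 1) × (ℝ ×ₗ ℝ))} {h : Fin (n - 1)} {b : ℝ ×ₗ ℝ}
    (H : TimedWord g ρ (s ++ [(h, b)])) : TimedWord g (swapAt h ρ) ((h, turn (-1) b) :: s) := by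
  have hpi := Real.pi_pos
  set τ := (ofLex b).1 - 2 * Real.pi with hτ
  have hact : act ρ (s.map Prod.fst) = swapAt h ρ := by
    have : swapAt h (act ρ (s.map Prod.fst)) = ρ := by
      have := H.act_eq
      rwa [List.map_append, act_append] at this
    rw [← swapAt_swapAt h (act ρ (s.map Prod.fst)), this]
  have hev : events (swapAt h ρ) ((h, turn (-1) b) :: s) =
      (ρ (hi h), ρ (lo h), turn (-1) b) :: events ρ s := by
    simp [events]
  have hev0 : events ρ (s ++ [(h, b)]) = events ρ s ++ [(ρ (hi h), ρ (lo h), b)] := by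
    rw [events_append, hact]; simp [events]
  have htime0 : time (ρ (hi h), ρ (lo h), b) = τ + 2 * Real.pi := by simp [time, hτ]
  have htime1 : time (ρ (hi h), ρ (lo h), turn (-1) b) = τ := by
    simp [time, turn, hτ]; ring
  have hpw := H.pairwise
  rw [hev0, List.pairwise_append] at hpw
  obtain ⟨hp2, -, hp1⟩ := hpw
  have hp1 : ∀ e ∈ events ρ s, ∀ i, Involves (ρ (hi h), ρ (lo h), b) i → Involves e i →
      τ < time e ∧ time e < τ + 2 * Real.pi := by
    intro e he i h1 h2
    have := hp1 e he _ (List.mem_singleton_self _) i h2 h1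
    rw [htime0] at this
    exact ⟨by linarith, this.1⟩
  have hmem0 : (ρ (hi h), ρ (lo h), b) ∈ events ρ (s ++ [(h, b)]) := by
    rw [hev0]; exact List.mem_append_right _ (List.mem_singleton_self _)
  have hInv : ∀ i, Involves (ρ (hi h), ρ (lo h), turn (-1) b) i ↔
    Involves (ρ (hi h), ρ (lo h), b) i := fun i => Iff.rfl
  constructor
  · change act (swapAt h (swapAt h ρ)) (s.map Prod.fst) = _
    rw [swapAt_swapAt, hact]
  · rw [hev, List.pairwise_cons]
    refine ⟨?_, hp2⟩
    intro e he i hi1 hi2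
    rw [htime1]
    exact hp1 e he i hi1 hi2
  · intro e he i hi1
    rw [hev, List.mem_cons] at he
    rcases he with rfl | he
    · have := H.value _ hmem0 i hi1
      rw [htime0, Circle.exp_add_two_pi] at this
      rw [htime1, this]; rfl
    · exact H.value e (hev0 ▸ List.mem_append_left _ he) i hi1
  · intro i j t hij ht
    obtain ⟨e, he, h1, h2, m, hm⟩ := H.zero i j t hij ht
    rw [hev0, List.mem_append, List.mem_singleton] at he
    rw [hev]
    rcases he with he | rfl
    · exact ⟨e, List.mem_cons_of_mem _ he, h1, h2, m, hm⟩
    · refine ⟨_, List.mem_cons_self, h1, h2, m + 1, ?_⟩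
      rw [hm, htime0, htime1]; push_cast; ring
  · intro i j hij t ht
    rw [swapAt_symm, swapAt_symm] at hij
    have htl : ∀ e ∈ events ρ s, Involves e i → Involves e j →
        time e - 2 * Real.pi < t ∧ t < time e := fun e he =>
      ht e (by rw [hev]; exact List.mem_cons_of_mem _ he)
    have hlast := ht (ρ (hi h), ρ (lo h), turn (-1) b) (by rw [hev]; exact List.mem_cons_self)
    rw [htime1, hInv, hInv] at hlast
    rcases lt_or_of_adjacentSwap_lt hij with hlt | ⟨e1, e2⟩
    · refine H.lt_of_lt i j hlt t fun e he h1 h2 => ?_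
      rw [hev0, List.mem_append, List.mem_singleton] at he
      rcases he with he | rfl
      · exact htl e he h1 h2
      · exfalso
        obtain ⟨rfl, rfl⟩ := involves_iff_of_lo_hi (b := b) hlt h1.symm h2.symm
        simp only [Equiv.symm_apply_apply, adjacentSwap_eq, Equiv.swap_apply_left,
          Equiv.swap_apply_right] at hij
        exact absurd hij (lo_lt_hi h).not_gt
    · rw [Equiv.symm_apply_eq] at e1 e2
      subst e1 e2
      have hne : ρ (hi h) ≠ ρ (lo h) := ρ.injective.ne (lo_lt_hi h).ne'
      have hlast := hlast (Or.inl rfl) (Or.inr rfl)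
      set S : Set ℝ := {τ | ∃ e ∈ events ρ s, Involves e (ρ (hi h)) ∧
        Involves e (ρ (lo h)) ∧ time e = τ} with hSdef
      have hSfin : S.Finite := finite_times s _ _
      have hS : ∀ σ ∈ S, τ < σ ∧ σ < τ + 2 * Real.pi := by
        rintro σ ⟨e, he, h1, h2, rfl⟩
        exact hp1 e he (ρ (hi h)) (Or.inl rfl) h1
      have hval := fun i => H.value _ hmem0 i
      rw [htime0, Circle.exp_add_two_pi] at hval
      have hcs := hg.changesSignAt hne ((hval _ (Or.inl rfl)).trans (hval _ (Or.inr rfl)).symm)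
      have hex : ∀ᶠ t' in 𝓝[>] τ, τ < t' ∧ t' < τ + 2 * Real.pi ∧ ∀ σ ∈ S, t' < σ := by
        refine eventually_mem_nhdsWithin.and (Filter.Eventually.and ?_ ?_)
        · exact nhdsWithin_le_nhds (gt_mem_nhds (by linarith))
        · rw [Filter.eventually_all_finite hSfin]
          exact fun σ hσ => nhdsWithin_le_nhds (gt_mem_nhds (by linarith [(hS σ hσ).1]))
      obtain ⟨t', h1, h2, h3⟩ := hex.exists
      have hneg := hcs.mul_neg_of_translates (hg.continuous_sub _ _) hS ?_ hlast.1 hlast.2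
        (by rintro σ ⟨e, he, h1, h2, rfl⟩; exact (htl e he h1 h2).1) h1 h2 h3
      · have hpos : g (ρ (lo h)) (Circle.exp t') < g (ρ (hi h)) (Circle.exp t') := by
          refine H.lt_of_lt _ _ (by simpa using lo_lt_hi h) t' fun e he k1 k2 => ?_
          rw [hev0, List.mem_append, List.mem_singleton] at he
          rcases he with he | rfl
          · have hm : time e ∈ S := ⟨e, he, k2, k1, rfl⟩
            exact ⟨by linarith [(hS _ hm).2], h3 _ hm⟩
          · rw [htime0]; exact ⟨by linarith, h2⟩
        have := neg_of_mul_neg_left (a := g (ρ (hi h)) (Circle.exp t) - g (ρ (lo h)) (Circle.exp t))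
          hneg (sub_pos.2 hpos).le
        linarith
      · intro z hz
        obtain ⟨e, he, k1, k2, m, hm⟩ := H.zero _ _ z hne (sub_eq_zero.1 hz)
        rw [hev0, List.mem_append, List.mem_singleton] at he
        rcases he with he | rfl
        · exact ⟨m, Or.inr ⟨_, ⟨e, he, k1, k2, rfl⟩, hm⟩⟩
        · refine ⟨m + 1, Or.inl ?_⟩
          rw [hm, htime0]; push_cast; ring

end TimedWord

section TimedWord

variable {n : ℕ} {L : Type*}

theorem ncard_lt_lo (ρ : Fin n ≃ L) (h : Fin (n - 1)) :
    (ρ '' {k | k < lo h}).ncard = (h : ℕ) := by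
  rw [Set.ncard_image_of_injective _ ρ.injective]
  have : {k : Fin n | k < lo h} = ↑(Finset.Iio (lo h)) := by ext; simp
  rw [this, Set.ncard_coe_finset, Fin.card_Iio]
  rfl

theorem TimedWord.ncard_below {g : L → Circle → ℝ} {ρ : Fin n ≃ L}
    {s : List (Fin (n - 1) × (ℝ ×ₗ ℝ))} {h : Fin (n - 1)} {b : ℝ ×ₗ ℝ}
    (H : TimedWord g ρ ((h, b) :: s)) :
    {k | g k (Circle.exp (ofLex b).1) < (ofLex b).2}.ncard = (h : ℕ) := by
  have hpi := Real.pi_pos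
  rw [← ncard_lt_lo ρ h]
  congr 1
  have hev0 : events ρ ((h, b) :: s) = (ρ (lo h), ρ (hi h), b) :: events (swapAt h ρ) s := rfl
  have hmem0 : (ρ (lo h), ρ (hi h), b) ∈ events ρ ((h, b) :: s) := by
    rw [hev0]; exact List.mem_cons_self
  have hpw := H.pairwise
  rw [hev0, List.pairwise_cons] at hpw
  have hv1 : g (ρ (lo h)) (Circle.exp (ofLex b).1) = (ofLex b).2 :=
    H.value _ hmem0 _ (Or.inl rfl)
  have hv2 : g (ρ (hi h)) (Circle.exp (ofLex b).1) = (ofLex b).2 :=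
    H.value _ hmem0 _ (Or.inr rfl)
  have hcond : ∀ l, l ≠ lo h → l ≠ hi h → ∀ e ∈ events ρ ((h, b) :: s),
      Involves e (ρ l) → Involves e (ρ (lo h)) →
      time e - 2 * Real.pi < (ofLex b).1 ∧ (ofLex b).1 < time e := by
    intro l hl1 hl2 e he h1 h2
    rw [hev0, List.mem_cons] at he
    rcases he with rfl | he
    · rcases h1 with h1 | h1
      · exact absurd (ρ.injective h1).symm hl1
      · exact absurd (ρ.injective h1).symm hl2
    · have := hpw.1 e he (ρ (lo h)) (Or.inl rfl) h2
      simp only [time] at this ⊢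
      exact ⟨by linarith, this.1⟩
  ext k
  obtain ⟨l, rfl⟩ := ρ.surjective k
  simp only [mem_ofPred_eq, mem_image, EmbeddingLike.apply_eq_iff_eq, exists_eq_right]
  constructor
  · intro hlt
    by_contra hge
    rcases eq_or_lt_of_le (not_lt.1 hge) with h1 | h1
    · rw [← h1, hv1] at hlt
      exact lt_irrefl _ hlt
    · by_cases h2 : l = hi h
      · rw [h2, hv2] at hlt
        exact lt_irrefl _ hlt
      · have := H.lt_of_lt (ρ (lo h)) (ρ l) (by simpa using h1) (ofLex b).1
          fun e he k1 k2 => hcond l h1.ne' h2 e he k2 k1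
        rw [hv1] at this
        exact lt_asymm this hlt
  · intro hlt
    have := H.lt_of_lt (ρ l) (ρ (lo h)) (by simpa using hlt) (ofLex b).1
      fun e he k1 k2 => hcond l hlt.ne (hlt.trans (lo_lt_hi h)).ne e he k1 k2
    rwa [hv1] at this

theorem TimedWord.exists_rotate {g : L → Circle → ℝ} (hg : IsCurveSystem g)
    (s₁ : List (Fin (n - 1) × (ℝ ×ₗ ℝ))) :
    ∀ {ρ : Fin n ≃ L} {s₂ : List (Fin (n - 1) × (ℝ ×ₗ ℝ))}, TimedWord g ρ (s₁ ++ s₂) →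
      ∃ (σ : Fin n ≃ L) (s' : List (Fin (n - 1) × (ℝ ×ₗ ℝ))), TimedWord g σ (s₂ ++ s') := by
  induction s₁ with
  | nil => exact fun {ρ s₂} h => ⟨ρ, [], by simpa using h⟩
  | cons x s₁ ih =>
    intro ρ s₂ h
    obtain ⟨σ, s', h'⟩ := ih (s₂ := s₂ ++ [(x.1, turn 1 x.2)])
      (by simpa using TimedWord.cyclicShift hg (h := x.1) (b := x.2) h)
    exact ⟨σ, _, by simpa using h'⟩

theorem TimedWord.ncard_below_of_mem {g : L → Circle → ℝ} (hg : IsCurveSystem g) {ρ : Fin n ≃ L}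
    {s : List (Fin (n - 1) × (ℝ ×ₗ ℝ))} (H : TimedWord g ρ s) {x : Fin (n - 1) × (ℝ ×ₗ ℝ)}
    (hx : x ∈ s) : {k | g k (Circle.exp (ofLex x.2).1) < (ofLex x.2).2}.ncard = (x.1 : ℕ) := by
  obtain ⟨s₁, s₂, rfl⟩ := List.append_of_mem hx
  obtain ⟨σ, s', h⟩ := H.exists_rotate hg s₁
  exact TimedWord.ncard_below (h := x.1) (b := x.2) h

theorem TimedWord.eq_of_translate {g : L → Circle → ℝ} {ρ : Fin n ≃ L}
    {s : List (Fin (n - 1) × (ℝ ×ₗ ℝ))} (H : TimedWord g ρ s) {e e' : L × L × (ℝ ×ₗ ℝ)}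
    (he : e ∈ events ρ s) (he' : e' ∈ events ρ s) {i : L} (hi : Involves e i)
    (hi' : Involves e' i) {m : ℤ} (h : time e' = time e + m * (2 * Real.pi)) : e = e' := by
  have hpi := Real.pi_pos
  let R : L × L × (ℝ ×ₗ ℝ) → L × L × (ℝ ×ₗ ℝ) → Prop := fun e e' =>
    (∃ i, Involves e i ∧ Involves e' i) → (∃ m : ℤ, time e' = time e + m * (2 * Real.pi)) → e = e'
  have : Std.Symm R := ⟨by
    rintro a b hab ⟨i, h1, h2⟩ ⟨m, hm⟩
    exact (hab ⟨i, h2, h1⟩ ⟨-m, by rw [hm]; push_cast; ring⟩).symm⟩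
  have hR : (events ρ s).Pairwise R := by
    refine H.pairwise.imp ?_
    rintro a b hab ⟨i, h1, h2⟩ ⟨m, hm⟩
    exfalso
    obtain ⟨h3, h4⟩ := hab i h1 h2
    refine not_mem_translate (τ := time a + 2 * Real.pi) (z := time b) (m := m - 1) (by linarith)
      h4 ?_
    rw [hm]; push_cast; ring
  exact List.Pairwise.forall_of_forall (fun _ _ _ _ => rfl) hR he he' ⟨i, hi, hi'⟩ ⟨m, h⟩

theorem TimedWord.far_of_lt {g : L → Circle → ℝ} {ρ : Fin n ≃ L}
    {s t : List (Fin (n - 1) × (ℝ ×ₗ ℝ))} {x y : Fin (n - 1) × (ℝ ×ₗ ℝ)}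
    (H : TimedWord g ρ (s ++ x :: y :: t)) (hlt : y.2 < x.2) :
    (x.1 : ℕ) + 1 < y.1 ∨ (y.1 : ℕ) + 1 < x.1 := by
  by_contra hcon
  have hpw := H.pairwise
  rw [events_append, List.pairwise_append] at hpw
  set σ := act ρ (s.map Prod.fst)
  have hpw := List.rel_of_pairwise_cons hpw.2.1
    (show (swapAt x.1 σ (lo y.1), swapAt x.1 σ (hi y.1), y.2) ∈ events (swapAt x.1 σ) (y :: t) from
      List.mem_cons_self)
  have hle : (ofLex y.2).1 ≤ (ofLex x.2).1 := by
    rcases Prod.Lex.lt_iff.1 hlt with h | h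
    · exact h.le
    · exact h.1.le
  have key : ∀ i, Involves (σ (lo x.1), σ (hi x.1), x.2) i →
      ¬ Involves (swapAt x.1 σ (lo y.1), swapAt x.1 σ (hi y.1), y.2) i := fun i h1 h2 =>
    absurd (hpw i h1 h2).1 (not_lt.2 hle)
  have hcases : (y.1 : ℕ) = x.1 ∨ (y.1 : ℕ) = x.1 + 1 ∨ (x.1 : ℕ) = y.1 + 1 := by omega
  rcases hcases with h | h | h
  · have : lo y.1 = lo x.1 := Fin.ext h
    exact key (σ (hi x.1)) (Or.inr rfl) (Or.inl (by simp [this]))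
  · have : lo y.1 = hi x.1 := Fin.ext h
    exact key (σ (lo x.1)) (Or.inl rfl) (Or.inl (by simp [this]))
  · have : hi y.1 = lo x.1 := Fin.ext h.symm
    exact key (σ (hi x.1)) (Or.inr rfl) (Or.inr (by simp [this]))

end TimedWord

/-! ### Normalization of timed words -/

/-- The number of inversions of a list. -/
def inversions {α : Type*} [LinearOrder α] : List α → ℕ
  | [] => 0
  | a :: l => l.countP (· < a) + inversions l

theorem inversions_swap_lt {α : Type*} [LinearOrder α] (l₁ l₂ : List α) {a b : α} (h : b < a) :
    inversions (l₁ ++ b :: a :: l₂) < inversions (l₁ ++ a :: b :: l₂) := by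
  induction l₁ with
  | nil =>
    simp only [List.nil_append, inversions, List.countP_cons, decide_eq_true h,
      decide_eq_false h.not_gt]
    simp
    omega
  | cons c l₁ ih =>
    simp only [List.cons_append, inversions]
    have : (l₁ ++ b :: a :: l₂).Perm (l₁ ++ a :: b :: l₂) :=
      List.Perm.append_left _ (List.Perm.swap _ _ _)
    rw [this.countP_eq]
    omega

theorem pairwise_le_or_exists_descent {α β : Type*} [LinearOrder β] (f : α → β) (l : List α) :
    l.Pairwise (fun x y => f x ≤ f y) ∨ ∃ l₁ x y l₂, l = l₁ ++ x :: y :: l₂ ∧ f y < f x := by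
  by_cases h : l.IsChain fun x y => f x ≤ f y
  · left
    have : IsTrans α fun x y => f x ≤ f y := ⟨fun _ _ _ => le_trans⟩
    exact List.isChain_iff_pairwise.1 h
  · right
    induction l with
    | nil => simp at h
    | cons a l ih =>
      cases l with
      | nil => simp at h
      | cons b l =>
        by_cases hab : f a ≤ f b
        · rw [List.isChain_cons_cons] at h
          obtain ⟨l₁, x, y, l₂, h1, h2⟩ := ih fun hc => h ⟨hab, hc⟩
          exact ⟨a :: l₁, x, y, l₂, by rw [h1]; rfl, h2⟩
        · exact ⟨[], a, b, l, rfl, not_le.1 hab⟩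

section SwapPair

variable {L : Type*} [Fintype L]

/-- The swap pair of a timed word. -/
def TimedWord.swapPair {g : L → Circle → ℝ} {ρ : Fin (Fintype.card L) ≃ L}
    {s : List (Fin (Fintype.card L - 1) × (ℝ ×ₗ ℝ))} (h : TimedWord g ρ s) : SwapPair L :=
  ⟨ρ, s.map Prod.fst, (act_eq_self_iff _ _).1 h.act_eq⟩

theorem TimedWord.exists_sorted {g : L → Circle → ℝ} {ρ : Fin (Fintype.card L) ≃ L}
    {s : List (Fin (Fintype.card L - 1) × (ℝ ×ₗ ℝ))} (h : TimedWord g ρ s) :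
    ∃ (s' : List (Fin (Fintype.card L - 1) × (ℝ ×ₗ ℝ))) (h' : TimedWord g ρ s'),
      s'.Perm s ∧ s'.Pairwise (fun x y => x.2 ≤ y.2) ∧ h.swapPair.Equivalent h'.swapPair := by
  generalize hN : inversions (s.map Prod.snd) = N
  induction N using Nat.strong_induction_on generalizing s with
  | _ N ih =>
    rcases pairwise_le_or_exists_descent Prod.snd s with hs | ⟨l₁, x, y, l₂, rfl, hlt⟩
    · exact ⟨s, h, List.Perm.refl _, hs, Relation.EqvGen.refl _⟩
    · have hfar := h.far_of_lt hlt
      have h' := h.independent hfar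
      have hinv : inversions ((l₁ ++ y :: x :: l₂).map Prod.snd) < N := by
        rw [← hN, List.map_append, List.map_append]
        exact inversions_swap_lt _ _ hlt
      obtain ⟨s'', h'', hp, hs, heq⟩ := ih _ hinv h' rfl
      refine ⟨s'', h'', hp.trans (List.Perm.append_left _ (List.Perm.swap _ _ _)), hs, ?_⟩
      refine Relation.EqvGen.trans _ _ _ (Relation.EqvGen.rel _ _ ?_) heq
      exact SwapPair.Step.independent _ _ x.1 y.1 (l₁.map Prod.fst) (l₂.map Prod.fst)
        (by simp [TimedWord.swapPair]) (by simp [TimedWord.swapPair]) rfl hfar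

/-- The index of the window `(2πw, 2π(w + 1)]` that contains the time of `b`. -/
noncomputable def windowIndex (b : ℝ ×ₗ ℝ) : ℤ := ⌈(ofLex b).1 / (2 * Real.pi)⌉ - 1

theorem windowIndex_turn (m : ℤ) (b : ℝ ×ₗ ℝ) : windowIndex (turn m b) = windowIndex b + m := by
  have hpi := Real.pi_pos
  simp only [windowIndex, turn, ofLex_toLex]
  rw [add_div, mul_div_cancel_right₀ _ (by positivity), Int.ceil_add_intCast]
  ring

theorem windowIndex_mono {b c : ℝ ×ₗ ℝ} (h : b ≤ c) : windowIndex b ≤ windowIndex c := by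
  have hpi := Real.pi_pos
  have h1 : (ofLex b).1 ≤ (ofLex c).1 := by
    rcases Prod.Lex.le_iff.1 h with h | h
    · exact h.le
    · exact h.1.le
  unfold windowIndex
  gcongr

theorem mem_Ioc_of_windowIndex_eq_zero {b : ℝ ×ₗ ℝ} (h : windowIndex b = 0) :
    (ofLex b).1 ∈ Ioc 0 (2 * Real.pi) := by
  have hpi := Real.pi_pos
  have h1 : ⌈(ofLex b).1 / (2 * Real.pi)⌉ = 1 := by unfold windowIndex at h; omega
  rw [Int.ceil_eq_iff] at h1
  constructor
  · have := h1.1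
    norm_num at this
    exact (div_pos_iff_of_pos_right (by positivity)).1 this
  · have := h1.2
    rw [div_le_iff₀ (by positivity)] at this
    simpa using this

theorem TimedWord.exists_normal {g : L → Circle → ℝ} (hg : IsCurveSystem g)
    {ρ : Fin (Fintype.card L) ≃ L}
    {s : List (Fin (Fintype.card L - 1) × (ℝ ×ₗ ℝ))} (h : TimedWord g ρ s) :
    ∃ (ρ' : Fin (Fintype.card L) ≃ L) (s' : List (Fin (Fintype.card L - 1) × (ℝ ×ₗ ℝ)))
      (h' : TimedWord g ρ' s'), s'.Pairwise (fun x y => x.2 ≤ y.2) ∧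
      (∀ x ∈ s', (ofLex x.2).1 ∈ Ioc 0 (2 * Real.pi)) ∧
      h.swapPair.Equivalent h'.swapPair := by
  generalize hN : (s.map fun x => (windowIndex x.2).natAbs).sum = N
  induction N using Nat.strong_induction_on generalizing s ρ with
  | _ N ih =>
    obtain ⟨s₁, h₁, hperm, hsort, heq₁⟩ := h.exists_sorted
    have hN₁ : (s₁.map fun x => (windowIndex x.2).natAbs).sum = N := by
      rw [← hN]; exact (hperm.map _).sum_eq
    by_cases hall : ∀ x ∈ s₁, windowIndex x.2 = 0
    · exact ⟨ρ, s₁, h₁, hsort, fun x hx => mem_Ioc_of_windowIndex_eq_zero (hall x hx), heq₁⟩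
    push Not at hall
    obtain ⟨x, hx, hx0⟩ := hall
    rcases lt_or_gt_of_ne hx0 with hneg | hpos
    · cases s₁ with
      | nil => simp at hx
      | cons y t =>
        have hy : windowIndex y.2 < 0 := by
          rcases List.mem_cons.1 hx with rfl | hx
          · exact hneg
          · exact (windowIndex_mono (List.rel_of_pairwise_cons hsort hx)).trans_lt hneg
        have h₂ := TimedWord.cyclicShift hg (h := y.1) (b := y.2) h₁
        obtain ⟨ρ', s', h', hs', hw', heq'⟩ := ih _ (by
          rw [← hN₁]
          simp only [List.map_append, List.map_cons, List.map_nil, List.sum_append, List.sum_cons,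
            List.sum_nil, windowIndex_turn]
          omega) h₂ rfl
        refine ⟨ρ', s', h', hs', hw', heq₁.trans _ _ _ (Relation.EqvGen.trans _ _ _
          (Relation.EqvGen.rel _ _ ?_) heq')⟩
        exact SwapPair.Step.cyclicShift _ _ y.1 (t.map Prod.fst) rfl
          (by simp [TimedWord.swapPair]) rfl
    · rcases List.eq_nil_or_concat s₁ with rfl | ⟨t, y, rfl⟩
      · simp at hx
      · rw [List.concat_eq_append] at hx hN₁ hsort
        have h₁' := h₁
        simp only [List.concat_eq_append] at h₁'
        have hy : 0 < windowIndex y.2 := by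
          rcases List.mem_append.1 hx with hx | hx
          · exact hpos.trans_le (windowIndex_mono
              ((List.pairwise_append.1 hsort).2.2 x hx y (List.mem_singleton_self _)))
          · rw [List.mem_singleton.1 hx] at hpos; exact hpos
        have h₂ := TimedWord.cyclicShift_symm hg (h := y.1) (b := y.2) h₁'
        obtain ⟨ρ', s', h', hs', hw', heq'⟩ := ih _ (by
          rw [← hN₁]
          simp only [List.map_append, List.map_cons, List.map_nil, List.sum_append, List.sum_cons,
            List.sum_nil, windowIndex_turn]
          omega) h₂ rfl
        refine ⟨ρ', s', h', hs', hw', heq₁.trans _ _ _ (Relation.EqvGen.trans _ _ _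
          (Relation.EqvGen.symm _ _ (Relation.EqvGen.rel _ _ ?_)) heq')⟩
        exact SwapPair.Step.cyclicShift _ _ y.1 (t.map Prod.fst) rfl
          (by simp [TimedWord.swapPair]) (swapAt_swapAt _ _).symm

theorem TimedWord.isSwapPairOf {g : L → Circle → ℝ} (hg : IsCurveSystem g)
    {ρ : Fin (Fintype.card L) ≃ L}
    {s : List (Fin (Fintype.card L - 1) × (ℝ ×ₗ ℝ))} (h : TimedWord g ρ s)
    (hsort : s.Pairwise (fun x y => x.2 ≤ y.2))
    (hwin : ∀ x ∈ s, (ofLex x.2).1 ∈ Ioc 0 (2 * Real.pi)) : IsSwapPairOf g h.swapPair := by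
  have hwin' : ∀ e ∈ events ρ s, time e ∈ Ioc 0 (2 * Real.pi) := by
    intro e he
    have : e.2.2 ∈ (events ρ s).map fun e => e.2.2 := List.mem_map_of_mem he
    rw [map_events] at this
    obtain ⟨x, hx, hxe⟩ := List.mem_map.1 this
    have := hwin x hx
    rwa [hxe] at this
  have hcross : ∀ p, p ∈ s.map Prod.snd ↔ p ∈ crossings g := by
    intro p
    rw [← map_events ρ s, List.mem_map]
    constructor
    · rintro ⟨e, he, rfl⟩
      exact ⟨hwin' e he, e.1, e.2.1, ne_of_mem_events he, h.value e he _ (Or.inl rfl),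
        h.value e he _ (Or.inr rfl)⟩
    · rintro ⟨hp, i, j, hij, hi, hj⟩
      obtain ⟨e, he, h1, h2, m, hm⟩ := h.zero i j _ hij (hi.trans hj.symm)
      have ht := eq_of_mem_Ioc_translate hp (hwin' e he) hm
      refine ⟨e, he, ofLex.injective (Prod.ext ht.symm ?_)⟩
      rw [← h.value e he i h1, ← ht, hi]
  constructor
  · intro t ht hlt a b hab
    refine h.lt_of_lt (ρ a) (ρ b) (by simpa using hab) t fun e he _ _ => ?_
    have h1 := hlt e.2.2 ((hcross _).1 (by
      rw [← map_events ρ s]; exact List.mem_map_of_mem he))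
    exact ⟨by linarith [(hwin' e he).2, ht.1], h1⟩
  · refine ⟨s.map Prod.snd, ?_, hcross, ?_⟩
    · have hle : (events ρ s).Pairwise fun e e' => e.2.2 ≤ e'.2.2 := by
        have : (s.map Prod.snd).Pairwise (· ≤ ·) := List.pairwise_map.2 hsort
        rw [← map_events ρ s] at this
        exact List.pairwise_map.1 this
      rw [← map_events ρ s, List.pairwise_map]
      refine (hle.and h.pairwise).imp_of_mem ?_
      rintro a b ha hb ⟨h1, h2⟩
      refine lt_of_le_of_ne h1 fun heq => ?_
      have htime : time a = time b := by simp only [time, heq]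
      by_cases hi : a.1 = b.1
      · exact absurd (h2 a.1 (Or.inl rfl) (Or.inl hi.symm)).1 (by rw [htime]; exact lt_irrefl _)
      · obtain ⟨c, hc, k1, k2, m, hm⟩ := h.zero a.1 b.1 (time a) hi (by
          rw [h.value a ha _ (Or.inl rfl), htime, h.value b hb _ (Or.inl rfl), heq])
        have := h.eq_of_translate hc ha k1 (Or.inl rfl) hm
        subst this
        exact absurd (h2 b.1 k2 (Or.inl rfl)).1 (by rw [htime]; exact lt_irrefl _)
    · simp only [TimedWord.swapPair, List.map_map, bind_pure_comp, List.map_eq_map]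
      refine List.map_congr_left fun x hx => ?_
      exact (h.ncard_below_of_mem hg hx).symm

end SwapPair

/-! ### Sweeping the crossings -/

section Sweep

variable {n : ℕ} {L : Type*}

theorem eq_of_forall_symm_lt {ρ σ : Fin n ≃ L} (h : ∀ i j, ρ.symm i < ρ.symm j → σ.symm i < σ.symm j) :
    ρ = σ := by
  have hm : StrictMono (ρ.trans σ.symm) := fun a b hab => h _ _ (by simpa using hab)
  have he : (ρ.trans σ.symm) = Equiv.refl _ := by
    have := Subsingleton.elim
      (StrictMono.orderIsoOfSurjective _ hm (ρ.trans σ.symm).surjective) (OrderIso.refl _)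
    ext k
    exact congrArg Fin.val (congrArg (fun F : Fin n ≃o Fin n => F k) this)
  ext k
  have := congrArg (fun F : Fin n ≃ Fin n => σ (F k)) he
  simpa using this

theorem fst_le_of_lt {p q : ℝ ×ₗ ℝ} (h : p < q) : (ofLex p).1 ≤ (ofLex q).1 := by
  rcases Prod.Lex.lt_iff.1 h with h | h
  · exact h.le
  · exact h.1.le

/-- The point `p` lies on the curves with indices `i` and `j`. -/
def OnBoth (g : L → Circle → ℝ) (i j : L) (p : ℝ ×ₗ ℝ) : Prop :=
  g i (Circle.exp (ofLex p).1) = (ofLex p).2 ∧ g j (Circle.exp (ofLex p).1) = (ofLex p).2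

/-- The sequence `ρ` is the vertical order of the curves when the crossings in `c₁` have been
passed and those in `c₂` have not; times are restricted to `(0, a)`. -/
def IsOrderBetween (g : L → Circle → ℝ) (a : ℝ) (ρ : Fin n ≃ L) (c₁ c₂ : List (ℝ ×ₗ ℝ)) : Prop :=
  ∀ i j, ρ.symm i < ρ.symm j → ∀ t ∈ Ioo 0 a, (∀ q ∈ c₁, OnBoth g i j q → (ofLex q).1 < t) →
    (∀ q ∈ c₂, OnBoth g i j q → t < (ofLex q).1) → g i (Circle.exp t) < g j (Circle.exp t)

theorem lt_fst_of_lt {g : L → Circle → ℝ} {i j : L} {p q : ℝ ×ₗ ℝ} (h : p < q)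
    (hi : g i (Circle.exp (ofLex p).1) = (ofLex p).2)
    (hq : OnBoth g i j q ∨ OnBoth g j i q) : (ofLex p).1 < (ofLex q).1 := by
  have hq : g i (Circle.exp (ofLex q).1) = (ofLex q).2 := by
    rcases hq with h | h
    · exact h.1
    · exact h.2
  refine lt_of_le_of_ne (fst_le_of_lt h) fun he => ?_
  rcases Prod.Lex.lt_iff.1 h with h | h
  · exact h.ne he
  · rw [← hi, ← hq, he] at h
    exact lt_irrefl _ h.2

theorem IsOrderBetween.sweep_one [Finite L] {g : L → Circle → ℝ} (hg : IsCurveSystem g) {a : ℝ}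
    {ρ : Fin n ≃ L} {c₁ c₂ : List (ℝ ×ₗ ℝ)} {p : ℝ ×ₗ ℝ} {h : Fin (n - 1)}
    (hpw : (c₁ ++ p :: c₂).Pairwise (· < ·)) (hp : p ∈ crossings g) (ha : 2 * Real.pi < a)
    (hzero : ∀ i j, i ≠ j → ∀ t ∈ Ioo 0 a, g i (Circle.exp t) = g j (Circle.exp t) →
      ∃ q ∈ c₁ ++ p :: c₂, OnBoth g i j q ∧ (ofLex q).1 = t)
    (hh : (h : ℕ) = {k | g k (Circle.exp (ofLex p).1) < (ofLex p).2}.ncard)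
    (H : IsOrderBetween g a ρ c₁ (p :: c₂)) :
    g (ρ (lo h)) (Circle.exp (ofLex p).1) = (ofLex p).2 ∧
    g (ρ (hi h)) (Circle.exp (ofLex p).1) = (ofLex p).2 ∧
    IsOrderBetween g a (swapAt h ρ) (c₁ ++ [p]) c₂ := by
  obtain ⟨hpt, i₀, j₀, hij, hi₀, hj₀⟩ := hp
  wlog hlt : ρ.symm i₀ < ρ.symm j₀ generalizing i₀ j₀
  · refine this j₀ i₀ hij.symm hj₀ hi₀ (lt_of_le_of_ne (not_lt.1 hlt) ?_)
    exact ρ.symm.injective.ne hij.symm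
  set τ := (ofLex p).1 with hτ
  set y := (ofLex p).2 with hy
  rw [List.pairwise_append, List.pairwise_cons] at hpw
  obtain ⟨-, ⟨hpc₂, -⟩, hc₁⟩ := hpw
  have hc₁p : ∀ q ∈ c₁, q < p := fun q hq => hc₁ q hq p List.mem_cons_self
  have hτa : τ ∈ Ioo 0 a := ⟨hpt.1, hpt.2.trans_lt ha⟩
  have htriple : ∀ l, l ≠ i₀ → l ≠ j₀ → g l (Circle.exp τ) ≠ y := fun l h1 h2 h3 =>
    hg.no_triple i₀ j₀ l hij h1.symm h2.symm _ (hi₀.trans hj₀.symm) (hi₀.trans h3.symm)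
  have hbefore : ∀ l m, g m (Circle.exp τ) = y → l ≠ i₀ → l ≠ j₀ → ∀ q,
      OnBoth g l m q ∨ OnBoth g m l q → (q ∈ c₁ → (ofLex q).1 < τ) ∧
      (q ∈ p :: c₂ → τ < (ofLex q).1) := by
    intro l m hm hl1 hl2 q hq
    constructor
    · intro hqc
      have hqm : g m (Circle.exp (ofLex q).1) = (ofLex q).2 := by
        rcases hq with h | h
        · exact h.2
        · exact h.1
      refine lt_of_le_of_ne (fst_le_of_lt (hc₁p q hqc)) fun he => ?_
      rcases Prod.Lex.lt_iff.1 (hc₁p q hqc) with h | h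
      · exact h.ne he
      · rw [← hqm, ← hy, ← hm, he] at h
        exact lt_irrefl _ h.2
    · intro hqc
      rcases List.mem_cons.1 hqc with rfl | hqc
      · rcases hq with h | h
        · exact absurd h.1 (htriple l hl1 hl2)
        · exact absurd h.2 (htriple l hl1 hl2)
      · exact lt_fst_of_lt (hpc₂ q hqc) hm hq.symm
  have hbelow : ∀ l m, g m (Circle.exp τ) = y → l ≠ i₀ → l ≠ j₀ → ρ.symm l < ρ.symm m →
      g l (Circle.exp τ) < y := by
    intro l m hm hl1 hl2 hlm
    have := H l m hlm τ hτa (fun q hq hb => (hbefore l m hm hl1 hl2 q (Or.inl hb)).1 hq)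
      (fun q hq hb => (hbefore l m hm hl1 hl2 q (Or.inl hb)).2 hq)
    rwa [hm] at this
  have habove : ∀ l m, g m (Circle.exp τ) = y → l ≠ i₀ → l ≠ j₀ → ρ.symm m < ρ.symm l →
      y < g l (Circle.exp τ) := by
    intro l m hm hl1 hl2 hlm
    have := H m l hlm τ hτa (fun q hq hb => (hbefore l m hm hl1 hl2 q (Or.inr hb)).1 hq)
      (fun q hq hb => (hbefore l m hm hl1 hl2 q (Or.inr hb)).2 hq)
    rwa [hm] at this
  have hadj : (ρ.symm j₀ : ℕ) = ρ.symm i₀ + 1 := by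
    by_contra hne
    have hlt' : (ρ.symm i₀ : ℕ) < ρ.symm j₀ := hlt
    let k : Fin n := ⟨ρ.symm i₀ + 1, by omega⟩
    have k1 : ρ.symm i₀ < k := by rw [Fin.lt_def]; simp [k]
    have k2 : k < ρ.symm j₀ := by rw [Fin.lt_def]; simp only [k]; omega
    have n1 : ρ k ≠ i₀ := fun h => k1.ne (by rw [← h]; simp)
    have n2 : ρ k ≠ j₀ := fun h => k2.ne (by rw [← h]; simp)
    exact lt_asymm (habove (ρ k) i₀ hi₀ n1 n2 (by simpa using k1))
      (hbelow (ρ k) j₀ hj₀ n1 n2 (by simpa using k2))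
  have hcard : {k | g k (Circle.exp τ) < y} = ρ '' {k | k < ρ.symm i₀} := by
    ext l
    obtain ⟨k, rfl⟩ := ρ.surjective l
    simp only [mem_ofPred_eq, mem_image, EmbeddingLike.apply_eq_iff_eq, exists_eq_right]
    have hne : g (ρ k) (Circle.exp τ) < y → ρ k ≠ i₀ ∧ ρ k ≠ j₀ := fun hk =>
      ⟨fun h => by rw [h, hi₀] at hk; exact lt_irrefl _ hk,
        fun h => by rw [h, hj₀] at hk; exact lt_irrefl _ hk⟩
    constructor
    · intro hk
      by_contra hge
      have hk' := hne hk
      have : ρ.symm i₀ < k := lt_of_le_of_ne (not_lt.1 hge) fun h => hk'.1 (by rw [← h]; simp)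
      exact lt_asymm hk (habove (ρ k) i₀ hi₀ hk'.1 hk'.2 (by simpa using this))
    · intro hk
      refine hbelow (ρ k) i₀ hi₀ (fun h => hk.ne (by rw [← h]; simp))
        (fun h => ?_) (by simpa using hk)
      rw [← h] at hlt
      simp only [Equiv.symm_apply_apply] at hlt
      exact lt_asymm hk hlt
  have hlo : ρ (lo h) = i₀ := by
    rw [← Equiv.eq_symm_apply]
    ext
    rw [hcard, Set.ncard_image_of_injective _ ρ.injective] at hh
    have : {k : Fin n | k < ρ.symm i₀} = ↑(Finset.Iio (ρ.symm i₀)) := by ext; simp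
    rw [this, Set.ncard_coe_finset, Fin.card_Iio] at hh
    exact hh
  have hlo' : (h : ℕ) = ρ.symm i₀ := by
    rw [← hlo, Equiv.symm_apply_apply]; rfl
  have hhi : ρ (hi h) = j₀ := by
    rw [← Equiv.eq_symm_apply]
    ext
    rw [hadj, ← hlo']; rfl
  refine ⟨by rw [hlo, hi₀], by rw [hhi, hj₀], ?_⟩
  intro i j hpos t ht hp1 hp2
  rw [swapAt_symm, swapAt_symm] at hpos
  have hpos' := lt_or_of_adjacentSwap_lt hpos
  rcases hpos' with hpos' | ⟨e1, e2⟩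
  · have hnb : ¬ OnBoth g i j p := by
      intro hb
      have hi' : i = i₀ ∨ i = j₀ := by
        by_contra hc
        push Not at hc
        exact htriple i hc.1 hc.2 hb.1
      have hj' : j = i₀ ∨ j = j₀ := by
        by_contra hc
        push Not at hc
        exact htriple j hc.1 hc.2 hb.2
      rcases hi' with rfl | rfl <;> rcases hj' with rfl | rfl
      · exact lt_irrefl _ hpos'
      · rw [← hlo, ← hhi] at hpos
        simp only [Equiv.symm_apply_apply, adjacentSwap_eq, Equiv.swap_apply_left,
          Equiv.swap_apply_right] at hpos
        exact absurd hpos (lo_lt_hi h).not_gt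
      · exact lt_asymm hlt hpos'
      · exact lt_irrefl _ hpos'
    refine H i j hpos' t ht (fun q hq => hp1 q (List.mem_append_left _ hq)) fun q hq hb => ?_
    rcases List.mem_cons.1 hq with rfl | hq
    · exact absurd hb hnb
    · exact hp2 q hq hb
  · rw [Equiv.symm_apply_eq] at e1 e2
    rw [hhi] at e1
    rw [hlo] at e2
    rw [e1, e2]
    rw [e1, e2] at hp1 hp2
    have hτt : τ < t := hp1 p (List.mem_append_right _ (List.mem_singleton_self _)) ⟨hj₀, hi₀⟩
    have hc1τ : ∀ q ∈ c₁, OnBoth g i₀ j₀ q → (ofLex q).1 < τ := by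
      intro q hq hb
      refine lt_of_le_of_ne (fst_le_of_lt (hc₁p q hq)) fun he => ?_
      rcases Prod.Lex.lt_iff.1 (hc₁p q hq) with h | h
      · exact h.ne he
      · rw [← hb.1, ← hy, ← hi₀, he] at h
        exact lt_irrefl _ h.2
    have hc2τ : ∀ q ∈ c₂, OnBoth g i₀ j₀ q → τ < (ofLex q).1 := fun q hq hb =>
      lt_fst_of_lt (hpc₂ q hq) hi₀ (Or.inl hb)
    have hex : ∀ᶠ t' in 𝓝[<] τ, t' < τ ∧ 0 < t' ∧
        ∀ q ∈ {q | q ∈ c₁}, OnBoth g i₀ j₀ q → (ofLex q).1 < t' := by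
      refine eventually_mem_nhdsWithin.and (Filter.Eventually.and ?_ ?_)
      · exact nhdsWithin_le_nhds (lt_mem_nhds hpt.1)
      · rw [Filter.eventually_all_finite (List.finite_toSet c₁)]
        intro q hq
        by_cases hb : OnBoth g i₀ j₀ q
        · filter_upwards [nhdsWithin_le_nhds (lt_mem_nhds (hc1τ q hq hb))] with t' ht' _ using ht'
        · exact Eventually.of_forall fun t' h => absurd h hb
    obtain ⟨t', h1, h2, h3⟩ := hex.exists
    have hpos := H i₀ j₀ hlt t' ⟨h2, h1.trans hτa.2⟩ h3 (by
      intro q hq hb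
      rcases List.mem_cons.1 hq with rfl | hq
      · exact h1
      · exact h1.trans (hc2τ q hq hb))
    have hneg := (hg.changesSignAt hij (hi₀.trans hj₀.symm)).mul_neg (hg.continuous_sub _ _) h1 hτt
      (fun z hz h0 => by
        obtain ⟨q, hq, hb, hqz⟩ := hzero i₀ j₀ hij z ⟨h2.trans_le hz.1, hz.2.trans hτa.2⟩
          (sub_eq_zero.1 h0)
        rcases List.mem_append.1 hq with hq | hq
        · have := h3 q hq hb; linarith [hz.1]
        · rcases List.mem_cons.1 hq with rfl | hq
          · linarith [hz.2]
          · have := hc2τ q hq hb; linarith [hz.2])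
      (fun z hz h0 => by
        obtain ⟨q, hq, hb, hqz⟩ := hzero i₀ j₀ hij z ⟨hpt.1.trans hz.1, hz.2.trans_lt ht.2⟩
          (sub_eq_zero.1 h0)
        rcases List.mem_append.1 hq with hq | hq
        · have := hc1τ q hq hb; linarith [hz.1]
        · rcases List.mem_cons.1 hq with rfl | hq
          · linarith [hz.1]
          · have := hp2 q hq hb.symm; linarith [hz.2])
    have := pos_of_mul_neg_right hneg (sub_neg.2 hpos).le
    linarith

theorem IsOrderBetween.sweep [Finite L] {g : L → Circle → ℝ} (hg : IsCurveSystem g) {a : ℝ}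
    {c : List (ℝ ×ₗ ℝ)} (hpw : c.Pairwise (· < ·)) (hc : ∀ p ∈ c, p ∈ crossings g)
    (ha : 2 * Real.pi < a)
    (hzero : ∀ i j, i ≠ j → ∀ t ∈ Ioo 0 a, g i (Circle.exp t) = g j (Circle.exp t) →
      ∃ q ∈ c, OnBoth g i j q ∧ (ofLex q).1 = t) (w : List (Fin (n - 1))) :
    ∀ {ρ : Fin n ≃ L} {c₁ c₂ : List (ℝ ×ₗ ℝ)}, c = c₁ ++ c₂ →
      w.map Fin.val = c₂.map (fun p => {k | g k (Circle.exp (ofLex p).1) < (ofLex p).2}.ncard) →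
      IsOrderBetween g a ρ c₁ c₂ → IsOrderBetween g a (act ρ w) c [] ∧
      ∀ e ∈ events ρ (w.zip c₂), ∀ i, Involves e i → g i (Circle.exp (time e)) = (ofLex e.2.2).2 := by
  induction w with
  | nil =>
    intro ρ c₁ c₂ hcc hw H
    have : c₂ = [] := List.map_eq_nil_iff.1 hw.symm
    subst this
    rw [List.append_nil] at hcc
    subst hcc
    exact ⟨H, by simp [events]⟩
  | cons h w ih =>
    intro ρ c₁ c₂ hcc hw H
    cases c₂ with
    | nil => simp at hw
    | cons p c₂ =>
      rw [List.map_cons, List.map_cons, List.cons.injEq] at hw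
      subst hcc
      obtain ⟨h1, h2, h3⟩ := H.sweep_one hg hpw (hc p (by simp)) ha hzero hw.1
      obtain ⟨h4, h5⟩ := ih (c₁ := c₁ ++ [p]) (by simp) hw.2 h3
      refine ⟨h4, fun e he i hi => ?_⟩
      rw [List.zip_cons_cons, events, List.mem_cons] at he
      rcases he with rfl | he
      · rcases hi with rfl | rfl
        · exact h1
        · exact h2
      · exact h5 e he i hi

/-- The crossings in lexicographic order, with the order of the curves before the first one and the
numbers of curves below them, form a timed word. -/
theorem timedWord_of_crossings [Finite L] {g : L → Circle → ℝ} (hg : IsCurveSystem g)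
    {ρ : Fin n ≃ L} {c : List (ℝ ×ₗ ℝ)} {w : List (Fin (n - 1))} (hpw : c.Pairwise (· < ·))
    (hc : ∀ p, p ∈ c ↔ p ∈ crossings g)
    (hw : w.map Fin.val = c.map (fun p => {k | g k (Circle.exp (ofLex p).1) < (ofLex p).2}.ncard))
    (hρ : ∀ t ∈ Ioc 0 (2 * Real.pi), (∀ p ∈ crossings g, t < (ofLex p).1) →
      StrictMono fun a => g (ρ a) (Circle.exp t)) : TimedWord g ρ (w.zip c) := by
  have hpi := Real.pi_pos
  have hwin : ∀ p ∈ c, (ofLex p).1 ∈ Ioc 0 (2 * Real.pi) := fun p hp => ((hc p).1 hp).1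
  obtain ⟨ε, hε0, hε1, hε⟩ : ∃ ε > 0, ε < 2 * Real.pi ∧ ∀ p ∈ c, ε < (ofLex p).1 := by
    have : ∀ᶠ ε in 𝓝[>] (0 : ℝ), 0 < ε ∧ ε < 2 * Real.pi ∧ ∀ p ∈ {p | p ∈ c}, ε < (ofLex p).1 := by
      refine eventually_mem_nhdsWithin.and (Filter.Eventually.and ?_ ?_)
      · exact nhdsWithin_le_nhds (gt_mem_nhds (by linarith))
      · rw [Filter.eventually_all_finite (List.finite_toSet c)]
        exact fun q hq => nhdsWithin_le_nhds (gt_mem_nhds (hwin q hq).1)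
    obtain ⟨ε, h⟩ := this.exists
    exact ⟨ε, h.1, h.2.1, h.2.2⟩
  have hcross : ∀ i j, i ≠ j → ∀ t ∈ Ioc 0 (2 * Real.pi), g i (Circle.exp t) = g j (Circle.exp t) →
      ∃ q ∈ c, OnBoth g i j q ∧ (ofLex q).1 = t := by
    intro i j hij t ht h
    exact ⟨toLex (t, g i (Circle.exp t)), (hc _).2 ⟨ht, i, j, hij, rfl, h.symm⟩, ⟨rfl, h.symm⟩, rfl⟩
  have hzero : ∀ i j, i ≠ j → ∀ t ∈ Ioo 0 (2 * Real.pi + ε),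
      g i (Circle.exp t) = g j (Circle.exp t) → ∃ q ∈ c, OnBoth g i j q ∧ (ofLex q).1 = t := by
    intro i j hij t ht h
    by_cases ht2 : t ≤ 2 * Real.pi
    · exact hcross i j hij t ⟨ht.1, ht2⟩ h
    · exfalso
      rw [not_le] at ht2
      rw [← Circle.exp_sub_two_pi] at h
      obtain ⟨q, hq, -, hqt⟩ := hcross i j hij (t - 2 * Real.pi)
        ⟨by linarith, by linarith [ht.2]⟩ h
      have := hε q hq
      linarith [ht.2]
  have hρε : ∀ i j, ρ.symm i < ρ.symm j → g i (Circle.exp ε) < g j (Circle.exp ε) := by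
    intro i j hij
    have := hρ ε ⟨hε0, hε1.le⟩ (fun p hp => hε p ((hc p).2 hp)) hij
    simpa using this
  have hstart : IsOrderBetween g (2 * Real.pi + ε) ρ [] c := by
    intro i j hij t ht _ hlt
    have hne : i ≠ j := fun h => by rw [h] at hij; exact lt_irrefl _ hij
    have := mul_pos_of_forall_ne_zero (hg.continuous_sub i j) (x := ε) (y := t) fun z hz h0 => by
      rw [mem_uIcc] at hz
      have hz0 : 0 < z := by rcases hz with h | h <;> linarith [h.1, ht.1]
      have hz1 : z < 2 * Real.pi + ε := by rcases hz with h | h <;> linarith [h.2, ht.2]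
      obtain ⟨q, hq, hb, rfl⟩ := hzero i j hne z ⟨hz0, hz1⟩ (sub_eq_zero.1 h0)
      have h1 := hε q hq
      have h2 := hlt q hq hb
      rcases hz with h | h <;> linarith [h.1, h.2]
    have := neg_of_mul_pos_right this (sub_neg.2 (hρε i j hij)).le
    linarith
  obtain ⟨hfin, hval⟩ := IsOrderBetween.sweep hg hpw (fun p hp => (hc p).1 hp)
    (show 2 * Real.pi < 2 * Real.pi + ε by linarith) hzero w (List.nil_append c).symm hw hstart
  have hlen : w.length = c.length := by simpa using congrArg List.length hw
  have hmap : (events ρ (w.zip c)).map (fun e => e.2.2) = c := by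
    rw [map_events, List.map_snd_zip hlen.ge]
  have hmemc : ∀ e ∈ events ρ (w.zip c), e.2.2 ∈ c := fun e he => by
    rw [← hmap]; exact List.mem_map_of_mem he
  have hzero' : ∀ i j t, i ≠ j → g i (Circle.exp t) = g j (Circle.exp t) →
      ∃ e ∈ events ρ (w.zip c), Involves e i ∧ Involves e j ∧
        ∃ m : ℤ, t = time e + m * (2 * Real.pi) := by
    intro i j t hij h
    obtain ⟨m, z, hz, rfl⟩ := exists_translate_mem_Ioc t
    rw [exp_add_int_mul] at h
    obtain ⟨q, hq, hb, rfl⟩ := hcross i j hij z hz h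
    rw [← hmap] at hq
    obtain ⟨e, he, rfl⟩ := List.mem_map.1 hq
    have h1 := hval e he e.1 (Or.inl rfl)
    have h2 := hval e he e.2.1 (Or.inr rfl)
    have key : ∀ l, g l (Circle.exp (time e)) = (ofLex e.2.2).2 → Involves e l := by
      intro l hl
      by_contra hc
      unfold Involves at hc
      push Not at hc
      exact hg.no_triple e.1 e.2.1 l (ne_of_mem_events he) hc.1 hc.2 _ (h1.trans h2.symm)
        (h1.trans hl.symm)
    exact ⟨e, he, key i hb.1, key j hb.2, m, rfl⟩
  constructor
  · rw [List.map_fst_zip hlen.le]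
    refine eq_of_forall_symm_lt fun i j hij => ?_
    have h1 := hfin i j hij (2 * Real.pi + ε / 2) ⟨by linarith, by linarith⟩
      (fun q hq _ => by linarith [(hwin q hq).2]) (by simp)
    have h2 : g i (Circle.exp (ε / 2)) < g j (Circle.exp (ε / 2)) := by
      rwa [add_comm, Circle.exp_add_two_pi] at h1
    by_contra hcon
    have hne : ρ.symm j ≠ ρ.symm i := fun h => by
      rw [ρ.symm.injective h] at hij; exact lt_irrefl _ hij
    have h3 := hstart j i (lt_of_le_of_ne (not_lt.1 hcon) hne) (ε / 2)
      ⟨by linarith, by linarith⟩ (by simp) (fun q hq _ => by linarith [hε q hq])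
    exact lt_asymm h2 h3
  · have h1 : (events ρ (w.zip c)).Pairwise fun e e' => e.2.2 < e'.2.2 := by
      rw [← List.pairwise_map (f := fun e : L × L × (ℝ ×ₗ ℝ) => e.2.2), hmap]
      exact hpw
    refine h1.imp_of_mem ?_
    intro e e' he he' hlt i hi hi'
    have w1 : time e ∈ Ioc 0 (2 * Real.pi) := hwin _ (hmemc e he)
    have w2 : time e' ∈ Ioc 0 (2 * Real.pi) := hwin _ (hmemc e' he')
    refine ⟨?_, by linarith [w1.1, w2.2]⟩
    exact lt_fst_of_lt hlt (hval e he i hi)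
      (Or.inl ⟨hval e' he' i hi', hval e' he' i hi'⟩)
  · exact hval
  · exact hzero'
  · intro i j hij t ht
    have hne : i ≠ j := fun h => by rw [h] at hij; exact lt_irrefl _ hij
    have := mul_pos_of_forall_ne_zero (hg.continuous_sub i j) (x := ε) (y := t) fun z hz h0 => by
      obtain ⟨e, he, k1, k2, m, hm⟩ := hzero' i j z hne (sub_eq_zero.1 h0)
      have h1 := hε _ (hmemc e he)
      have h2 := hwin _ (hmemc e he)
      have h3 := ht e he k1 k2
      have h4 : (ofLex e.2.2).1 = time e := rfl
      rw [h4] at h1 h2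
      rw [mem_uIcc] at hz
      refine not_mem_translate (τ := time e) ?_ ?_ hm
      · rcases hz with h | h <;> linarith [h.1, h2.2]
      · rcases hz with h | h <;> linarith [h.2]
    have := neg_of_mul_pos_right this (sub_neg.2 (hρε i j hij)).le
    linarith

end Sweep

section SwapPair

variable {L : Type*} [Fintype L]

theorem IsSwapPairOf.exists_timedWord {g : L → Circle → ℝ} (hg : IsCurveSystem g) {P : SwapPair L}
    (hP : IsSwapPairOf g P) : ∃ s, s.map Prod.fst = P.swaps ∧ TimedWord g P.order s := by
  obtain ⟨c, hc1, hc2, hc3⟩ := hP.swaps_eq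
  simp only [bind_pure_comp, List.map_eq_map, List.map_map] at hc3
  have hw : P.swaps.map Fin.val =
      c.map (fun p => {k | g k (Circle.exp (ofLex p).1) < (ofLex p).2}.ncard) := hc3
  have hlen : P.swaps.length = c.length := by simpa using congrArg List.length hw
  exact ⟨P.swaps.zip c, List.map_fst_zip hlen.le,
    timedWord_of_crossings hg hc1 hc2 hw hP.order_before⟩

theorem exists_isSwapPairOf {g : L → Circle → ℝ} (hg : IsCurveSystem g) :
    ∃ P, IsSwapPairOf g P := by
  classical
  have hpi := Real.pi_pos
  set c : List (ℝ ×ₗ ℝ) := hg.finite_crossings.toFinset.sort (· ≤ ·) with hcdef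
  have hpw : c.Pairwise (· < ·) := (Finset.sortedLT_sort _).pairwise
  have hc : ∀ p, p ∈ c ↔ p ∈ crossings g := by intro p; simp [hcdef]
  have hwin : ∀ p ∈ c, (ofLex p).1 ∈ Ioc 0 (2 * Real.pi) := fun p hp => ((hc p).1 hp).1
  obtain ⟨ε, hε0, hε1, hε⟩ : ∃ ε > 0, ε < 2 * Real.pi ∧ ∀ p ∈ c, ε < (ofLex p).1 := by
    have : ∀ᶠ ε in 𝓝[>] (0 : ℝ), 0 < ε ∧ ε < 2 * Real.pi ∧ ∀ p ∈ {p | p ∈ c}, ε < (ofLex p).1 := by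
      refine eventually_mem_nhdsWithin.and (Filter.Eventually.and ?_ ?_)
      · exact nhdsWithin_le_nhds (gt_mem_nhds (by linarith))
      · rw [Filter.eventually_all_finite (List.finite_toSet c)]
        exact fun q hq => nhdsWithin_le_nhds (gt_mem_nhds (hwin q hq).1)
    obtain ⟨ε, h⟩ := this.exists
    exact ⟨ε, h.1, h.2.1, h.2.2⟩
  have hno : ∀ i j, i ≠ j → ∀ t ∈ Ioc 0 (2 * Real.pi), (∀ p ∈ c, t < (ofLex p).1) →
      g i (Circle.exp t) ≠ g j (Circle.exp t) := by
    intro i j hij t ht hlt h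
    exact lt_irrefl _ (hlt (toLex (t, g i (Circle.exp t))) ((hc _).2 ⟨ht, i, j, hij, rfl, h.symm⟩))
  let F : Fin (Fintype.card L) → ℝ := fun k => g ((Fintype.equivFin L).symm k) (Circle.exp ε)
  let ρ : Fin (Fintype.card L) ≃ L := (Tuple.sort F).trans (Fintype.equivFin L).symm
  have hρε : StrictMono fun a => g (ρ a) (Circle.exp ε) := by
    refine (Tuple.monotone_sort F).strictMono_of_injective ?_
    intro a b hab
    by_contra hne
    exact hno (ρ a) (ρ b) (ρ.injective.ne hne) ε ⟨hε0, hε1.le⟩ hε hab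
  have hρ : ∀ t ∈ Ioc 0 (2 * Real.pi), (∀ p ∈ crossings g, t < (ofLex p).1) →
      StrictMono fun a => g (ρ a) (Circle.exp t) := by
    intro t ht hlt a b hab
    have := mul_pos_of_forall_ne_zero (hg.continuous_sub (ρ a) (ρ b)) (x := ε) (y := t)
      fun z hz h0 => by
        rw [mem_uIcc] at hz
        refine hno (ρ a) (ρ b) (ρ.injective.ne hab.ne) z ⟨?_, ?_⟩ (fun p hp => ?_)
          (sub_eq_zero.1 h0)
        · rcases hz with h | h <;> linarith [h.1, ht.1]
        · rcases hz with h | h <;> linarith [h.2, ht.2]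
        · have h1 := hlt p ((hc p).1 hp)
          have h2 := hε p hp
          rcases hz with h | h <;> linarith [h.2]
    have := neg_of_mul_pos_right this (sub_neg.2 (hρε hab)).le
    simp only
    linarith
  have hcard : ∀ p ∈ c, {k | g k (Circle.exp (ofLex p).1) < (ofLex p).2}.ncard <
      Fintype.card L - 1 := by
    intro p hp
    obtain ⟨-, i, j, hij, hi, hj⟩ := (hc p).1 hp
    have hsub : {k | g k (Circle.exp (ofLex p).1) < (ofLex p).2} ⊆ ({i, j} : Set L)ᶜ := by
      rintro k hk (rfl | rfl)
      · exact (ne_of_lt hk) hi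
      · exact (ne_of_lt hk) hj
    have h1 := Set.ncard_le_ncard hsub (Set.toFinite _)
    have h2 := Set.ncard_add_ncard_compl ({i, j} : Set L)
    rw [Set.ncard_pair hij, Nat.card_eq_fintype_card] at h2
    omega
  let w : List (Fin (Fintype.card L - 1)) := c.attach.map fun p => ⟨_, hcard p.1 p.2⟩
  have hw : w.map Fin.val =
      c.map (fun p => {k | g k (Circle.exp (ofLex p).1) < (ofLex p).2}.ncard) := by
    simp only [w, List.map_map]
    conv_rhs => rw [← List.attach_map_subtype_val c]
    rw [List.map_map]
    rfl
  have hT := timedWord_of_crossings hg hpw hc hw hρ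
  have hlen : w.length = c.length := by simpa using congrArg List.length hw
  refine ⟨hT.swapPair, hρ, c, hpw, hc, ?_⟩
  simp only [TimedWord.swapPair, List.map_fst_zip hlen.le, bind_pure_comp, List.map_eq_map,
    List.map_map]
  exact hw

end SwapPair

/-! ### Comparison of signs -/

theorem mul_pos_of_changesSignAt {u v : ℝ → ℝ} (hu : Continuous u) (hv : Continuous v)
    (hz : ∀ t, u t = 0 ↔ v t = 0) (cu : ∀ t, u t = 0 → ChangesSignAt u t)
    (cv : ∀ t, v t = 0 → ChangesSignAt v t) {t₀ : ℝ} (h₀ : 0 < u t₀ * v t₀) {t : ℝ}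
    (ht : u t ≠ 0) : 0 < u t * v t := by
  have hc : Continuous fun s => u s * v s := hu.mul hv
  have hdich : ∀ t, (∀ᶠ s in 𝓝[≠] t, 0 < u s * v s) ∨ ∀ᶠ s in 𝓝[≠] t, u s * v s < 0 := by
    intro t
    simp only [← nhdsLT_sup_nhdsGT, eventually_sup]
    by_cases h : u t = 0
    · rcases (cu t h).2 with ⟨a1, a2⟩ | ⟨a1, a2⟩ <;>
        rcases (cv t ((hz t).1 h)).2 with ⟨b1, b2⟩ | ⟨b1, b2⟩
      · exact Or.inl ⟨by filter_upwards [a1, b1] with s using mul_pos_of_neg_of_neg,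
          by filter_upwards [a2, b2] with s using mul_pos⟩
      · exact Or.inr ⟨by filter_upwards [a1, b1] with s using mul_neg_of_neg_of_pos,
          by filter_upwards [a2, b2] with s using mul_neg_of_pos_of_neg⟩
      · exact Or.inr ⟨by filter_upwards [a1, b1] with s using mul_neg_of_pos_of_neg,
          by filter_upwards [a2, b2] with s using mul_neg_of_neg_of_pos⟩
      · exact Or.inl ⟨by filter_upwards [a1, b1] with s using mul_pos,
          by filter_upwards [a2, b2] with s using mul_pos_of_neg_of_neg⟩
    · have hne : u t * v t ≠ 0 := mul_ne_zero h fun h' => h ((hz t).2 h')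
      rcases lt_or_gt_of_ne hne with h' | h'
      · have := hc.continuousAt.eventually (gt_mem_nhds h')
        exact Or.inr ⟨nhdsWithin_le_nhds this, nhdsWithin_le_nhds this⟩
      · have := hc.continuousAt.eventually (lt_mem_nhds h')
        exact Or.inl ⟨nhdsWithin_le_nhds this, nhdsWithin_le_nhds this⟩
  have hopen : ∀ p : ℝ → Prop, IsOpen {s | p s} → IsOpen {t | ∀ᶠ s in 𝓝[≠] t, p s} := by
    intro p hp
    rw [isOpen_iff_mem_nhds]
    intro t ht
    rw [mem_ofPred_eq, eventually_nhdsWithin_iff] at ht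
    filter_upwards [ht] with s hs
    by_cases hst : s = t
    · rw [hst]; exact eventually_nhdsWithin_iff.2 ht
    · exact nhdsWithin_le_nhds (hp.mem_nhds (hs hst))
  have hpos := hopen (fun s => 0 < u s * v s) (isOpen_lt continuous_const hc)
  have hneg := hopen (fun s => u s * v s < 0) (isOpen_lt hc continuous_const)
  have hexcl : ∀ t, (∀ᶠ s in 𝓝[≠] t, 0 < u s * v s) → ¬ ∀ᶠ s in 𝓝[≠] t, u s * v s < 0 := by
    intro t h1 h2
    obtain ⟨s, hs1, hs2⟩ := (h1.and h2).exists
    exact lt_asymm hs1 hs2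
  have hclopen : IsClopen {t | ∀ᶠ s in 𝓝[≠] t, 0 < u s * v s} := by
    refine ⟨?_, hpos⟩
    rw [← isOpen_compl_iff]
    convert hneg using 1
    ext t
    exact ⟨fun h => (hdich t).resolve_left h, fun h h' => hexcl t h' h⟩
  have huniv := hclopen.eq_univ ⟨t₀, nhdsWithin_le_nhds (hc.continuousAt.eventually (lt_mem_nhds h₀))⟩
  have ht' : ∀ᶠ s in 𝓝[≠] t, 0 < u s * v s := huniv.symm.subset (mem_univ t)
  have hne : u t * v t ≠ 0 := mul_ne_zero ht fun h' => ht ((hz t).2 h')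
  rcases lt_or_gt_of_ne hne with h' | h'
  · exact absurd (nhdsWithin_le_nhds (hc.continuousAt.eventually (gt_mem_nhds h'))) (hexcl t ht')
  · exact h'

theorem ChangesSignAt.comp_strictMono {u T : ℝ → ℝ} {t : ℝ} (hm : StrictMono T)
    (hc : Continuous T) (h : ChangesSignAt u (T t)) : ChangesSignAt (fun s => u (T s)) t := by
  have hl : Tendsto T (𝓝[<] t) (𝓝[<] (T t)) :=
    tendsto_nhdsWithin_iff.2 ⟨hc.continuousAt.tendsto.mono_left nhdsWithin_le_nhds,
      eventually_mem_nhdsWithin.mono fun s hs => hm hs⟩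
  have hr : Tendsto T (𝓝[>] t) (𝓝[>] (T t)) :=
    tendsto_nhdsWithin_iff.2 ⟨hc.continuousAt.tendsto.mono_left nhdsWithin_le_nhds,
      eventually_mem_nhdsWithin.mono fun s hs => hm hs⟩
  refine ⟨h.1, ?_⟩
  rcases h.2 with ⟨h1, h2⟩ | ⟨h1, h2⟩
  · exact Or.inl ⟨hl.eventually h1, hr.eventually h2⟩
  · exact Or.inr ⟨hl.eventually h1, hr.eventually h2⟩

/-! ### Extension of monotone equivariant maps -/

theorem exists_pos_le_translates {D : Set ℝ} (hD : D.Finite) :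
    ∃ δ > 0, ∀ d ∈ D, ∀ m : ℤ, 0 < d + m * (2 * Real.pi) → δ ≤ d + m * (2 * Real.pi) := by
  have hpi := Real.pi_pos
  have : ∀ᶠ δ in 𝓝[>] (0 : ℝ), 0 < δ ∧
      ∀ d ∈ D, ∀ m : ℤ, 0 < d + m * (2 * Real.pi) → δ ≤ d + m * (2 * Real.pi) := by
    refine eventually_mem_nhdsWithin.and ?_
    rw [Filter.eventually_all_finite hD]
    intro d _
    obtain ⟨m₀, z, hz, rfl⟩ := exists_translate_mem_Ioc d
    filter_upwards [nhdsWithin_le_nhds (gt_mem_nhds hz.1)] with δ hδ m hm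
    have h1 : (-1 : ℝ) < m₀ + m := by
      by_contra hc
      nlinarith [not_lt.1 hc, hz.2]
    have h2 : (0 : ℤ) ≤ m₀ + m := by
      have : (-1 : ℤ) < m₀ + m := by exact_mod_cast h1
      omega
    have h3 : (0 : ℝ) ≤ m₀ + m := by exact_mod_cast h2
    nlinarith
  exact this.exists

/-- A monotone equivariant map between discrete sets extends to an equivariant homeomorphism of the
line. -/
theorem exists_equivariant_extension {S : Set (ℝ × ℝ)} (hS : S.Finite)
    (hlt : ∀ p ∈ S, ∀ q ∈ S, ∀ m : ℤ,
      p.1 < q.1 + m * (2 * Real.pi) ↔ p.2 < q.2 + m * (2 * Real.pi)) :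
    ∃ T : ℝ → ℝ, StrictMono T ∧ Continuous T ∧
      (∀ t, T (t + 2 * Real.pi) = T t + 2 * Real.pi) ∧ ∀ p ∈ S, T p.1 = p.2 := by
  rcases S.eq_empty_or_nonempty with rfl | ⟨p₀, hp₀⟩
  · exact ⟨id, strictMono_id, continuous_id, fun _ => rfl, by simp⟩
  have hpi := Real.pi_pos
  let a : S × ℤ → ℝ := fun x => x.1.1.1 + x.2 * (2 * Real.pi)
  let b : S × ℤ → ℝ := fun x => x.1.1.2 + x.2 * (2 * Real.pi)
  have hab : ∀ x y, a x < a y ↔ b x < b y := by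
    intro x y
    have := hlt x.1.1 x.1.2 y.1.1 y.1.2 (y.2 - x.2)
    push_cast at this
    simp only [a, b]
    constructor
    · intro h; have := this.1 (by linarith); linarith
    · intro h; have := this.2 (by linarith); linarith
  obtain ⟨δ₁, hδ₁, hδ₁'⟩ := exists_pos_le_translates
    ((hS.prod hS).image fun x : (ℝ × ℝ) × (ℝ × ℝ) => x.2.1 - x.1.1)
  obtain ⟨δ₂, hδ₂, hδ₂'⟩ := exists_pos_le_translates
    ((hS.prod hS).image fun x : (ℝ × ℝ) × (ℝ × ℝ) => x.2.2 - x.1.2)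
  have hd₁ : ∀ x y, a x < a y → δ₁ ≤ a y - a x := by
    intro x y h
    have := hδ₁' (y.1.1.1 - x.1.1.1) ⟨(x.1.1, y.1.1), ⟨x.1.2, y.1.2⟩, rfl⟩ (y.2 - x.2)
    push_cast at this
    simp only [a] at h ⊢
    have := this (by linarith)
    linarith
  have hd₂ : ∀ x y, b x < b y → δ₂ ≤ b y - b x := by
    intro x y h
    have := hδ₂' (y.1.1.2 - x.1.1.2) ⟨(x.1.1, y.1.1), ⟨x.1.2, y.1.2⟩, rfl⟩ (y.2 - x.2)
    push_cast at this
    simp only [b] at h ⊢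
    have := this (by linarith)
    linarith
  obtain ⟨C, hC⟩ := ((hS.image fun p => |p.2 - p.1|)).bddAbove
  have hC0 : 0 ≤ C := (abs_nonneg _).trans (hC ⟨p₀, hp₀, rfl⟩)
  have hCx : ∀ x, |b x - a x| ≤ C := fun x => by
    have := hC ⟨x.1.1, x.1.2, rfl⟩
    simp only [a, b]
    rwa [show x.1.1.2 + x.2 * (2 * Real.pi) - (x.1.1.1 + x.2 * (2 * Real.pi)) =
      x.1.1.2 - x.1.1.1 by ring]
  set Λ : ℝ := 1 + 2 * C / δ₁ with hΛ
  set l : ℝ := 1 / (1 + 2 * C / δ₂) with hl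
  have hq₁ : 0 ≤ 2 * C / δ₁ := by positivity
  have hq₂ : 0 ≤ 2 * C / δ₂ := by positivity
  have hl0 : 0 < l := by positivity
  have hl1 : l ≤ 1 := by rw [hl, div_le_one (by positivity)]; linarith
  have hΛ1 : 1 ≤ Λ := by linarith
  have hup : ∀ x y, a x < a y → b y - b x ≤ Λ * (a y - a x) := by
    intro x y h
    have h1 := hd₁ x y h
    have h2 := abs_le.1 (hCx x)
    have h3 := abs_le.1 (hCx y)
    have h4 : 2 * C ≤ 2 * C / δ₁ * (a y - a x) := by
      calc 2 * C = 2 * C / δ₁ * δ₁ := by field_simp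
        _ ≤ _ := by gcongr
    rw [hΛ]; linarith
  have hlow : ∀ x y, a x < a y → l * (a y - a x) ≤ b y - b x := by
    intro x y h
    have h1 := hd₂ x y ((hab x y).1 h)
    have h2 := abs_le.1 (hCx x)
    have h3 := abs_le.1 (hCx y)
    have h4 : 2 * C ≤ 2 * C / δ₂ * (b y - b x) := by
      calc 2 * C = 2 * C / δ₂ * δ₂ := by field_simp
        _ ≤ _ := by gcongr
    rw [hl, div_mul_eq_mul_div, one_mul, div_le_iff₀ (by positivity)]
    linarith
  let ω : ℝ → ℝ := fun u => max (Λ * u) (l * u)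
  have hω : ∀ u h, 0 ≤ h → ω u + l * h ≤ ω (u + h) ∧ ω (u + h) ≤ ω u + Λ * h := by
    intro u h hh
    have hlΛ : l * h ≤ Λ * h := by
      apply mul_le_mul_of_nonneg_right _ hh; linarith
    simp only [ω]
    constructor
    · rw [← max_add_add_right]
      apply max_le_max <;> linarith
    · rw [← max_add_add_right]
      apply max_le_max <;> linarith
  have hnode : ∀ x₀ x, b x₀ ≤ b x + ω (a x₀ - a x) := by
    intro x₀ x
    rcases lt_trichotomy (a x) (a x₀) with h | h | h
    · have := hup x x₀ h
      have := le_max_left (Λ * (a x₀ - a x)) (l * (a x₀ - a x))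
      simp only [ω]; linarith
    · have h1 : b x = b x₀ := by
        apply le_antisymm
        · exact not_lt.1 fun hc => h.not_gt ((hab _ _).2 hc)
        · exact not_lt.1 fun hc => h.not_lt ((hab _ _).2 hc)
      simp [ω, h, h1]
    · have := hlow x₀ x h
      have := le_max_right (Λ * (a x₀ - a x)) (l * (a x₀ - a x))
      simp only [ω]; linarith
  let x₀ : S × ℤ := (⟨p₀, hp₀⟩, 0)
  have : Nonempty (S × ℤ) := ⟨x₀⟩
  have hbdd : ∀ t, BddBelow (range fun x => b x + ω (t - a x)) := by
    intro t
    refine ⟨b x₀ - Λ * |t - a x₀|, ?_⟩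
    rintro _ ⟨x, rfl⟩
    have h1 := hnode x₀ x
    have h0 : 0 ≤ Λ * |t - a x₀| := by positivity
    simp only
    rcases le_total (a x₀) t with h | h
    · have := (hω (a x₀ - a x) (t - a x₀) (by linarith)).1
      rw [show a x₀ - a x + (t - a x₀) = t - a x by ring] at this
      have : 0 ≤ l * (t - a x₀) := mul_nonneg hl0.le (by linarith)
      linarith
    · have := (hω (t - a x) (a x₀ - t) (by linarith)).2
      rw [show t - a x + (a x₀ - t) = a x₀ - a x by ring] at this
      rw [abs_of_nonpos (by linarith)]
      linarith
  let T : ℝ → ℝ := fun t => ⨅ x, (b x + ω (t - a x))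
  have hTle : ∀ t x, T t ≤ b x + ω (t - a x) := fun t x => ciInf_le (hbdd t) x
  have hinc : ∀ t h, 0 ≤ h → T t + l * h ≤ T (t + h) ∧ T (t + h) ≤ T t + Λ * h := by
    intro t h hh
    constructor
    · refine le_ciInf fun x => ?_
      have h1 := (hω (t - a x) h hh).1
      rw [show t - a x + h = t + h - a x by ring] at h1
      have := hTle t x
      linarith
    · rw [← sub_le_iff_le_add]
      refine le_ciInf fun x => ?_
      have h1 := (hω (t - a x) h hh).2
      rw [show t - a x + h = t + h - a x by ring] at h1
      have := hTle (t + h) x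
      linarith
  refine ⟨T, ?_, ?_, ?_, ?_⟩
  · intro s t hst
    have := (hinc s (t - s) (by linarith)).1
    rw [add_sub_cancel] at this
    have : 0 < l * (t - s) := mul_pos hl0 (by linarith)
    linarith
  · refine (LipschitzWith.of_le_add_mul (⟨Λ, by linarith⟩ : NNReal) fun s t => ?_).continuous
    change T s ≤ T t + Λ * |s - t|
    rcases le_total t s with h | h
    · have := (hinc t (s - t) (by linarith)).2
      rwa [add_sub_cancel, ← abs_of_nonneg (show 0 ≤ s - t by linarith)] at this
    · have := (hinc s (t - s) (by linarith)).1
      rw [add_sub_cancel] at this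
      have : 0 ≤ l * (t - s) := mul_nonneg hl0.le (by linarith)
      have : 0 ≤ Λ * |s - t| := by positivity
      linarith
  · intro t
    apply le_antisymm
    · rw [← sub_le_iff_le_add]
      refine le_ciInf fun x => ?_
      have := hTle (t + 2 * Real.pi) (x.1, x.2 + 1)
      have e1 : a (x.1, x.2 + 1) = a x + 2 * Real.pi := by simp only [a]; push_cast; ring
      have e2 : b (x.1, x.2 + 1) = b x + 2 * Real.pi := by simp only [b]; push_cast; ring
      rw [e1, e2, add_sub_add_right_eq_sub] at this
      linarith
    · refine le_ciInf fun x => ?_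
      have := hTle t (x.1, x.2 - 1)
      have e1 : a (x.1, x.2 - 1) = a x - 2 * Real.pi := by simp only [a]; push_cast; ring
      have e2 : b (x.1, x.2 - 1) = b x - 2 * Real.pi := by simp only [b]; push_cast; ring
      rw [e1, e2, show t - (a x - 2 * Real.pi) = t + 2 * Real.pi - a x by ring] at this
      linarith
  · intro p hp
    let x : S × ℤ := (⟨p, hp⟩, 0)
    have e1 : a x = p.1 := by simp [a, x]
    have e2 : b x = p.2 := by simp [b, x]
    rw [← e1, ← e2]
    apply le_antisymm
    · have := hTle (a x) x
      simpa [ω] using this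
    · exact le_ciInf fun y => hnode x y

/-! ### Timed words and isomorphisms -/

section TimedWord

variable {n : ℕ} {L : Type*}

theorem CurveIso.eq_iff {f g : L → Circle → ℝ} {T : L → ℝ → ℝ} (h : CurveIso f g T) (i j : L)
    (t : ℝ) : f i (Circle.exp t) = f j (Circle.exp t) ↔
      g i (Circle.exp (T i t)) = g j (Circle.exp (T i t)) := by
  have h1 := h.lt_iff i j t
  have h2 := h.gt_iff i j t
  constructor
  · intro e
    rw [e] at h1 h2
    exact le_antisymm (not_lt.1 fun hc => lt_irrefl _ (h2.2 hc))
      (not_lt.1 fun hc => lt_irrefl _ (h1.2 hc))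
  · intro e
    rw [e] at h1 h2
    exact le_antisymm (not_lt.1 fun hc => lt_irrefl _ (h2.1 hc))
      (not_lt.1 fun hc => lt_irrefl _ (h1.1 hc))

open Classical in
/-- The map induced by an isomorphism on the points of the curves. -/
noncomputable def pushPoint (f g : L → Circle → ℝ) (T : L → ℝ → ℝ) (p : ℝ ×ₗ ℝ) : ℝ ×ₗ ℝ :=
  if h : ∃ i, f i (Circle.exp (ofLex p).1) = (ofLex p).2 then
    toLex (T h.choose (ofLex p).1, g h.choose (Circle.exp (T h.choose (ofLex p).1)))
  else p

theorem CurveIso.pushPoint_eq {f g : L → Circle → ℝ} {T : L → ℝ → ℝ} (h : CurveIso f g T) {i : L}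
    {p : ℝ ×ₗ ℝ} (hi : f i (Circle.exp (ofLex p).1) = (ofLex p).2) :
    pushPoint f g T p = toLex (T i (ofLex p).1, g i (Circle.exp (T i (ofLex p).1))) := by
  have hex : ∃ i, f i (Circle.exp (ofLex p).1) = (ofLex p).2 := ⟨i, hi⟩
  have hch := hex.choose_spec
  rw [pushPoint, dif_pos hex]
  have h1 := h.eq_of_eq _ _ _ (hch.trans hi.symm)
  have h2 := (h.eq_iff _ _ _).1 (hch.trans hi.symm)
  rw [h2, h1]

theorem CurveIso.exists_timedWord {f g : L → Circle → ℝ} {T : L → ℝ → ℝ} (h : CurveIso f g T)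
    {ρ : Fin n ≃ L} {s : List (Fin (n - 1) × (ℝ ×ₗ ℝ))} (H : TimedWord f ρ s) :
    ∃ s', s'.map Prod.fst = s.map Prod.fst ∧ TimedWord g ρ s' := by
  have hfst : (s.map fun x => (x.1, pushPoint f g T x.2)).map Prod.fst = s.map Prod.fst := by
    rw [List.map_map]; rfl
  have hpush : ∀ e ∈ events ρ s, ∀ i, Involves e i → pushPoint f g T e.2.2 =
      toLex (T i (time e), g i (Circle.exp (T i (time e)))) := fun e he i hi =>
    h.pushPoint_eq (H.value e he i hi)
  have htime : ∀ e ∈ events ρ s, ∀ i, Involves e i →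
      time (e.1, e.2.1, pushPoint f g T e.2.2) = T i (time e) := by
    intro e he i hi
    rw [time, hpush e he i hi]; rfl
  refine ⟨s.map fun x => (x.1, pushPoint f g T x.2), hfst, ?_⟩
  constructor
  · rw [hfst]; exact H.act_eq
  · rw [events_map, List.pairwise_map]
    refine H.pairwise.imp_of_mem ?_
    intro e e' he he' hp i hi hi'
    rw [htime e he i hi, htime e' he' i hi']
    obtain ⟨h1, h2⟩ := hp i hi hi'
    refine ⟨h.strictMono i h1, ?_⟩
    rw [← h.add_two_pi]
    exact h.strictMono i h2
  · intro e' he' i hi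
    rw [events_map] at he'
    obtain ⟨e, he, rfl⟩ := List.mem_map.1 he'
    rw [htime e he i hi]
    simp only [hpush e he i hi, ofLex_toLex]
  · intro i j t hij ht
    obtain ⟨t, rfl⟩ := surjective_of_add_two_pi (h.continuous i) (h.add_two_pi i) t
    obtain ⟨e, he, h1, h2, m, hm⟩ := H.zero i j t hij ((h.eq_iff i j t).2 ht)
    refine ⟨(e.1, e.2.1, pushPoint f g T e.2.2), by
      rw [events_map]
      exact List.mem_map_of_mem (f := fun e => (e.1, e.2.1, pushPoint f g T e.2.2)) he, h1, h2, m, ?_⟩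
    rw [htime e he i h1, hm, add_int_mul_two_pi (h.add_two_pi i)]
  · intro i j hij t ht
    obtain ⟨t, rfl⟩ := surjective_of_add_two_pi (h.continuous i) (h.add_two_pi i) t
    rw [← h.lt_iff]
    refine H.lt_of_lt i j hij t fun e he h1 h2 => ?_
    have := ht (e.1, e.2.1, pushPoint f g T e.2.2) (by
      rw [events_map]
      exact List.mem_map_of_mem (f := fun e => (e.1, e.2.1, pushPoint f g T e.2.2)) he) h1 h2
    rw [htime e he i h1] at this
    refine ⟨(h.strictMono i).lt_iff_lt.1 ?_, (h.strictMono i).lt_iff_lt.1 this.2⟩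
    have h3 := h.add_two_pi i (time e - 2 * Real.pi)
    rw [sub_add_cancel] at h3
    linarith [this.1]

theorem exists_common_word {α β γ : Type*} (s : List (α × β)) :
    ∀ s' : List (α × γ), s.map Prod.fst = s'.map Prod.fst → ∃ u : List (α × (β × γ)),
      u.map (fun x => (x.1, x.2.1)) = s ∧ u.map (fun x => (x.1, x.2.2)) = s' := by
  induction s with
  | nil =>
    intro s' h
    have : s' = [] := List.map_eq_nil_iff.1 h.symm
    exact ⟨[], rfl, this.symm⟩
  | cons x s ih =>
    intro s' h
    cases s' with
    | nil => simp at h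
    | cons y s' =>
      rw [List.map_cons, List.map_cons, List.cons.injEq] at h
      obtain ⟨u, h1, h2⟩ := ih s' h.2
      refine ⟨(x.1, (x.2, y.2)) :: u, by simp [h1], ?_⟩
      rw [List.map_cons, h2]
      simp [h.1]

theorem lt_translate_iff {x y x' y' : ℝ} (h1 : x < y) (h2 : y < x + 2 * Real.pi) (h1' : x' < y')
    (h2' : y' < x' + 2 * Real.pi) (m : ℤ) :
    (x < y + m * (2 * Real.pi) ↔ x' < y' + m * (2 * Real.pi)) ∧
    (y < x + m * (2 * Real.pi) ↔ y' < x' + m * (2 * Real.pi)) := by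
  have hpi := Real.pi_pos
  have k1 : ∀ x y : ℝ, x < y → y < x + 2 * Real.pi → (x < y + m * (2 * Real.pi) ↔ 0 ≤ m) := by
    intro x y h1 h2
    constructor
    · intro h
      have : (-1 : ℝ) < m := by by_contra hc; nlinarith [not_lt.1 hc]
      have : (-1 : ℤ) < m := by exact_mod_cast this
      omega
    · intro h
      have : (0 : ℝ) ≤ m := by exact_mod_cast h
      nlinarith
  have k2 : ∀ x y : ℝ, x < y → y < x + 2 * Real.pi → (y < x + m * (2 * Real.pi) ↔ 1 ≤ m) := by
    intro x y h1 h2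
    constructor
    · intro h
      have : (0 : ℝ) < m := by by_contra hc; nlinarith [not_lt.1 hc]
      have : (0 : ℤ) < m := by exact_mod_cast this
      omega
    · intro h
      have : (1 : ℝ) ≤ m := by exact_mod_cast h
      nlinarith
  exact ⟨(k1 x y h1 h2).trans (k1 x' y' h1' h2').symm, (k2 x y h1 h2).trans (k2 x' y' h1' h2').symm⟩

theorem exists_curveIso_of_timedWord {f g : L → Circle → ℝ} (hf : IsCurveSystem f)
    (hg : IsCurveSystem g) {ρ : Fin n ≃ L} {s s' : List (Fin (n - 1) × (ℝ ×ₗ ℝ))}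
    (H : TimedWord f ρ s) (H' : TimedWord g ρ s') (hss : s.map Prod.fst = s'.map Prod.fst) :
    ∃ T, CurveIso f g T := by
  have hpi := Real.pi_pos
  obtain ⟨u, rfl, rfl⟩ := exists_common_word s s' hss
  set τ : L × L × ((ℝ ×ₗ ℝ) × (ℝ ×ₗ ℝ)) → ℝ := fun e => (ofLex e.2.2.1).1 with hτ
  set τ' : L × L × ((ℝ ×ₗ ℝ) × (ℝ ×ₗ ℝ)) → ℝ := fun e => (ofLex e.2.2.2).1 with hτ'
  have hpw : (events ρ u).Pairwise fun e e' => ∀ i, Involves e i → Involves e' i →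
      τ e < τ e' ∧ τ e' < τ e + 2 * Real.pi := by
    have := H.pairwise
    rw [events_map, List.pairwise_map] at this
    exact this
  have hpw' : (events ρ u).Pairwise fun e e' => ∀ i, Involves e i → Involves e' i →
      τ' e < τ' e' ∧ τ' e' < τ' e + 2 * Real.pi := by
    have := H'.pairwise
    rw [events_map, List.pairwise_map] at this
    exact this
  have hval : ∀ e ∈ events ρ u, ∀ i, Involves e i →
      f i (Circle.exp (τ e)) = (ofLex e.2.2.1).2 := fun e he i hi =>
    H.value (e.1, e.2.1, e.2.2.1) (by
      rw [events_map]; exact List.mem_map_of_mem (f := fun e => (e.1, e.2.1, e.2.2.1)) he) i hi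
  have hval' : ∀ e ∈ events ρ u, ∀ i, Involves e i →
      g i (Circle.exp (τ' e)) = (ofLex e.2.2.2).2 := fun e he i hi =>
    H'.value (e.1, e.2.1, e.2.2.2) (by
      rw [events_map]; exact List.mem_map_of_mem (f := fun e => (e.1, e.2.1, e.2.2.2)) he) i hi
  have hzero : ∀ i j t, i ≠ j → f i (Circle.exp t) = f j (Circle.exp t) →
      ∃ e ∈ events ρ u, Involves e i ∧ Involves e j ∧ ∃ m : ℤ, t = τ e + m * (2 * Real.pi) := by
    intro i j t hij ht
    obtain ⟨e', he', h1, h2, h3⟩ := H.zero i j t hij ht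
    rw [events_map] at he'
    obtain ⟨e, he, rfl⟩ := List.mem_map.1 he'
    exact ⟨e, he, h1, h2, h3⟩
  have hzero' : ∀ i j t, i ≠ j → g i (Circle.exp t) = g j (Circle.exp t) →
      ∃ e ∈ events ρ u, Involves e i ∧ Involves e j ∧ ∃ m : ℤ, t = τ' e + m * (2 * Real.pi) := by
    intro i j t hij ht
    obtain ⟨e', he', h1, h2, h3⟩ := H'.zero i j t hij ht
    rw [events_map] at he'
    obtain ⟨e, he, rfl⟩ := List.mem_map.1 he'
    exact ⟨e, he, h1, h2, h3⟩
  have hlt : ∀ i j, ρ.symm i < ρ.symm j → ∀ t, (∀ e ∈ events ρ u, Involves e i → Involves e j →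
      τ e - 2 * Real.pi < t ∧ t < τ e) → f i (Circle.exp t) < f j (Circle.exp t) := by
    intro i j hij t ht
    refine H.lt_of_lt i j hij t fun e' he' h1 h2 => ?_
    rw [events_map] at he'
    obtain ⟨e, he, rfl⟩ := List.mem_map.1 he'
    exact ht e he h1 h2
  have hlt' : ∀ i j, ρ.symm i < ρ.symm j → ∀ t, (∀ e ∈ events ρ u, Involves e i → Involves e j →
      τ' e - 2 * Real.pi < t ∧ t < τ' e) → g i (Circle.exp t) < g j (Circle.exp t) := by
    intro i j hij t ht
    refine H'.lt_of_lt i j hij t fun e' he' h1 h2 => ?_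
    rw [events_map] at he'
    obtain ⟨e, he, rfl⟩ := List.mem_map.1 he'
    exact ht e he h1 h2
  let Q : L × L × ((ℝ ×ₗ ℝ) × (ℝ ×ₗ ℝ)) → L × L × ((ℝ ×ₗ ℝ) × (ℝ ×ₗ ℝ)) → Prop := fun e e' =>
    ∀ i, Involves e i → Involves e' i → ∀ m : ℤ,
      (τ e < τ e' + m * (2 * Real.pi) ↔ τ' e < τ' e' + m * (2 * Real.pi)) ∧
      (τ e' < τ e + m * (2 * Real.pi) ↔ τ' e' < τ' e + m * (2 * Real.pi))
  have : Std.Symm Q := ⟨fun e e' h i h1 h2 m => ⟨(h i h2 h1 m).2, (h i h2 h1 m).1⟩⟩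
  have hQ : (events ρ u).Pairwise Q := by
    refine (hpw.and hpw').imp ?_
    rintro e e' ⟨h1, h2⟩ i hi hi' m
    exact lt_translate_iff (h1 i hi hi').1 (h1 i hi hi').2 (h2 i hi hi').1 (h2 i hi hi').2 m
  have hQ' := List.Pairwise.forall_of_forall
    (fun e _ i _ _ m => by simp) hQ
  have hwin : ∀ e ∈ events ρ u, ∀ e' ∈ events ρ u, ∀ i, Involves e i → Involves e' i →
      τ e' < τ e + 2 * Real.pi := by
    let W : L × L × ((ℝ ×ₗ ℝ) × (ℝ ×ₗ ℝ)) → L × L × ((ℝ ×ₗ ℝ) × (ℝ ×ₗ ℝ)) → Prop := fun e e' =>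
      ∀ i, Involves e i → Involves e' i → τ e' < τ e + 2 * Real.pi ∧ τ e < τ e' + 2 * Real.pi
    have : Std.Symm W := ⟨fun e e' h i h1 h2 => ⟨(h i h2 h1).2, (h i h2 h1).1⟩⟩
    have hW : (events ρ u).Pairwise W := hpw.imp fun {e e'} h i h1 h2 =>
      ⟨(h i h1 h2).2, by linarith [(h i h1 h2).1]⟩
    have := List.Pairwise.forall_of_forall (fun e _ i _ _ => by simpa using hpi) hW
    exact fun e he e' he' i hi hi' => (this he he' i hi hi').1
  have hext : ∀ i, ∃ T : ℝ → ℝ, StrictMono T ∧ Continuous T ∧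
      (∀ t, T (t + 2 * Real.pi) = T t + 2 * Real.pi) ∧
      ∀ e ∈ events ρ u, Involves e i → T (τ e) = τ' e := by
    intro i
    obtain ⟨T, h1, h2, h3, h4⟩ := exists_equivariant_extension
      (S := (fun e => (τ e, τ' e)) '' {e | e ∈ events ρ u ∧ Involves e i})
      (((List.finite_toSet (events ρ u)).subset fun e he => he.1).image _) (by
        rintro _ ⟨e, ⟨he, hi⟩, rfl⟩ _ ⟨e', ⟨he', hi'⟩, rfl⟩ m
        exact (hQ' he he' i hi hi' m).1)
    exact ⟨T, h1, h2, h3, fun e he hi => h4 _ ⟨e, ⟨he, hi⟩, rfl⟩⟩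
  choose T hT1 hT2 hT3 hT4 using hext
  have hzz : ∀ i j, i ≠ j → ∀ t, f i (Circle.exp t) = f j (Circle.exp t) ↔
      g i (Circle.exp (T i t)) = g j (Circle.exp (T i t)) := by
    intro i j hij t
    constructor
    · intro h
      obtain ⟨e, he, h1, h2, m, rfl⟩ := hzero i j t hij h
      rw [add_int_mul_two_pi (hT3 i), hT4 i e he h1, exp_add_int_mul, hval' e he i h1,
        hval' e he j h2]
    · intro h
      obtain ⟨e, he, h1, h2, m, hm⟩ := hzero' i j _ hij h
      rw [← hT4 i e he h1, ← add_int_mul_two_pi (hT3 i)] at hm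
      rw [(hT1 i).injective hm, exp_add_int_mul, hval e he i h1, hval e he j h2]
  have hsign : ∀ i j, i ≠ j → ∀ t, f i (Circle.exp t) - f j (Circle.exp t) ≠ 0 →
      0 < (f i (Circle.exp t) - f j (Circle.exp t)) *
        (g i (Circle.exp (T i t)) - g j (Circle.exp (T i t))) := by
    intro i j hij t ht
    obtain ⟨t₀, ht₀⟩ : ∃ t₀, ∀ e ∈ events ρ u, Involves e i → Involves e j →
        τ e - 2 * Real.pi < t₀ ∧ t₀ < τ e := by
      set E := {e | e ∈ events ρ u ∧ Involves e i ∧ Involves e j} with hE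
      have hEfin : E.Finite := (List.finite_toSet (events ρ u)).subset fun e he => he.1
      rcases E.eq_empty_or_nonempty with h | h
      · exact ⟨0, fun e he h1 h2 => absurd (show e ∈ E from ⟨he, h1, h2⟩) (by simp [h])⟩
      · obtain ⟨e₁, he₁, hmin⟩ := Set.exists_min_image E τ hEfin h
        have hex : ∀ᶠ t in 𝓝[<] τ e₁, t < τ e₁ ∧ ∀ e ∈ E, τ e - 2 * Real.pi < t := by
          refine eventually_mem_nhdsWithin.and ?_
          rw [Filter.eventually_all_finite hEfin]
          intro e he
          have := hwin e₁ he₁.1 e he.1 i he₁.2.1 he.2.1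
          exact nhdsWithin_le_nhds (lt_mem_nhds (by linarith))
        obtain ⟨t₀, h1, h2⟩ := hex.exists
        exact ⟨t₀, fun e he k1 k2 => ⟨h2 e ⟨he, k1, k2⟩, h1.trans_le (hmin e ⟨he, k1, k2⟩)⟩⟩
    have ht₀' : ∀ e ∈ events ρ u, Involves e i → Involves e j →
        τ' e - 2 * Real.pi < T i t₀ ∧ T i t₀ < τ' e := by
      intro e he h1 h2
      obtain ⟨h3, h4⟩ := ht₀ e he h1 h2
      rw [← hT4 i e he h1]
      refine ⟨?_, hT1 i h4⟩
      have h5 := hT3 i (τ e - 2 * Real.pi)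
      rw [sub_add_cancel] at h5
      have := hT1 i h3
      linarith
    have hpos : 0 < (f i (Circle.exp t₀) - f j (Circle.exp t₀)) *
        (g i (Circle.exp (T i t₀)) - g j (Circle.exp (T i t₀))) := by
      rcases lt_or_gt_of_ne (ρ.symm.injective.ne hij) with h | h
      · exact mul_pos_of_neg_of_neg (sub_neg.2 (hlt i j h t₀ ht₀))
          (sub_neg.2 (hlt' i j h _ ht₀'))
      · exact mul_pos (sub_pos.2 (hlt j i h t₀ fun e he h1 h2 => ht₀ e he h2 h1))
          (sub_pos.2 (hlt' j i h _ fun e he h1 h2 => ht₀' e he h2 h1))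
    refine mul_pos_of_changesSignAt (hf.continuous_sub i j)
      (v := fun t => g i (Circle.exp (T i t)) - g j (Circle.exp (T i t)))
      ((hg.continuous_sub i j).comp (hT2 i)) ?_ ?_ ?_ hpos ht
    · intro t
      rw [sub_eq_zero, sub_eq_zero]
      exact hzz i j hij t
    · intro t h
      exact hf.changesSignAt hij (sub_eq_zero.1 h)
    · intro t h
      exact ChangesSignAt.comp_strictMono (hT1 i) (hT2 i)
        (hg.changesSignAt hij (t := T i t) (sub_eq_zero.1 h))
  refine ⟨T, hT1, hT2, hT3, ?_, ?_, ?_⟩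
  · intro i j t
    by_cases hij : i = j
    · subst hij; simp
    by_cases h0 : f i (Circle.exp t) = f j (Circle.exp t)
    · rw [h0, (hzz i j hij t).1 h0]; simp
    · have := hsign i j hij t (sub_ne_zero.2 h0)
      rw [← sub_neg, ← sub_neg (a := g i _)]
      rcases mul_pos_iff.1 this with ⟨h1, h2⟩ | ⟨h1, h2⟩
      · exact ⟨fun h => absurd h h1.not_gt, fun h => absurd h h2.not_gt⟩
      · exact ⟨fun _ => h2, fun _ => h1⟩
  · intro i j t
    by_cases hij : i = j
    · subst hij; simp
    by_cases h0 : f i (Circle.exp t) = f j (Circle.exp t)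
    · rw [h0, (hzz i j hij t).1 h0]; simp
    · have := hsign i j hij t (sub_ne_zero.2 h0)
      rw [← sub_pos, ← sub_pos (a := g i _)]
      rcases mul_pos_iff.1 this with ⟨h1, h2⟩ | ⟨h1, h2⟩
      · exact ⟨fun _ => h2, fun _ => h1⟩
      · exact ⟨fun h => absurd h h1.not_gt, fun h => absurd h h2.not_gt⟩
  · intro i j t h
    by_cases hij : i = j
    · rw [hij]
    · obtain ⟨e, he, h1, h2, m, rfl⟩ := hzero i j t hij h
      rw [add_int_mul_two_pi (hT3 i), add_int_mul_two_pi (hT3 j), hT4 i e he h1, hT4 j e he h2]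

end TimedWord

/-! ### Order statistics of a finite family of functions -/

section Level

variable {L : Type*} [Finite L]

/-- `c` is the `k`-th smallest value (counted from `0`, with multiplicity) of `x`. -/
def HasRank (x : L → ℝ) (k : ℕ) (c : ℝ) : Prop :=
  {j | x j < c}.ncard ≤ k ∧ k < {j | x j ≤ c}.ncard

theorem exists_hasRank (x : L → ℝ) {k : ℕ} (hk : k < Nat.card L) : ∃ c, HasRank x k c := by
  have hne : {i | k < {j | x j ≤ x i}.ncard}.Nonempty := by
    have : Nonempty L := (Nat.card_pos_iff.1 (by omega)).1
    obtain ⟨i, hi⟩ := Finite.exists_max x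
    refine ⟨i, ?_⟩
    rwa [mem_ofPred_eq, show {j | x j ≤ x i} = univ from eq_univ_of_forall hi, ncard_univ]
  obtain ⟨i, hi, hmin⟩ := Set.exists_min_image _ x (toFinite _) hne
  refine ⟨x i, not_lt.1 fun hlt => ?_, hi⟩
  obtain ⟨m, hm, hmax⟩ := Set.exists_max_image {j | x j < x i} x (toFinite _)
    (nonempty_of_ncard_ne_zero (by omega))
  refine absurd (hmin m ?_) (not_le.2 hm)
  exact hlt.trans_le (ncard_le_ncard fun j hj => hmax j hj)

theorem HasRank.mono {x : L → ℝ} {k l : ℕ} {c d : ℝ} (hc : HasRank x k c) (hd : HasRank x l d)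
    (h : k ≤ l) : c ≤ d := by
  by_contra hlt
  have := ncard_le_ncard (s := {j | x j ≤ d}) (t := {j | x j < c})
    fun j hj => lt_of_le_of_lt hj (not_le.1 hlt)
  have := hc.1
  have := hd.2
  omega

theorem HasRank.unique {x : L → ℝ} {k : ℕ} {c d : ℝ} (hc : HasRank x k c) (hd : HasRank x k d) :
    c = d :=
  le_antisymm (hc.mono hd le_rfl) (hd.mono hc le_rfl)

theorem HasRank.exists_eq {x : L → ℝ} {k : ℕ} {c : ℝ} (hc : HasRank x k c) : ∃ i, x i = c := by
  by_contra! h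
  have := ncard_le_ncard (s := {j | x j ≤ c}) (t := {j | x j < c})
    fun j hj => lt_of_le_of_ne hj (h j)
  have := hc.1
  have := hc.2
  omega

theorem hasRank_ncard (x : L → ℝ) (i : L) : HasRank x {j | x j < x i}.ncard (x i) :=
  ⟨le_rfl, ncard_lt_ncard ⟨fun j (hj : x j < x i) => show x j ≤ x i from hj.le, fun h =>
    lt_irrefl (x i) (h (show x i ≤ x i from le_rfl))⟩⟩

open Classical in
/-- The `k`-th level of a family of functions on the circle; it is the top level for large `k`. -/
noncomputable def level (f : L → Circle → ℝ) (k : ℕ) (θ : Circle) : ℝ :=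
  if h : ∃ c, HasRank (fun j => f j θ) (min k (Nat.card L - 1)) c then h.choose else 0

variable [Nonempty L]

theorem hasRank_level (f : L → Circle → ℝ) (k : ℕ) (θ : Circle) :
    HasRank (fun j => f j θ) (min k (Nat.card L - 1)) (level f k θ) := by
  have h : ∃ c, HasRank (fun j => f j θ) (min k (Nat.card L - 1)) c := by
    apply exists_hasRank
    have := Nat.card_pos (α := L)
    omega
  rw [level, dif_pos h]
  exact h.choose_spec

theorem level_mono (f : L → Circle → ℝ) (θ : Circle) (k : ℕ) : level f k θ ≤ level f (k + 1) θ :=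
  (hasRank_level f k θ).mono (hasRank_level f (k + 1) θ) (by omega)

theorem exists_eq_level (f : L → Circle → ℝ) (k : ℕ) (θ : Circle) : ∃ i, f i θ = level f k θ :=
  (hasRank_level f k θ).exists_eq

theorem exists_level_eq (f : L → Circle → ℝ) (i : L) (θ : Circle) : ∃ k, f i θ = level f k θ := by
  refine ⟨{j | f j θ < f i θ}.ncard, (hasRank_ncard (fun j => f j θ) i).unique ?_⟩
  have := hasRank_level f {j | f j θ < f i θ}.ncard θ
  rwa [min_eq_left] at this
  have h1 : _ < {j | f j θ ≤ f i θ}.ncard := (hasRank_ncard (fun j => f j θ) i).2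
  have h2 := ncard_le_card {j | f j θ ≤ f i θ}
  omega

theorem continuous_level {f : L → Circle → ℝ} (hf : ∀ i, Continuous (f i)) (k : ℕ) :
    Continuous (level f k) := by
  rw [continuous_iff_continuousAt]
  intro θ₀
  have h₀ := hasRank_level f k θ₀
  refine tendsto_order.2 ⟨fun a ha => ?_, fun a ha => ?_⟩
  · have : ∀ᶠ θ in 𝓝 θ₀, ∀ j, a < f j θ₀ → a < f j θ := by
      rw [eventually_all]
      intro j
      by_cases hj : a < f j θ₀
      · exact ((hf j).continuousAt.eventually (lt_mem_nhds hj)).mono fun _ h _ => h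
      · exact Eventually.of_forall fun _ h => absurd h hj
    filter_upwards [this] with θ hθ
    by_contra hle
    have h : _ < {j | f j θ ≤ level f k θ}.ncard := (hasRank_level f k θ).2
    have h1 := ncard_le_ncard (s := {j | f j θ ≤ level f k θ}) (t := {j | f j θ₀ < level f k θ₀})
      fun j hj => by
        by_contra hlt
        exact absurd (hθ j (ha.trans_le (not_lt.1 hlt))) (not_lt.2 (le_trans hj (not_lt.1 hle)))
    have h2 : {j | f j θ₀ < level f k θ₀}.ncard ≤ _ := h₀.1
    omega
  · have : ∀ᶠ θ in 𝓝 θ₀, ∀ j, f j θ₀ < a → f j θ < a := by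
      rw [eventually_all]
      intro j
      by_cases hj : f j θ₀ < a
      · exact ((hf j).continuousAt.eventually (gt_mem_nhds hj)).mono fun _ h _ => h
      · exact Eventually.of_forall fun _ h => absurd h hj
    filter_upwards [this] with θ hθ
    by_contra hle
    have h : {j | f j θ < level f k θ}.ncard ≤ _ := (hasRank_level f k θ).1
    have h1 := ncard_le_ncard (s := {j | f j θ₀ ≤ level f k θ₀}) (t := {j | f j θ < level f k θ})
      fun j hj => (hθ j (lt_of_le_of_lt hj ha)).trans_le (not_lt.1 hle)
    have h2 : _ < {j | f j θ₀ ≤ level f k θ₀}.ncard := h₀.2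
    omega

theorem CurveIso.eq_level_iff {f g : L → Circle → ℝ} {T : L → ℝ → ℝ} (h : CurveIso f g T) (i : L)
    (k : ℕ) (t : ℝ) : f i (Circle.exp t) = level f k (Circle.exp t) ↔
      g i (Circle.exp (T i t)) = level g k (Circle.exp (T i t)) := by
  have key : ∀ m, HasRank (fun j => f j (Circle.exp t)) m (f i (Circle.exp t)) ↔
      HasRank (fun j => g j (Circle.exp (T i t))) m (g i (Circle.exp (T i t))) := by
    intro m
    have h1 : {j | f j (Circle.exp t) < f i (Circle.exp t)} =
        {j | g j (Circle.exp (T i t)) < g i (Circle.exp (T i t))} := by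
      ext j; exact h.gt_iff i j t
    have h2 : {j | f j (Circle.exp t) ≤ f i (Circle.exp t)} =
        {j | g j (Circle.exp (T i t)) ≤ g i (Circle.exp (T i t))} := by
      ext j; exact not_lt.symm.trans ((not_congr (h.lt_iff i j t)).trans not_lt)
    simp only [HasRank, h1, h2]
  constructor
  · intro e
    have := hasRank_level f k (Circle.exp t)
    rw [← e, key] at this
    exact this.unique (hasRank_level _ _ _)
  · intro e
    have := hasRank_level g k (Circle.exp (T i t))
    rw [← e, ← key] at this
    exact this.unique (hasRank_level _ _ _)

/-- The common value of the maps `T i` over the points of the `k`-th level. -/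
noncomputable def levelMap (f : L → Circle → ℝ) (T : L → ℝ → ℝ) (k : ℕ) (t : ℝ) : ℝ :=
  T (exists_eq_level f k (Circle.exp t)).choose t

theorem CurveIso.levelMap_eq {f g : L → Circle → ℝ} {T : L → ℝ → ℝ} (h : CurveIso f g T) {i : L}
    {k : ℕ} {t : ℝ} (hi : f i (Circle.exp t) = level f k (Circle.exp t)) :
    levelMap f T k t = T i t :=
  h.eq_of_eq _ _ _ ((exists_eq_level f k (Circle.exp t)).choose_spec.trans hi.symm)

theorem CurveIso.levelMap_add_two_pi {f g : L → Circle → ℝ} {T : L → ℝ → ℝ} (h : CurveIso f g T)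
    (k : ℕ) (t : ℝ) : levelMap f T k (t + 2 * Real.pi) = levelMap f T k t + 2 * Real.pi := by
  obtain ⟨i, hi⟩ := exists_eq_level f k (Circle.exp t)
  rw [h.levelMap_eq hi, ← h.add_two_pi, h.levelMap_eq]
  rwa [Circle.exp_add_two_pi]

theorem CurveIso.eventually_levelMap {f g : L → Circle → ℝ} {T : L → ℝ → ℝ} (h : CurveIso f g T)
    (hf : ∀ i, Continuous (f i)) (k : ℕ) (t : ℝ) :
    ∀ᶠ s in 𝓝 t, ∃ i, levelMap f T k t = T i t ∧ levelMap f T k s = T i s := by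
  have : ∀ᶠ s in 𝓝 t, ∀ i, f i (Circle.exp t) ≠ level f k (Circle.exp t) →
      f i (Circle.exp s) ≠ level f k (Circle.exp s) := by
    rw [eventually_all]
    intro i
    by_cases hi : f i (Circle.exp t) = level f k (Circle.exp t)
    · exact Eventually.of_forall fun _ h => absurd hi h
    · have hc : Continuous fun s => f i (Circle.exp s) := (hf i).comp Circle.exp.continuous
      have hc' : Continuous fun s => level f k (Circle.exp s) :=
        (continuous_level hf k).comp Circle.exp.continuous
      filter_upwards [(isOpen_ne_fun hc hc').mem_nhds hi] with s hs _ using hs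
  filter_upwards [this] with s hs
  obtain ⟨i, hi⟩ := exists_eq_level f k (Circle.exp s)
  refine ⟨i, h.levelMap_eq ?_, h.levelMap_eq hi⟩
  by_contra hne
  exact hs i hne hi

theorem CurveIso.continuous_levelMap {f g : L → Circle → ℝ} {T : L → ℝ → ℝ} (h : CurveIso f g T)
    (hf : ∀ i, Continuous (f i)) (k : ℕ) : Continuous (levelMap f T k) := by
  rw [continuous_iff_continuousAt]
  intro t
  rw [ContinuousAt, tendsto_def]
  intro U hU
  have : ∀ᶠ s in 𝓝 t, ∀ i, levelMap f T k t = T i t → T i s ∈ U := by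
    rw [eventually_all]
    intro i
    by_cases hi : levelMap f T k t = T i t
    · rw [hi] at hU
      exact ((h.continuous i).continuousAt.eventually hU).mono fun _ h _ => h
    · exact Eventually.of_forall fun _ h => absurd h hi
  filter_upwards [this, h.eventually_levelMap hf k t] with s hs ⟨i, h1, h2⟩
  rw [mem_preimage, h2]
  exact hs i h1

theorem CurveIso.strictMono_levelMap {f g : L → Circle → ℝ} {T : L → ℝ → ℝ} (h : CurveIso f g T)
    (hf : ∀ i, Continuous (f i)) (k : ℕ) : StrictMono (levelMap f T k) := by
  refine strictMono_of_eventually_lt (h.continuous_levelMap hf k) fun t => ?_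
  filter_upwards [nhdsWithin_le_nhds (h.eventually_levelMap hf k t), self_mem_nhdsWithin]
    with s ⟨i, h1, h2⟩ hs
  rw [h1, h2]
  exact h.strictMono i hs

end Level

/-! ### Piecewise linear interpolation -/

/-- The function that increases linearly from `0` to `1` on `[k, k + 1]`. -/
noncomputable def ramp (k : ℕ) (s : ℝ) : ℝ := max 0 (min 1 (s - k))

theorem monotone_ramp (k : ℕ) : Monotone (ramp k) := fun _ _ h =>
  max_le_max le_rfl (min_le_min le_rfl (by linarith))

theorem continuous_ramp (k : ℕ) : Continuous (ramp k) := by unfold ramp; fun_prop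

theorem ramp_nonneg (k : ℕ) (s : ℝ) : 0 ≤ ramp k s := le_max_left _ _

theorem ramp_le_one (k : ℕ) (s : ℝ) : ramp k s ≤ 1 :=
  max_le zero_le_one (min_le_left _ _)

theorem ramp_of_le {k : ℕ} {s : ℝ} (h : s ≤ k) : ramp k s = 0 :=
  max_eq_left ((min_le_right _ _).trans (by linarith))

theorem ramp_of_ge {k : ℕ} {s : ℝ} (h : k + 1 ≤ s) : ramp k s = 1 := by
  rw [ramp, min_eq_left (by linarith), max_eq_right zero_le_one]

/-- The piecewise linear interpolation of the values `u 0, …, u N` at `0, …, N`. -/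
noncomputable def interp (N : ℕ) (u : ℕ → ℝ) (s : ℝ) : ℝ :=
  u 0 + ∑ k ∈ Finset.range N, (u (k + 1) - u k) * ramp k s

theorem interp_succ (N : ℕ) (u : ℕ → ℝ) (s : ℝ) :
    interp (N + 1) u s = interp N u s + (u (N + 1) - u N) * ramp N s := by
  rw [interp, Finset.sum_range_succ, ← add_assoc, interp]

theorem interp_of_ge {N : ℕ} {s : ℝ} (h : N ≤ s) (u : ℕ → ℝ) : interp N u s = u N := by
  induction N with
  | zero => simp [interp]
  | succ N ih =>
    push_cast at h
    rw [interp_succ, ih (by linarith), ramp_of_ge h]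
    ring

theorem interp_eq {N k : ℕ} (hk : k < N) {s : ℝ} (h : k ≤ s) (h' : s ≤ k + 1) (u : ℕ → ℝ) :
    interp N u s = u k + (u (k + 1) - u k) * ramp k s := by
  induction N with
  | zero => omega
  | succ N ih =>
    rw [interp_succ]
    rcases (Nat.lt_succ_iff_lt_or_eq).1 hk with hk | rfl
    · have : (k : ℝ) + 1 ≤ N := by exact_mod_cast hk
      rw [ih hk, ramp_of_le (k := N) (by linarith)]
      ring
    · rw [interp_of_ge h]

theorem interp_nat {N k : ℕ} (hk : k ≤ N) (u : ℕ → ℝ) : interp N u k = u k := by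
  rcases hk.lt_or_eq with hk | rfl
  · rw [interp_eq hk le_rfl (by linarith), ramp_of_le le_rfl]; ring
  · exact interp_of_ge le_rfl u

theorem exists_interp_eq (N : ℕ) (s : ℝ) : ∃ (k l : ℕ) (c : ℝ), 0 ≤ c ∧ c ≤ 1 ∧
    ∀ u, interp N u s = (1 - c) * u k + c * u l := by
  induction N with
  | zero => exact ⟨0, 0, 0, le_rfl, zero_le_one, fun u => by simp [interp]⟩
  | succ N ih =>
    rcases le_total s N with h | h
    · obtain ⟨k, l, c, h0, h1, hu⟩ := ih
      exact ⟨k, l, c, h0, h1, fun u => by rw [interp_succ, hu, ramp_of_le h]; ring⟩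
    · exact ⟨N, N + 1, ramp N s, ramp_nonneg _ _, ramp_le_one _ _, fun u => by
        rw [interp_succ, interp_of_ge h]; ring⟩

theorem interp_strictMono {N : ℕ} {u : ℕ → ℝ → ℝ} (h : ∀ k, StrictMono (u k)) (s : ℝ) :
    StrictMono fun t => interp N (fun k => u k t) s := by
  obtain ⟨k, l, c, h0, h1, hu⟩ := exists_interp_eq N s
  intro a b hab
  have hk := h k hab
  have hl := h l hab
  simp only [hu]
  rcases h0.eq_or_lt with rfl | h0
  · linarith
  · have := mul_lt_mul_of_pos_left hl h0
    have := mul_le_mul_of_nonneg_left hk.le (sub_nonneg.2 h1)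
    linarith

theorem interp_add (N : ℕ) (u : ℕ → ℝ) (a s : ℝ) :
    interp N (fun k => u k + a) s = interp N u s + a := by
  simp only [interp, add_sub_add_right_eq_sub]
  ring

theorem abs_interp_sub_le (N : ℕ) (u : ℕ → ℝ) (a s : ℝ) :
    |interp N u s - a| ≤ |u 0 - a| + ∑ k ∈ Finset.range N, |u (k + 1) - u k| := by
  rw [interp, add_sub_right_comm]
  refine (abs_add_le _ _).trans (add_le_add_right ((Finset.abs_sum_le_sum_abs _ _).trans
    (Finset.sum_le_sum fun k _ => ?_)) _)
  rw [abs_mul, abs_of_nonneg (ramp_nonneg _ _)]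
  exact mul_le_of_le_one_right (abs_nonneg _) (ramp_le_one _ _)

theorem interp_congr {N : ℕ} {u : ℕ → ℝ} {s s' : ℝ}
    (h : ∀ k < N, ramp k s ≠ ramp k s' → u k = u (k + 1)) : interp N u s = interp N u s' := by
  unfold interp
  congr 1
  refine Finset.sum_congr rfl fun k hk => ?_
  by_cases hr : ramp k s = ramp k s'
  · rw [hr]
  · rw [h k (Finset.mem_range.1 hk) hr]; ring

/-- The interpolation of `u 0, …, u N`, continued with slope `1` on both sides of `[0, N]`. -/
noncomputable def interpLine (N : ℕ) (u : ℕ → ℝ) (s : ℝ) : ℝ :=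
  interp N u s + (min s 0 + max (s - N) 0)

theorem abs_interpLine_sub_le (N : ℕ) (u : ℕ → ℝ) (s : ℝ) :
    |interpLine N u s - s| ≤ |u 0| + ∑ k ∈ Finset.range N, |u (k + 1) - u k| + N := by
  have h := abs_interp_sub_le N u 0 s
  have hN : (0 : ℝ) ≤ N := N.cast_nonneg
  have h' : |min s 0 + max (s - N) 0 - s| ≤ N := by
    rw [abs_le]
    rcases le_total s 0 with h1 | h1 <;> rcases le_total (s - N) 0 with h2 | h2 <;>
      simp only [min_eq_left h1, min_eq_right h1, max_eq_left h2, max_eq_right h2] <;>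
      constructor <;> linarith
  rw [sub_zero, sub_zero] at h
  rw [interpLine, add_sub_assoc]
  exact (abs_add_le _ _).trans (add_le_add h h')

theorem interpLine_congr {N : ℕ} {u v : ℕ → ℝ} (hu : ∀ k, u k ≤ u (k + 1)) {s s' : ℝ} (hs : s ≤ s')
    (h : interpLine N u s = interpLine N u s') :
    (∀ k < N, ramp k s ≠ ramp k s' → u k = u (k + 1)) ∧
      ((∀ k < N, ramp k s ≠ ramp k s' → v k = v (k + 1)) →
        interpLine N v s = interpLine N v s') := by
  have h1 : min s 0 + max (s - N) 0 ≤ min s' 0 + max (s' - N) 0 :=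
    add_le_add (min_le_min hs le_rfl) (max_le_max (by linarith) le_rfl)
  have hle : ∀ k ∈ Finset.range N, (u (k + 1) - u k) * ramp k s ≤ (u (k + 1) - u k) * ramp k s' :=
    fun k _ => mul_le_mul_of_nonneg_left (monotone_ramp k hs) (sub_nonneg.2 (hu k))
  have h2 := Finset.sum_le_sum hle
  have h3 := h
  simp only [interpLine, interp] at h3
  have h4 := (Finset.sum_eq_sum_iff_of_le hle).1 (by linarith)
  constructor
  · intro k hk hr
    have h5 := h4 k (Finset.mem_range.2 hk)
    by_contra hne
    exact hr (mul_left_cancel₀ (sub_ne_zero.2 (Ne.symm hne)) h5)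
  · intro hv
    rw [interpLine, interpLine, interp_congr hv]
    linarith

/-! ### Quotient maps -/

theorem isQuotientMap_shear {X : Type*} [TopologicalSpace X] [T2Space X] [LocallyCompactSpace X]
    {F : X × ℝ → ℝ} (hF : Continuous F) {C : ℝ} (hC : ∀ q, |F q - q.2| ≤ C) :
    IsQuotientMap fun q : X × ℝ => (q.1, F q) := by
  have hc : Continuous fun q : X × ℝ => (q.1, F q) := by fun_prop
  refine IsClosedMap.isQuotientMap (IsProperMap.isClosedMap
    (isProperMap_iff_isCompact_preimage.2 ⟨hc, fun K hK => ?_⟩)) hc ?_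
  · obtain ⟨R, hR⟩ := (hK.image continuous_snd).isBounded.exists_norm_le
    refine ((hK.image continuous_fst).prod (isCompact_Icc (a := -R - C) (b := R + C))).of_isClosed_subset
      (hK.isClosed.preimage hc) fun q hq => ⟨⟨_, hq, rfl⟩, ?_⟩
    have h1 := abs_le.1 (hR _ ⟨_, hq, rfl⟩)
    have h2 := abs_le.1 (hC q)
    simp only at h1
    constructor <;> linarith
  · rintro ⟨x, y⟩
    have hx : Continuous fun s => F (x, s) := by fun_prop
    obtain ⟨s, hs⟩ := mem_range_of_exists_le_of_exists_ge hx (c := y)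
      ⟨y - C, by have := abs_le.1 (hC (x, y - C)); simp only at this; linarith⟩
      ⟨y + C, by have := abs_le.1 (hC (x, y + C)); simp only at this; linarith⟩
    exact ⟨(x, s), Prod.ext rfl hs⟩

theorem isQuotientMap_exp_prod : IsQuotientMap fun q : ℝ × ℝ => (Circle.exp q.1, q.2) := by
  have ho : IsOpenMap (Prod.map (Circle.exp : ℝ → Circle) (id : ℝ → ℝ)) :=
    isLocalHomeomorph_circleExp.isOpenMap.prodMap IsOpenMap.id
  refine ho.isQuotientMap (by fun_prop) ?_
  rintro ⟨θ, y⟩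
  exact ⟨(Complex.arg θ, y), Prod.ext (Circle.exp_arg θ) rfl⟩

theorem exists_homeomorph_of_isQuotientMap {X Y Z : Type*} [TopologicalSpace X] [TopologicalSpace Y]
    [TopologicalSpace Z] {p : X → Y} {q : X → Z} (hp : IsQuotientMap p) (hq : IsQuotientMap q)
    (h : ∀ x y, p x = p y ↔ q x = q y) : ∃ φ : Y ≃ₜ Z, ∀ x, φ (p x) = q x := by
  have e1 : ∀ x, q (Function.surjInv hp.surjective (p x)) = q x := fun x =>
    (h _ _).1 (Function.surjInv_eq hp.surjective _)
  have e2 : ∀ x, p (Function.surjInv hq.surjective (q x)) = p x := fun x =>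
    (h _ _).2 (Function.surjInv_eq hq.surjective _)
  refine ⟨⟨⟨fun y => q (Function.surjInv hp.surjective y),
    fun z => p (Function.surjInv hq.surjective z), fun y => ?_, fun z => ?_⟩, ?_, ?_⟩, e1⟩
  · obtain ⟨x, rfl⟩ := hp.surjective y
    simp only [e1, e2]
  · obtain ⟨x, rfl⟩ := hq.surjective z
    simp only [e1, e2]
  · rw [hp.continuous_iff]
    exact hq.continuous.congr fun x => (e1 x).symm
  · rw [hq.continuous_iff]
    exact hp.continuous.congr fun x => (e2 x).symm

/-! ### The homeomorphism that interpolates between levels -/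

theorem eq_of_levels {N : ℕ} {F G : ℕ → Circle → ℝ} {τ : ℕ → ℝ → ℝ}
    (hFm : ∀ k θ, F k θ ≤ F (k + 1) θ)
    (hFG : ∀ k t, F k (Circle.exp t) = F (k + 1) (Circle.exp t) → τ k t = τ (k + 1) t ∧
      G k (Circle.exp (τ k t)) = G (k + 1) (Circle.exp (τ k t)))
    {t s s' : ℝ} (hs : s ≤ s')
    (h : interpLine N (fun k => F k (Circle.exp t)) s =
      interpLine N (fun k => F k (Circle.exp t)) s') :
    interp N (fun k => τ k t) s = interp N (fun k => τ k t) s' ∧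
      interpLine N (fun k => G k (Circle.exp (interp N (fun k => τ k t) s))) s =
        interpLine N (fun k => G k (Circle.exp (interp N (fun k => τ k t) s))) s' := by
  have hK := interpLine_congr (v := fun k => G k (Circle.exp (interp N (fun k => τ k t) s)))
    (fun k => hFm k _) hs h
  have hτ : ∀ k < N, ramp k s ≠ ramp k s' → τ k t = τ (k + 1) t := fun k hk hr =>
    (hFG k t (hK.1 k hk hr)).1
  refine ⟨interp_congr hτ, hK.2 fun k hk hr => ?_⟩
  have hks : (k : ℝ) < s' := by
    by_contra hc
    exact hr (by rw [ramp_of_le (not_lt.1 hc), ramp_of_le (hs.trans (not_lt.1 hc))])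
  have hsk : s < k + 1 := by
    by_contra hc
    exact hr (by rw [ramp_of_ge (not_lt.1 hc), ramp_of_ge ((not_lt.1 hc).trans hs)])
  have h1 : interp N (fun k => τ k t) s = interp N (fun k => τ k t) (max s k) := by
    refine interp_congr fun j hj hr' => hτ j hj fun he => hr' (le_antisymm ?_ ?_)
    · exact monotone_ramp j (le_max_left _ _)
    · rw [he]
      exact monotone_ramp j (max_le hs hks.le)
  rw [interp_eq hk (le_max_right _ _) (max_le hsk.le (by linarith)), ← hτ k hk hr, sub_self,
    zero_mul, add_zero] at h1
  rw [h1]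
  exact (hFG k t (hK.1 k hk hr)).2

theorem eq_of_levels_symm {N : ℕ} {F G : ℕ → Circle → ℝ} {τ : ℕ → ℝ → ℝ}
    (hGm : ∀ k θ, G k θ ≤ G (k + 1) θ) (hτm : ∀ k, StrictMono (τ k))
    (hτs : ∀ k, Function.Surjective (τ k))
    (hFG : ∀ k t, F k (Circle.exp t) = F (k + 1) (Circle.exp t) → τ k t = τ (k + 1) t)
    (hGF : ∀ k t, G k (Circle.exp (τ k t)) = G (k + 1) (Circle.exp (τ k t)) →
      F k (Circle.exp t) = F (k + 1) (Circle.exp t))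
    {t t' s s' : ℝ} (hs : s ≤ s')
    (ht : interp N (fun k => τ k t) s = interp N (fun k => τ k t') s')
    (h : interpLine N (fun k => G k (Circle.exp (interp N (fun k => τ k t) s))) s =
        interpLine N (fun k => G k (Circle.exp (interp N (fun k => τ k t) s))) s') :
    t = t' ∧ interpLine N (fun k => F k (Circle.exp t)) s =
      interpLine N (fun k => F k (Circle.exp t)) s' := by
  have hK := interpLine_congr (v := fun k => F k (Circle.exp t)) (fun k => hGm k _) hs h
  have hF : ∀ k < N, ramp k s ≠ ramp k s' → F k (Circle.exp t) = F (k + 1) (Circle.exp t) := by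
    intro k
    induction k using Nat.strong_induction_on with
    | _ k ih =>
      intro hk hr
      have hks : (k : ℝ) < s' := by
        by_contra hc
        exact hr (by rw [ramp_of_le (not_lt.1 hc), ramp_of_le (hs.trans (not_lt.1 hc))])
      have hsk : s < k + 1 := by
        by_contra hc
        exact hr (by rw [ramp_of_ge (not_lt.1 hc), ramp_of_ge ((not_lt.1 hc).trans hs)])
      have h1 : interp N (fun k => τ k t) s = interp N (fun k => τ k t) (max s k) := by
        refine interp_congr fun j hj hr' => hFG j t (ih j ?_ hj fun he => hr' (le_antisymm ?_ ?_))
        · by_contra hc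
          refine hr' ?_
          rcases le_total s k with h2 | h2
          · have h3 : (k : ℝ) ≤ j := by exact_mod_cast not_lt.1 hc
            rw [max_eq_right h2, ramp_of_le h3, ramp_of_le (h2.trans h3)]
          · rw [max_eq_left h2]
        · exact monotone_ramp j (le_max_left _ _)
        · rw [he]
          exact monotone_ramp j (max_le hs hks.le)
      obtain ⟨x, hx⟩ := hτs k (interp N (fun k => τ k t) s)
      have h2 := hK.1 k hk hr
      rw [← hx] at h2
      have h3 := hGF k x h2
      have h4 := hFG k x h3
      have h5 : interp N (fun k => τ k x) (max s k) = τ k x := by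
        rw [interp_eq hk (le_max_right _ _) (max_le hsk.le (by linarith)), ← h4]
        ring
      rw [hx, h1] at h5
      rwa [← (interp_strictMono hτm _).injective h5]
  refine ⟨?_, hK.2 hF⟩
  rw [interp_congr (s' := s') fun k hk hr => hFG k t (hF k hk hr)] at ht
  exact (interp_strictMono hτm _).injective ht

theorem exists_homeomorph_of_levels (N : ℕ) {F G : ℕ → Circle → ℝ} {τ : ℕ → ℝ → ℝ}
    (hF : ∀ k, Continuous (F k)) (hG : ∀ k, Continuous (G k)) (hτ : ∀ k, Continuous (τ k))
    (hFm : ∀ k θ, F k θ ≤ F (k + 1) θ) (hGm : ∀ k θ, G k θ ≤ G (k + 1) θ)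
    (hτm : ∀ k, StrictMono (τ k)) (hτp : ∀ k t, τ k (t + 2 * Real.pi) = τ k t + 2 * Real.pi)
    (hFG : ∀ k t, F k (Circle.exp t) = F (k + 1) (Circle.exp t) → τ k t = τ (k + 1) t ∧
      G k (Circle.exp (τ k t)) = G (k + 1) (Circle.exp (τ k t)))
    (hGF : ∀ k t, G k (Circle.exp (τ k t)) = G (k + 1) (Circle.exp (τ k t)) →
      F k (Circle.exp t) = F (k + 1) (Circle.exp t)) :
    ∃ φ : Circle × ℝ ≃ₜ Circle × ℝ, ∀ t s,
      φ (Circle.exp t, interpLine N (fun k => F k (Circle.exp t)) s) =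
        (Circle.exp (interp N (fun k => τ k t) s),
          interpLine N (fun k => G k (Circle.exp (interp N (fun k => τ k t) s))) s) := by
  have hshear : ∀ {F : ℕ → Circle → ℝ}, (∀ k, Continuous (F k)) →
      IsQuotientMap fun q : Circle × ℝ => (q.1, interpLine N (fun k => F k q.1) q.2) := by
    intro F hF
    have hc : Continuous fun θ => |F 0 θ| + ∑ k ∈ Finset.range N, |F (k + 1) θ - F k θ| + N := by
      fun_prop
    obtain ⟨C, hC⟩ := exists_forall_lt hc
    refine isQuotientMap_shear (F := fun q => interpLine N (fun k => F k q.1) q.2) ?_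
      fun q => (abs_interpLine_sub_le _ _ _).trans (hC q.1).le
    have := continuous_ramp
    unfold interpLine interp
    fun_prop
  have hτq : IsQuotientMap fun q : ℝ × ℝ => (interp N (fun k => τ k q.1) q.2, q.2) := by
    have hc : Continuous fun t => |τ 0 t - t| + ∑ k ∈ Finset.range N, |τ (k + 1) t - τ k t| := by
      fun_prop
    have hper : Function.Periodic
        (fun t => |τ 0 t - t| + ∑ k ∈ Finset.range N, |τ (k + 1) t - τ k t|) (2 * Real.pi) := by
      intro t
      simp only [hτp, add_sub_add_right_eq_sub]
    obtain ⟨C, hC⟩ := (hper.compact_of_continuous Real.two_pi_pos.ne' hc).bddAbove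
    have h1 := isQuotientMap_shear (X := ℝ) (F := fun q => interp N (fun k => τ k q.2) q.1) (C := C)
      (by have := continuous_ramp; unfold interp; fun_prop)
      fun q => (abs_interp_sub_le _ _ _ _).trans (hC ⟨q.2, rfl⟩)
    exact (Homeomorph.prodComm ℝ ℝ).isQuotientMap.comp
      (h1.comp (Homeomorph.prodComm ℝ ℝ).isQuotientMap)
  have key := exists_homeomorph_of_isQuotientMap ((hshear hF).comp isQuotientMap_exp_prod)
    ((hshear hG).comp (isQuotientMap_exp_prod.comp hτq)) ?_
  · obtain ⟨φ, hφ⟩ := key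
    exact ⟨φ, fun t s => hφ (t, s)⟩
  have hper : ∀ (m : ℤ) t s, interp N (fun k => τ k (t + m * (2 * Real.pi))) s =
      interp N (fun k => τ k t) s + m * (2 * Real.pi) := by
    intro m t s
    simp only [add_int_mul_two_pi (hτp _), interp_add]
  have main : ∀ t s t' s', s ≤ s' →
      ((Circle.exp t = Circle.exp t' ∧ interpLine N (fun k => F k (Circle.exp t)) s =
        interpLine N (fun k => F k (Circle.exp t')) s') ↔
      (Circle.exp (interp N (fun k => τ k t) s) = Circle.exp (interp N (fun k => τ k t') s') ∧
        interpLine N (fun k => G k (Circle.exp (interp N (fun k => τ k t) s))) s =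
        interpLine N (fun k => G k (Circle.exp (interp N (fun k => τ k t') s'))) s')) := by
    intro t s t' s' hs
    constructor
    · rintro ⟨h1, h2⟩
      rw [← h1] at h2
      obtain ⟨h3, h4⟩ := eq_of_levels hFm hFG hs h2
      obtain ⟨m, hm⟩ := Circle.exp_eq_exp.1 h1.symm
      have h5 : Circle.exp (interp N (fun k => τ k t) s) =
          Circle.exp (interp N (fun k => τ k t') s') := by
        rw [hm, hper, h3, exp_add_int_mul]
      rw [← h5]
      exact ⟨rfl, h4⟩
    · rintro ⟨h1, h2⟩
      rw [← h1] at h2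
      obtain ⟨m, hm⟩ := Circle.exp_eq_exp.1 h1
      rw [← hper] at hm
      obtain ⟨h3, h4⟩ := eq_of_levels_symm hGm hτm
        (fun k => surjective_of_add_two_pi (hτ k) (hτp k)) (fun k t h => (hFG k t h).1) hGF hs hm h2
      have h5 : Circle.exp t = Circle.exp t' := by rw [h3, exp_add_int_mul]
      rw [← h5]
      exact ⟨rfl, h4⟩
  rintro ⟨t, s⟩ ⟨t', s'⟩
  simp only [Function.comp_apply, Prod.mk.injEq]
  rcases le_total s s' with hs | hs
  · exact main t s t' s' hs
  · have := main t' s' t s hs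
    rw [eq_comm, eq_comm (a := interpLine N (fun k => F k (Circle.exp t')) s'), eq_comm (a :=
      Circle.exp (interp N (fun k => τ k t') s')), eq_comm (b := interpLine N (fun k =>
      G k (Circle.exp (interp N (fun k => τ k t) s))) s)] at this
    exact this

/-! ### From isomorphisms of curve systems to homeomorphisms of the cylinder -/

theorem CurveIso.withTop {L : Type*} {f g : L → Circle → ℝ} {T : L → ℝ → ℝ} (h : CurveIso f g T)
    {M : ℝ} (hf : ∀ i θ, f i θ < M) (hg : ∀ i θ, g i θ < M) :
    CurveIso (fun o : Option L => o.elim (fun _ => M) f) (fun o : Option L => o.elim (fun _ => M) g)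
      (fun o : Option L => o.elim id T) where
  strictMono i := by
    cases i with
    | none => exact strictMono_id
    | some i => exact h.strictMono i
  continuous i := by
    cases i with
    | none => exact continuous_id
    | some i => exact h.continuous i
  add_two_pi i t := by
    cases i with
    | none => rfl
    | some i => exact h.add_two_pi i t
  lt_iff i j t := by
    cases i <;> cases j
    · exact Iff.rfl
    · exact iff_of_false (hf _ _).not_gt (hg _ _).not_gt
    · exact iff_of_true (hf _ _) (hg _ _)
    · exact h.lt_iff _ _ t
  gt_iff i j t := by
    cases i <;> cases j
    · exact Iff.rfl
    · exact iff_of_true (hf _ _) (hg _ _)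
    · exact iff_of_false (hf _ _).not_gt (hg _ _).not_gt
    · exact h.gt_iff _ _ t
  eq_of_eq i j t e := by
    cases i <;> cases j
    · rfl
    · exact absurd e (hf _ _).ne'
    · exact absurd e (hf _ _).ne
    · exact h.eq_of_eq _ _ t e

theorem exists_forall_forall_lt {L : Type*} [Finite L] {f : L → Circle → ℝ}
    (hf : ∀ i, Continuous (f i)) : ∃ M, ∀ i θ, f i θ < M := by
  choose C hC using fun i => exists_forall_lt (hf i)
  obtain ⟨M, hM⟩ := (finite_range C).bddAbove
  exact ⟨M, fun i θ => (hC i θ).trans_le (hM ⟨i, rfl⟩)⟩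

theorem level_eq_of_forall_le {L : Type*} [Finite L] [Nonempty L] {f : L → Circle → ℝ} {M : ℝ}
    {i : L} (hi : ∀ θ, f i θ = M) (hle : ∀ j θ, f j θ ≤ M) (θ : Circle) :
    level f (Nat.card L - 1) θ = M := by
  refine (hasRank_level f _ θ).unique ⟨?_, ?_⟩
  · have : {j | f j θ < M}.ncard < Nat.card L := by
      rw [← ncard_univ]
      exact ncard_lt_ncard ⟨subset_univ _, fun h => (h (mem_univ i) : f i θ < M).ne (hi θ)⟩
    simp only [min_self]
    omega
  · rw [show {j | f j θ ≤ M} = univ from eq_univ_of_forall fun j => hle j θ, ncard_univ]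
    have := Nat.card_pos (α := L)
    omega

theorem CurveIso.exists_homeomorph {L : Type*} [Finite L] {f g : L → Circle → ℝ} {T : L → ℝ → ℝ}
    (h : CurveIso f g T) (hf : ∀ i, Continuous (f i)) (hg : ∀ i, Continuous (g i)) :
    ∃ φ : Circle × ℝ ≃ₜ Circle × ℝ, PreservesOrientation φ ∧ PreservesTop φ ∧
      ∀ i, φ '' curve (f i) = curve (g i) := by
  obtain ⟨M₁, hM₁⟩ := exists_forall_forall_lt hf
  obtain ⟨M₂, hM₂⟩ := exists_forall_forall_lt hg
  set M := max M₁ M₂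
  replace hM₁ : ∀ i θ, f i θ < M := fun i θ => (hM₁ i θ).trans_le (le_max_left _ _)
  replace hM₂ : ∀ i θ, g i θ < M := fun i θ => (hM₂ i θ).trans_le (le_max_right _ _)
  have H := h.withTop hM₁ hM₂
  set f' : Option L → Circle → ℝ := fun o => o.elim (fun _ => M) f with hf'
  set g' : Option L → Circle → ℝ := fun o => o.elim (fun _ => M) g with hg'
  set T' : Option L → ℝ → ℝ := fun o => o.elim id T with hT'
  have hfc : ∀ i, Continuous (f' i) := by
    rintro (_ | i)
    exacts [continuous_const, hf i]
  have hgc : ∀ i, Continuous (g' i) := by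
    rintro (_ | i)
    exacts [continuous_const, hg i]
  set N := Nat.card (Option L) - 1 with hN
  have hFG : ∀ k t, level f' k (Circle.exp t) = level f' (k + 1) (Circle.exp t) →
      levelMap f' T' k t = levelMap f' T' (k + 1) t ∧
      level g' k (Circle.exp (levelMap f' T' k t)) =
        level g' (k + 1) (Circle.exp (levelMap f' T' k t)) := by
    intro k t hk
    obtain ⟨i, hi⟩ := exists_eq_level f' k (Circle.exp t)
    rw [H.levelMap_eq hi, H.levelMap_eq (hi.trans hk)]
    exact ⟨rfl, ((H.eq_level_iff i k t).1 hi).symm.trans ((H.eq_level_iff i (k + 1) t).1 (hi.trans hk))⟩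
  have hGF : ∀ k t, level g' k (Circle.exp (levelMap f' T' k t)) =
        level g' (k + 1) (Circle.exp (levelMap f' T' k t)) →
      level f' k (Circle.exp t) = level f' (k + 1) (Circle.exp t) := by
    intro k t hk
    obtain ⟨i, hi⟩ := exists_eq_level f' k (Circle.exp t)
    rw [H.levelMap_eq hi] at hk
    rw [← hi]
    exact (H.eq_level_iff i (k + 1) t).2 (((H.eq_level_iff i k t).1 hi).trans hk)
  obtain ⟨φ, hφ⟩ := exists_homeomorph_of_levels N (fun k => continuous_level hfc k)
    (fun k => continuous_level hgc k) (fun k => H.continuous_levelMap hfc k)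
    (fun k θ => level_mono f' θ k) (fun k θ => level_mono g' θ k)
    (fun k => H.strictMono_levelMap hfc k) (fun k t => H.levelMap_add_two_pi k t) hFG hGF
  have htopf : ∀ θ, level f' N θ = M := level_eq_of_forall_le (i := none) (fun _ => rfl) (by
    rintro (_ | j) θ
    exacts [le_rfl, (hM₁ j θ).le])
  have htopg : ∀ θ, level g' N θ = M := level_eq_of_forall_le (i := none) (fun _ => rfl) (by
    rintro (_ | j) θ
    exacts [le_rfl, (hM₂ j θ).le])
  have htopτ : ∀ t, levelMap f' T' N t = t := fun t =>
    H.levelMap_eq (i := none) (htopf _).symm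
  have hid : ∀ q : Circle × ℝ, M ≤ q.2 → φ q = q := by
    rintro ⟨θ, y⟩ hy
    obtain ⟨t, rfl⟩ : ∃ t, Circle.exp t = θ := ⟨_, Circle.exp_arg θ⟩
    have hy : M ≤ y := hy
    have hN0 : (0 : ℝ) ≤ N := N.cast_nonneg
    have key : ∀ u : ℕ → ℝ, u N = M → interpLine N u (N + (y - M)) = y := by
      intro u hu
      rw [interpLine, interp_of_ge (by linarith), min_eq_right (by linarith),
        max_eq_left (by linarith), hu]
      ring
    have := hφ t (N + (y - M))
    rw [key _ (htopf _), interp_of_ge (by linarith), key _ (htopg _), htopτ] at this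
    exact this
  have hcurve : ∀ i t, φ (Circle.exp t, f i (Circle.exp t)) =
      (Circle.exp (T i t), g i (Circle.exp (T i t))) := by
    intro i t
    have hi := exists_level_eq f' (some i) (Circle.exp t)
    obtain ⟨k, hkN, hk⟩ : ∃ k ≤ N, f' (some i) (Circle.exp t) = level f' k (Circle.exp t) := by
      obtain ⟨k, hk⟩ := hi
      refine ⟨min k N, min_le_right _ _, hk.trans ?_⟩
      rw [level, level, hN, min_assoc, min_self]
    have key : ∀ u : ℕ → ℝ, interpLine N u k = u k := by
      intro u
      have h1 : (k : ℝ) ≤ N := by exact_mod_cast hkN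
      have h2 : (0 : ℝ) ≤ k := k.cast_nonneg
      rw [interpLine, interp_nat hkN, min_eq_right h2, max_eq_right (by linarith), add_zero, add_zero]
    have := hφ t k
    rw [key, key, interp_nat hkN, H.levelMap_eq hk, ← hk, ← (H.eq_level_iff _ _ _).1 hk] at this
    exact this
  refine ⟨φ, preservesOrientation_of_hasLocalDegreeOne φ (p₀ := (1, M + 1))
    (hasLocalDegreeOne_of_eventually_id ?_), ⟨max M 1, fun y hy θ => ?_⟩, fun i => ?_⟩
  · have : ∀ᶠ q : Circle × ℝ in 𝓝 (1, M + 1), M < q.2 :=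
      continuous_snd.continuousAt.eventually (lt_mem_nhds (by simp))
    exact this.mono fun q hq => hid q hq.le
  · rw [hid (θ, y) ((le_max_left _ _).trans hy)]
    exact zero_lt_one.trans_le ((le_max_right _ _).trans hy)
  · ext ⟨θ, y⟩
    constructor
    · rintro ⟨⟨θ', y'⟩, hq, he⟩
      obtain ⟨t, rfl⟩ : ∃ t, Circle.exp t = θ' := ⟨_, Circle.exp_arg θ'⟩
      have hq : y' = f i (Circle.exp t) := hq
      rw [hq, hcurve] at he
      rw [← he]
      rfl
    · intro hq
      have hq : y = g i θ := hq
      obtain ⟨t, rfl⟩ : ∃ t, Circle.exp t = θ := ⟨_, Circle.exp_arg θ⟩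
      obtain ⟨t, rfl⟩ := surjective_of_add_two_pi (h.continuous i) (h.add_two_pi i) t
      exact ⟨(Circle.exp t, f i (Circle.exp t)), rfl, by rw [hcurve, hq]⟩

theorem CurveIso.symm {L : Type*} {f g : L → Circle → ℝ} {T : L → ℝ → ℝ} (h : CurveIso f g T) :
    ∃ T', CurveIso g f T' := by
  let e : L → ℝ ≃o ℝ := fun i => (h.strictMono i).orderIsoOfSurjective (T i)
    (surjective_of_add_two_pi (h.continuous i) (h.add_two_pi i))
  have he : ∀ i t, T i ((e i).symm t) = t := fun i t => (e i).apply_symm_apply t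
  have he' : ∀ i t, (e i).symm (T i t) = t := fun i t => (e i).symm_apply_apply t
  refine ⟨fun i => (e i).symm, fun i => (e i).symm.strictMono, fun i => (e i).symm.continuous,
    fun i t => ?_, fun i j t => ?_, fun i j t => ?_, fun i j t hij => ?_⟩
  · apply (h.strictMono i).injective
    rw [he, h.add_two_pi, he]
  · rw [h.lt_iff, he]
  · rw [h.gt_iff, he]
  · have h1 := h.eq_iff i j ((e i).symm t)
    rw [he] at h1
    have h2 := h.eq_of_eq i j _ (h1.2 hij)
    rw [he] at h2
    show (e i).symm t = (e j).symm t
    conv_rhs => rw [h2, he']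

/-! ### Arrangements -/

section Arrangement

variable {L : Type*}

theorem Arrangement.isCurveSystem (A : Arrangement L) : IsCurveSystem A.support where
  continuous i := by
    have := (A.isCompact_body i).continuous_sSup
      (f := fun (θ : Circle) (p : ℂ) => inner ℝ (θ : ℂ) p) (by unfold Function.HasUncurry.uncurry; fun_prop)
    exact this
  cross := A.transversal
  no_triple i j k hij hik hjk θ h1 h2 := by
    refine A.no_triple_tangent i j k hij hik hjk (θ, A.support i θ) ?_
    simp only [isSupportingTangent_iff (A.isCompact_body _) (A.nonempty_body _)]
    exact ⟨rfl, h1.symm, h2.symm⟩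
  finite_crossings := by
    refine Finite.of_injOn (f := fun p : ℝ ×ₗ ℝ => (Circle.exp (ofLex p).1, (ofLex p).2)) ?_ ?_
      A.finite_tangents
    · rintro p ⟨_, i, j, hij, h1, h2⟩
      refine ⟨i, j, hij, ?_⟩
      simp only [isSupportingTangent_iff (A.isCompact_body _) (A.nonempty_body _)]
      exact ⟨h1, h2⟩
    · rintro p ⟨hp, _⟩ q ⟨hq, _⟩ he
      obtain ⟨h1, h2⟩ := Prod.mk.inj he
      obtain ⟨m, hm⟩ := Circle.exp_eq_exp.1 h1
      have h3 := eq_of_mem_Ioc_translate hp hq hm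
      exact ofLex.injective (Prod.ext h3 h2)

variable [Fintype L]

theorem exists_timedWord_iff_of_step {g : L → Circle → ℝ} (hg : IsCurveSystem g) {P Q : SwapPair L}
    (h : SwapPair.Step P Q) : (∃ s, s.map Prod.fst = P.swaps ∧ TimedWord g P.order s) ↔
      ∃ s, s.map Prod.fst = Q.swaps ∧ TimedWord g Q.order s := by
  cases h with
  | cyclicShift i w hP hQ ho =>
    rw [hP, hQ]
    have ho' : Q.order = swapAt i P.order := ho
    constructor
    · rintro ⟨s, hs, H⟩
      obtain ⟨⟨_, b⟩, s, rfl, rfl, rfl⟩ := List.map_eq_cons_iff.1 hs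
      exact ⟨s ++ [(_, turn 1 b)], by simp, ho' ▸ H.cyclicShift hg⟩
    · rintro ⟨s, hs, H⟩
      obtain ⟨s, r, rfl, rfl, hr⟩ := List.map_eq_append_iff.1 hs
      obtain ⟨x, rfl, rfl⟩ := List.map_eq_singleton_iff.1 hr
      refine ⟨(x.1, turn (-1) x.2) :: s, rfl, ?_⟩
      have := TimedWord.cyclicShift_symm (h := x.1) (b := x.2) hg H
      rwa [ho', swapAt_swapAt] at this
  | independent i j w v hP hQ ho hfar =>
    have key : ∀ {i j : Fin (Fintype.card L - 1)} {ρ : Fin (Fintype.card L) ≃ L},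
        ((i : ℕ) + 1 < j ∨ (j : ℕ) + 1 < i) →
        (∃ s, s.map Prod.fst = w ++ i :: j :: v ∧ TimedWord g ρ s) →
        ∃ s, s.map Prod.fst = w ++ j :: i :: v ∧ TimedWord g ρ s := by
      rintro i j ρ hfar ⟨s, hs, H⟩
      obtain ⟨s, r, rfl, rfl, hr⟩ := List.map_eq_append_iff.1 hs
      obtain ⟨x, r, rfl, rfl, hr'⟩ := List.map_eq_cons_iff.1 hr
      obtain ⟨y, r, rfl, rfl, rfl⟩ := List.map_eq_cons_iff.1 hr'
      exact ⟨s ++ y :: x :: r, by simp, H.independent hfar⟩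
    rw [hP, hQ, ho]
    exact ⟨key hfar, key hfar.symm⟩

theorem exists_timedWord_iff_of_equivalent {g : L → Circle → ℝ} (hg : IsCurveSystem g)
    {P Q : SwapPair L} (h : P.Equivalent Q) :
    (∃ s, s.map Prod.fst = P.swaps ∧ TimedWord g P.order s) ↔
      ∃ s, s.map Prod.fst = Q.swaps ∧ TimedWord g Q.order s := by
  induction h with
  | rel _ _ h => exact exists_timedWord_iff_of_step hg h
  | refl => rfl
  | symm _ _ _ ih => exact ih.symm
  | trans _ _ _ _ _ ih₁ ih₂ => exact ih₁.trans ih₂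

theorem CurveIso.exists_isSwapPairOf {f g : L → Circle → ℝ} {T : L → ℝ → ℝ} (h : CurveIso f g T)
    (hf : IsCurveSystem f) (hg : IsCurveSystem g) {P : SwapPair L} (hP : IsSwapPairOf f P) :
    ∃ Q, IsSwapPairOf g Q ∧ P.Equivalent Q := by
  obtain ⟨s, hs, H⟩ := hP.exists_timedWord hf
  obtain ⟨s', hs', H'⟩ := h.exists_timedWord H
  obtain ⟨ρ, s'', H'', hsort, hwin, heq⟩ := H'.exists_normal hg
  refine ⟨H''.swapPair, H''.isSwapPairOf hg hsort hwin, ?_⟩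
  have : H'.swapPair = P := by
    obtain ⟨ρ', w, hw⟩ := P
    simp only [TimedWord.swapPair, SwapPair.mk.injEq, true_and]
    exact hs'.trans hs
  rwa [this] at heq

theorem CurveIso.combinatorialType_subset {A B : Arrangement L} {T : L → ℝ → ℝ}
    (h : CurveIso A.support B.support T) : A.combinatorialType ⊆ B.combinatorialType := by
  rintro X ⟨P, hP, hPX⟩
  obtain ⟨Q, hQ, hPQ⟩ := h.exists_isSwapPairOf A.isCurveSystem B.isCurveSystem hP
  exact ⟨Q, hQ, .trans _ _ _ (.symm _ _ hPQ) hPX⟩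

theorem exists_curveIso_of_combinatorialType_eq {A B : Arrangement L}
    (h : A.combinatorialType = B.combinatorialType) : ∃ T, CurveIso A.support B.support T := by
  obtain ⟨P, hP⟩ := exists_isSwapPairOf A.isCurveSystem
  obtain ⟨Q, hQ, hQP⟩ : P ∈ B.combinatorialType := h ▸ ⟨P, hP, .refl _⟩
  obtain ⟨s, hs, H⟩ := hP.exists_timedWord A.isCurveSystem
  obtain ⟨s', hs', H'⟩ := (exists_timedWord_iff_of_equivalent B.isCurveSystem hQP).1
    (hQ.exists_timedWord B.isCurveSystem)
  exact exists_curveIso_of_timedWord A.isCurveSystem B.isCurveSystem H H' (hs.trans hs'.symm)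

end Arrangement

end ConvexArrangement

open ConvexArrangement in
theorem mainTheorem3 {L : Type*} [Fintype L] [Nonempty L] (A B : Arrangement L) :
    A.combinatorialType = B.combinatorialType ↔
      ∃ φ : Circle × ℝ ≃ₜ Circle × ℝ, PreservesOrientation φ ∧ PreservesTop φ ∧
        ∀ i, φ '' A.dualCurve i = B.dualCurve i := by
  constructor
  · intro h
    obtain ⟨T, hT⟩ := exists_curveIso_of_combinatorialType_eq h
    exact hT.exists_homeomorph A.isCurveSystem.continuous B.isCurveSystem.continuous
  · rintro ⟨φ, hor, htop, hφ⟩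
    obtain ⟨T, hT⟩ := exists_curveIso_of_homeomorph A.isCurveSystem.continuous
      B.isCurveSystem.continuous hor htop hφ
    obtain ⟨T', hT'⟩ := hT.symm
    exact hT.combinatorialType_subset.antisymm hT'.combinatorialType_subset
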